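/- **Ensemble.** For each $N$ let $M=M^{(N)}$ be a random $N\times N$ complex matrix whose entries have finite moments of all orders. A *loop* of length $n\ge 1$ is a product $M_{i_1i_2}M_{i_2i_3}\cdots M_{i_ni_1}$ with pairwise distinct $i_1,\dots,i_n\in\{1,\dots,N\}$. Assume, with all error bounds uniform in the indices and with constants depending only on the total number of matrix entries involved: (i) (local $U(1)$-invariance) for all real angles $\theta_1,\dots,\theta_N$ the matrices $(M_{ij})_{ij}$ and $(e^{-i\theta_i}M_{ij}e^{i\theta_j})_{ij}$ have the same law; (ii) $\mathbb E[M_{i_1i_2}\cdots M_{i_ni_1}]=O(N^{1-n})$ for every loop of length $n$; (iii) (factorization at leading order) if $L_1,\dots,L_r$ are loops of lengths $n_1,\dots,n_r$ such that each $L_k$ has at most one index in common with the union of the index sets of $L_{k+1},\dots,L_r$ (for two loops: at most the coincidence $i_1=j_1$), then $$\mathbb E[L_1\cdots L_r]=\mathbb E[L_1]\cdots\mathbb E[L_r]+O\big(N^{-1}\,N^{(1-n_1)+\cdots+(1-n_r)}\big);$$ and for arbitrary coincidences of indices between the loops one still has $\mathbb E[L_1\cdots L_r]=O(N^{(1-n_1)+\cdots+(1-n_r)})$,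 provided the product $L_1\cdots L_r$ cannot be rewritten as a product of more than $r$ loops. **Local free cumulants.** Assume that for every $n\ge1$ and all $x\in[0,1]^n$ with pairwise distinct coordinates the limit $$g_n(x_1,\dots,x_n)=\lim_{N\to\infty}N^{n-1}\,\mathbb E[M_{i_1i_2}M_{i_2i_3}\cdots M_{i_ni_1}]^c$$ exists, where $\mathbb E[\cdots]^c$ is the joint cumulant of the $n$ entries and the indices $i_k$ are distinct with $|x_k-i_k/N|\le 1/N$ (the limit is uniform over the choice of such indices). **Generating functions.** Let $h:[0,1]\to[0,\infty)$ be bounded and continuous almost everywhere (for instance the indicator function of a finite union of intervals), identify $h$ with the diagonal matrix with entries $h_{ii}=h(i/N)$, and put $M_h=h^{1/2}Mh^{1/2}$ and $\underline{\mathrm{tr}}=\mathrm{Tr}/N$. As formal power series in $1/z$, with limits taken coefficient by coefficient, let $$F[h](z)=\lim_{N\to\infty}\mathbb E\,\underline{\mathrm{tr}}\log(z-M_h)=\log z-\sum_{n\ge1}\frac{z^{-n}}{n}\lim_{N\to\infty}\mathbb E\,\underline{\mathrm{tr}}(M_h^n),\qquad G[h](z)=\lim_{N\to\infty}\mathbb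 E\,\underline{\mathrm{tr}}(z-M_h)^{-1}=\sum_{n\ge0}z^{-n-1}\lim_{N\to\infty}\mathbb E\,\underline{\mathrm{tr}}(M_h^n).$$ **Variational problem.** Let $a_z,b_z$ range over formal power series in $1/z$ with coefficients in $L^\infty[0,1]$, where $a_z$ has no constant term, and put $$F_0[p]=\sum_{n\ge1}\frac1n\int_{[0,1]^n}g_n(x_1,\dots,x_n)\,p(x_1)\cdots p(x_n)\,dx_1\cdots dx_n,$$ $$S[a_z,b_z]=\int_0^1\big[\log(z-h(x)b_z(x))+a_z(x)b_z(x)\big]dx-F_0[a_z],$$ where $\log(z-hb_z)=\log z+\log(1-hb_z/z)$ is expanded in powers of $1/z$. A pair $(a_z,b_z)$ is an *extremum* of $S$ if the first variation of $S$ at $(a_z,b_z)$ vanishes in all admissible directions, coefficient by coefficient. **Theorem 1.** The action $S$ has an extremum. A pair $(a_z,b_z)$ is an extremum if and only if $$a_z(x)=\frac{h(x)}{z-h(x)b_z(x)}\ \text{ for almost every }x\in[0,1],\qquad b_z=\frac{\delta F_0[a_z]}{\delta a_z}.$$ The limits defining $F[h]$ and $G[h]$ exist, and at every extremum $$F[h](z)=\int_0^1\big[\log(z-h(x)b_z(x))+a_z(x)b_z(x)\big]dx-F_0[a_z],\qquad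 G[h](z)=\int_0^1\frac{dx}{z-h(x)b_z(x)} .$$ -/

import Mathlib

open MeasureTheory ProbabilityTheory Filter Topology
open scoped ENNReal PowerSeries

/-! ### Loops of matrix entries -/

/-- A loop on `N` sites without repeated index: pairwise distinct indices `i₁, …, iₙ`, `n ≥ 1`,
standing for the product of matrix entries `M_{i₁i₂} M_{i₂i₃} ⋯ M_{iₙi₁}`. -/
structure MatLoop (N : ℕ) where
  /-- the number `n` of indices -/
  len : ℕ
  /-- the indices -/
  idx : Fin len → Fin N
  len_pos : 0 < len
  inj : Function.Injective idx

/-- The product `A_{i₁i₂} A_{i₂i₃} ⋯ A_{iₙi₁}` along a loop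
(`finRotate n` is the cyclic successor `k ↦ k + 1` on `Fin n`). -/
def MatLoop.value {N : ℕ} (ℓ : MatLoop N) (A : Matrix (Fin N) (Fin N) ℂ) : ℂ :=
  ∏ k, A (ℓ.idx k) (ℓ.idx (finRotate ℓ.len k))

/-- The set of indices visited by a loop. -/
def MatLoop.vertices {N : ℕ} (ℓ : MatLoop N) : Finset (Fin N) :=
  Finset.univ.image ℓ.idx

/-- The positions `(i₁, i₂), (i₂, i₃), …, (iₙ, i₁)` of the entries in a loop. -/
def MatLoop.edges {N : ℕ} (ℓ : MatLoop N) : Multiset (Fin N × Fin N) :=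
  (Finset.univ : Finset (Fin ℓ.len)).val.map fun k => (ℓ.idx k, ℓ.idx (finRotate ℓ.len k))

/-- Total number of matrix entries in a product of loops. -/
def loopsLen {N : ℕ} (L : List (MatLoop N)) : ℕ := (L.map MatLoop.len).sum

/-- All indices visited by a family of loops. -/
def loopsVertices {N : ℕ} (L : List (MatLoop N)) : Finset (Fin N) :=
  L.foldr (fun ℓ s => ℓ.vertices ∪ s) ∅

/-- The multiset of positions of the matrix entries in a product of loops. -/
def loopsEdges {N : ℕ} (L : List (MatLoop N)) : Multiset (Fin N × Fin N) :=
  (L.map MatLoop.edges).sum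

/-- A product of loops, as a function of the matrix. -/
def loopsValue {N : ℕ} (L : List (MatLoop N)) (A : Matrix (Fin N) (Fin N) ℂ) : ℂ :=
  (L.map fun ℓ => ℓ.value A).prod

/-- The loops are attached to one another at single indices at most: each of them shares at most
one index with all those that come after it in the list. For two loops: up to relabelling, at most
the coincidence `i₁ = j₁`. -/
def LoopsPinched {N : ℕ} : List (MatLoop N) → Prop
  | [] => True
  | ℓ :: L => (ℓ.vertices ∩ loopsVertices L).card ≤ 1 ∧ LoopsPinched L

/-- The product of loops cannot be rewritten as a product of a larger number of loops. -/
def LoopsFinest {N : ℕ} (L : List (MatLoop N)) : Prop :=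
  ∀ L' : List (MatLoop N), loopsEdges L' = loopsEdges L → L'.length ≤ L.length

/-! ### The random matrix ensembles and their local free cumulants -/

/-- A sequence of random `N × N` complex matrices with finite moments such that, for `N → ∞`,
the three defining properties hold. -/
structure IsLoopEnsemble {Ω : ℕ → Type*} [∀ N, MeasurableSpace (Ω N)]
    (μ : ∀ N, Measure (Ω N)) (M : ∀ N, Ω N → Matrix (Fin N) (Fin N) ℂ) : Prop where
  /-- all moments of the entries are finite -/
  moments : ∀ N (i j : Fin N) (p : ℕ), MemLp (fun ω => M N ω i j) (p : ℝ≥0∞) (μ N)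
  /-- (i) local `U(1)`-invariance of the (joint) law of the entries -/
  u1_invariance : ∀ N (θ : Fin N → ℝ),
    IdentDistrib (fun ω (i j : Fin N) => M N ω i j)
      (fun ω (i j : Fin N) =>
        Complex.exp (-(Complex.I * θ i)) * M N ω i j * Complex.exp (Complex.I * θ j))
      (μ N) (μ N)
  /-- (ii) the expectation of a loop of `n` distinct indices is `O(N^{1-n})` -/
  scaling : ∀ n : ℕ, ∃ C : ℝ, ∀ᶠ N in atTop, ∀ ℓ : MatLoop N, ℓ.len = n →
    ‖∫ ω, ℓ.value (M N ω) ∂(μ N)‖ ≤ C * (N : ℝ) ^ (1 - (n : ℤ))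
  /-- (iii) a product of loops, where each loop has at most one index in common with the union of
  those that come after it, factorizes at leading order: the error is smaller than the scale
  `N^{(1-n₁) + ⋯ + (1-n_r)}` of the product of the expectations by a factor `O(N⁻¹)` -/
  factorization : ∀ n : ℕ, ∃ C : ℝ, ∀ᶠ N in atTop, ∀ L : List (MatLoop N),
    loopsLen L = n → LoopsPinched L →
    ‖(∫ ω, loopsValue L (M N ω) ∂(μ N)) - (L.map fun ℓ => ∫ ω, ℓ.value (M N ω) ∂(μ N)).prod‖
      ≤ C * (N : ℝ) ^ ((L.length : ℤ) - n - 1)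
  /-- (iii), further coincidences: whatever indices the loops share, a product of loops (written
  with as many loops as possible) is at most of the order of the product of their scales. Full
  factorization with an error factor `1 + O(N⁻¹)` is not required here: for Gaussian matrices
  `E |M₁₂|⁴ = 2 (E |M₁₂|²)²`. -/
  coincidences : ∀ n : ℕ, ∃ C : ℝ, ∀ᶠ N in atTop, ∀ L : List (MatLoop N),
    loopsLen L = n → LoopsFinest L →
    ‖∫ ω, loopsValue L (M N ω) ∂(μ N)‖ ≤ C * (N : ℝ) ^ ((L.length : ℤ) - n)

/-- The joint cumulant `E[X₁ ⋯ Xₙ]ᶜ` of complex random variables: the sum over set partitions `π`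
of `{1, …, n}` of `(-1)^{|π|-1} (|π|-1)! ∏_{B ∈ π} E[∏_{i ∈ B} X_i]`. -/
noncomputable def jointCumulant {Ω : Type*} [MeasurableSpace Ω] (μ : Measure Ω) {n : ℕ}
    (X : Fin n → Ω → ℂ) : ℂ :=
  ∑ π : Finpartition (Finset.univ : Finset (Fin n)),
    (-1 : ℂ) ^ (π.parts.card - 1) * ((π.parts.card - 1).factorial : ℂ) *
      ∏ B ∈ π.parts, ∫ ω, ∏ i ∈ B, X i ω ∂μ

/-- The position `i / N ∈ [0, 1]` of the index `i ∈ {1, …, N}`. -/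
noncomputable def sitePos {N : ℕ} (i : Fin N) : ℝ := ((i : ℝ) + 1) / N

/-- `g` is the family of local free cumulants of the ensemble:
`g_n(x₁, …, xₙ) = lim N^{n-1} E[M_{i₁i₂} ⋯ M_{iₙi₁}]ᶜ`, where the `i_k` are distinct and
`x_k = i_k / N` up to the lattice spacing `1 / N`. This fixes `g_n` at all points of `[0, 1]^n` with
pairwise distinct coordinates; the other points form a null set. -/
def IsLocalFreeCumulants {Ω : ℕ → Type*} [∀ N, MeasurableSpace (Ω N)]
    (μ : ∀ N, Measure (Ω N)) (M : ∀ N, Ω N → Matrix (Fin N) (Fin N) ℂ)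
    (g : (n : ℕ) → (Fin n → ℝ) → ℂ) : Prop :=
  ∀ n : ℕ, 1 ≤ n → ∀ x : Fin n → ℝ, (∀ k, x k ∈ Set.Icc (0 : ℝ) 1) → Function.Injective x →
    ∀ ε > (0 : ℝ), ∀ᶠ N in atTop, ∀ i : Fin n → Fin N, Function.Injective i →
      (∀ k, |sitePos (i k) - x k| ≤ 1 / (N : ℝ)) →
      ‖(N : ℂ) ^ (n - 1) *
          jointCumulant (μ N) (fun k ω => M N ω (i k) (i (finRotate n k))) - g n x‖ < ε

/-! ### The generating functions of `M_h = h^{1/2} M h^{1/2}` at finite `N`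

The variable of all power series is `X = 1/z`. -/

/-- `A_h = h^{1/2} A h^{1/2}` with `h` the diagonal matrix with entries `h_{ii} = h(i/N)`. -/
noncomputable def dressed {N : ℕ} (h : ℝ → ℝ) (A : Matrix (Fin N) (Fin N) ℂ) :
    Matrix (Fin N) (Fin N) ℂ :=
  Matrix.diagonal (fun i => (Real.sqrt (h (sitePos i)) : ℂ)) * A *
    Matrix.diagonal (fun i => (Real.sqrt (h (sitePos i)) : ℂ))

/-- `E tr (M_h)^n` with the normalized trace `tr = Tr / N`. -/
noncomputable def traceMoment {N : ℕ} {Ω : Type*} [MeasurableSpace Ω] (μ : Measure Ω)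
    (M : Ω → Matrix (Fin N) (Fin N) ℂ) (h : ℝ → ℝ) (n : ℕ) : ℂ :=
  ∫ ω, Matrix.trace (dressed h (M ω) ^ n) / (N : ℂ) ∂μ

/-- `E tr log(z - M_h) - log z = E tr log(1 - M_h / z) = -∑_{n ≥ 1} z^{-n} E tr (M_h)^n / n`. -/
noncomputable def traceLogSeries {N : ℕ} {Ω : Type*} [MeasurableSpace Ω] (μ : Measure Ω)
    (M : Ω → Matrix (Fin N) (Fin N) ℂ) (h : ℝ → ℝ) : ℂ⟦X⟧ :=
  PowerSeries.mk fun n => if n = 0 then 0 else -(traceMoment μ M h n / (n : ℂ))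

/-- `E tr (z - M_h)⁻¹ = ∑_{n ≥ 0} z^{-n-1} E tr (M_h)^n`. -/
noncomputable def resolventSeries {N : ℕ} {Ω : Type*} [MeasurableSpace Ω] (μ : Measure Ω)
    (M : Ω → Matrix (Fin N) (Fin N) ℂ) (h : ℝ → ℝ) : ℂ⟦X⟧ :=
  PowerSeries.X * PowerSeries.mk (traceMoment μ M h)

/-! ### The variational problem, in formal power series in `X = 1/z` -/

/-- `log(z - u) - log z = log(1 - u/z)` for a series `u` in `1/z`. -/
noncomputable def logZSub (u : ℂ⟦X⟧) : ℂ⟦X⟧ := PowerSeries.logOf (1 - PowerSeries.X * u)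

/-- `1 / (z - u) = z⁻¹ (1 - u/z)⁻¹` for a series `u` in `1/z`. -/
noncomputable def invZSub (u : ℂ⟦X⟧) : ℂ⟦X⟧ := PowerSeries.X * (1 - PowerSeries.X * u)⁻¹

/-- A formal power series in `1/z` whose coefficients are functions of `x` in `L^∞[0, 1]`. -/
def IsFieldSeries (p : ℝ → ℂ⟦X⟧) : Prop :=
  ∀ k : ℕ, MemLp (fun x => PowerSeries.coeff k (p x)) ∞ (volume.restrict (Set.Icc (0 : ℝ) 1))

/-- Such a series without constant term, i.e. of order `O(1/z)`. -/
def IsFieldSeries₀ (p : ℝ → ℂ⟦X⟧) : Prop :=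
  IsFieldSeries p ∧ ∀ x ∈ Set.Icc (0 : ℝ) 1, PowerSeries.constantCoeff (p x) = 0

/-- `∫₀¹ p(x) dx`, coefficient by coefficient. -/
noncomputable def fieldIntegral (p : ℝ → ℂ⟦X⟧) : ℂ⟦X⟧ :=
  PowerSeries.mk fun k => ∫ x in Set.Icc (0 : ℝ) 1, PowerSeries.coeff k (p x)

/-- `F₀[p] = ∑_{n ≥ 1} (1/n) ∫_{[0,1]^n} g_n(x₁, …, xₙ) p(x₁) ⋯ p(xₙ) dx₁ ⋯ dxₙ` for a series `p`
without constant term. Since `p(x₁) ⋯ p(xₙ) = O(z^{-n})`, only the terms `n ≤ k` contribute to the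
coefficient of `z^{-k}`. -/
noncomputable def F₀ (g : (n : ℕ) → (Fin n → ℝ) → ℂ) (p : ℝ → ℂ⟦X⟧) : ℂ⟦X⟧ :=
  PowerSeries.mk fun k => ∑ n ∈ Finset.Icc 1 k, (1 / (n : ℂ)) *
    ∫ x in Set.Icc (0 : Fin n → ℝ) 1, PowerSeries.coeff k (∏ j, p (x j)) * g n x

/-- The action
`∫₀¹ [log(z - h(x) b(x)) + a(x) b(x)] dx - F₀[a]`, from which `log z = ∫₀¹ log z dx` is
subtracted. -/
noncomputable def action (g : (n : ℕ) → (Fin n → ℝ) → ℂ) (h : ℝ → ℝ) (a b : ℝ → ℂ⟦X⟧) : ℂ⟦X⟧ :=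
  fieldIntegral (fun x => logZSub (PowerSeries.C (h x : ℂ) * b x) + a x * b x) - F₀ g a

/-- `(a, b)` is an extremum (stationary point) of the action: the first variation of every
coefficient of the action vanishes in every direction `(α, β)`. -/
def IsExtremum (g : (n : ℕ) → (Fin n → ℝ) → ℂ) (h : ℝ → ℝ) (a b : ℝ → ℂ⟦X⟧) : Prop :=
  ∀ α β : ℝ → ℂ⟦X⟧, IsFieldSeries₀ α → IsFieldSeries β → ∀ k : ℕ,
    HasDerivAt (fun t : ℂ => PowerSeries.coeff k (action g h (a + t • α) (b + t • β))) 0 0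

/-- `b = δF₀[a]/δa`: for every variation `α`, the derivative at `t = 0` of `F₀[a + t α]` is
`∫₀¹ b(x) α(x) dx`. -/
def IsFunctionalDerivF₀ (g : (n : ℕ) → (Fin n → ℝ) → ℂ) (a b : ℝ → ℂ⟦X⟧) : Prop :=
  ∀ α : ℝ → ℂ⟦X⟧, IsFieldSeries₀ α → ∀ k : ℕ,
    HasDerivAt (fun t : ℂ => PowerSeries.coeff k (F₀ g (a + t • α)))
      (PowerSeries.coeff k (fieldIntegral fun x => b x * α x)) 0

/-! ### Combinatorics of products of loops -/

/-! Expand a diagonal entry of `M_h ^ n` over the closed walks of `n` steps from a site `i`. Cutting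
such a walk after its last visit to `i`, then after the last visit to the letter that follows, and
so on, exhibits a first loop through distinct sites `i, j₁, …, j_m` with a closed walk, possibly
trivial, attached at each of them (`exists_split`).

If the walk visits `v` sites and its steps regroup into `r` loops, connectedness gives `v + r ≤ n +
1`, and equality forces the loops, suitably ordered, to be pinched (`card_toFinset_add_length_le`,
`exists_perm_pinched`). The walk has expectation `O(N^(r - n)) = O(N^(1 - v))`, while `O(N^(v - 1))`
walks visit `v` sites (`sum_words_inv_pow_card_le`), so the total is of order one. In the case of
equality the split is unique and the expectation factorizes into the first loop times the attached
walks, up to a factor `N⁻¹` below the leading scale; otherwise the expectation and all its candidate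
factorizations are already that small (`norm_moment_sub_splits_le`).

Local `U(1)`-invariance kills the expectation of every proper nonempty part of a loop, so the
cumulant of a loop is its moment, which rescales to `g`. Sums over sites are integrals of step
functions, and dominated convergence yields, for the limits `d_n(x)` of the diagonal moments and
`a(x) = ∑ h(x) d_n(x) z^(-n-1)`, the recursion `d_{n+1}(x) = ∑_m ∫ g_{m+1}(x, y) [z^(-n-1)] a(x)
a(y₁) ⋯ a(y_m) dy` (`tendsto_diagMoment`).

On the variational side, cyclic invariance of `g_n` cancels the factor `1/n` in `F₀`, so that its
gradient is `b(x) = ∑_m ∫ g_{m+1}(x, y) ∏ a(y_k) dy`. The recursion then says that `1 + a b`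
generates the `d_n`, and `a = (h/z)(1 + a b)` is the other stationarity equation `a = h/(z - h b)`.
Hence every extremum reproduces the limiting moments (`tendsto_traceMoment_saddle`). The resolvent
follows from `1/(z - h b) = (1 + a b)/z`. For the logarithm, apply `-z d/dz` to the action: by
stationarity only the explicit dependence on `z` counts, which leaves `-∫ a b` (`mul_coeff_action`).
An extremum exists because the fixed point map for `a` gains one order in `1/z` at each iteration.
-/

theorem forall_of_finRotate_invariant {n : ℕ} {Q : Fin n → Prop} (hQ : ∃ k, Q k)
    (hs : ∀ k, Q k → Q (finRotate n k)) : ∀ k, Q k := by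
  obtain ⟨k₀, hk₀⟩ := hQ
  cases n with
  | zero => exact k₀.elim0
  | succ m =>
    have key : ∀ d : Fin (m + 1), Q (k₀ + d) := by
      intro d
      induction d using Fin.induction with
      | zero => simpa using hk₀
      | succ i ih =>
        have := hs _ ih
        rwa [finRotate_apply, add_assoc, Fin.coeSucc_eq_succ] at this
    intro k
    simpa using key (k - k₀)

/-- A nonempty set stable under a full cycle is everything. This locates the place where a loop
leaves a set of edges, and the open end of a proper part of a loop. -/
theorem exists_finRotate_exit {n : ℕ} {Q : Fin n → Prop} (hQ : ∃ k, Q k) (hQ' : ∃ k, ¬ Q k) :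
    ∃ k, Q k ∧ ¬ Q (finRotate n k) := by
  by_contra! hc
  obtain ⟨k, hk⟩ := hQ'
  exact hk (forall_of_finRotate_invariant hQ hc k)

section LoopCombinatorics

variable {N : ℕ}

namespace MatLoop

theorem mem_edges {ℓ : MatLoop N} {e : Fin N × Fin N} :
    e ∈ ℓ.edges ↔ ∃ k, (ℓ.idx k, ℓ.idx (finRotate ℓ.len k)) = e := by
  simp [edges]

theorem mem_vertices {ℓ : MatLoop N} {v : Fin N} : v ∈ ℓ.vertices ↔ ∃ k, ℓ.idx k = v := by
  simp [vertices]

theorem edges_nodup (ℓ : MatLoop N) : ℓ.edges.Nodup := by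
  refine Multiset.Nodup.map ?_ Finset.univ.nodup
  intro j k hjk
  exact ℓ.inj (congrArg Prod.fst hjk)

theorem card_edges (ℓ : MatLoop N) : ℓ.edges.card = ℓ.len := by simp [edges]

theorem card_vertices (ℓ : MatLoop N) : ℓ.vertices.card = ℓ.len := by
  rw [vertices, Finset.card_image_of_injective _ ℓ.inj]; simp

theorem fst_mem_vertices {ℓ : MatLoop N} {e : Fin N × Fin N} (he : e ∈ ℓ.edges) :
    e.1 ∈ ℓ.vertices := by
  obtain ⟨k, rfl⟩ := mem_edges.1 he
  exact mem_vertices.2 ⟨k, rfl⟩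

theorem snd_mem_vertices {ℓ : MatLoop N} {e : Fin N × Fin N} (he : e ∈ ℓ.edges) :
    e.2 ∈ ℓ.vertices := by
  obtain ⟨k, rfl⟩ := mem_edges.1 he
  exact mem_vertices.2 ⟨_, rfl⟩

theorem exists_edge_of_mem_vertices {ℓ : MatLoop N} {v : Fin N} (hv : v ∈ ℓ.vertices) :
    ∃ e ∈ ℓ.edges, e.1 = v := by
  obtain ⟨k, rfl⟩ := mem_vertices.1 hv
  exact ⟨_, mem_edges.2 ⟨k, rfl⟩, rfl⟩

/-- Each site of `ℓ'` has a single outgoing edge there. The sites shared with `ℓ` are therefore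
stable under the successor map of `ℓ'`, so they exhaust `ℓ'`. -/
theorem edges_eq_of_subset {ℓ ℓ' : MatLoop N} (hs : ∀ e ∈ ℓ.edges, e ∈ ℓ'.edges) :
    ℓ'.edges = ℓ.edges := by
  have succ_eq : ∀ e ∈ ℓ'.edges, ∀ e' ∈ ℓ'.edges, e.1 = e'.1 → e = e' := by
    intro e he e' he' h
    obtain ⟨k, rfl⟩ := mem_edges.1 he
    obtain ⟨k', rfl⟩ := mem_edges.1 he'
    rw [ℓ'.inj h]
  have key : ∀ k, ℓ'.idx k ∈ ℓ.vertices := by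
    apply forall_of_finRotate_invariant
    · have := hs _ (mem_edges.2 ⟨⟨0, ℓ.len_pos⟩, rfl⟩)
      obtain ⟨k, hk⟩ := mem_edges.1 this
      exact ⟨k, mem_vertices.2 ⟨_, (congrArg Prod.fst hk).symm⟩⟩
    · intro k hk
      obtain ⟨e, he, hek⟩ := exists_edge_of_mem_vertices hk
      have := succ_eq e (hs e he) _ (mem_edges.2 ⟨k, rfl⟩) hek
      have h2 := snd_mem_vertices he
      rwa [this] at h2
  rw [Multiset.Nodup.ext ℓ'.edges_nodup ℓ.edges_nodup]
  intro e
  refine ⟨fun he => ?_, hs e⟩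
  obtain ⟨k, hk⟩ := mem_edges.1 he
  obtain ⟨e', he', hek⟩ := exists_edge_of_mem_vertices (key k)
  have := succ_eq e' (hs e' he') e he (by rw [hek, ← hk])
  rwa [← this]

end MatLoop

@[simp] theorem loopsEdges_nil : loopsEdges ([] : List (MatLoop N)) = 0 := rfl

@[simp] theorem loopsEdges_cons (ℓ : MatLoop N) (L : List (MatLoop N)) :
    loopsEdges (ℓ :: L) = ℓ.edges + loopsEdges L := by simp [loopsEdges]

theorem loopsEdges_append (L L' : List (MatLoop N)) :
    loopsEdges (L ++ L') = loopsEdges L + loopsEdges L' := by simp [loopsEdges]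

theorem loopsEdges_perm {L L' : List (MatLoop N)} (h : L.Perm L') :
    loopsEdges L = loopsEdges L' := (h.map _).sum_eq

theorem mem_loopsEdges {L : List (MatLoop N)} {e : Fin N × Fin N} :
    e ∈ loopsEdges L ↔ ∃ ℓ ∈ L, e ∈ ℓ.edges := by
  induction L with
  | nil => simp
  | cons ℓ L ih => simp [ih]

@[simp] theorem loopsLen_nil : loopsLen ([] : List (MatLoop N)) = 0 := rfl

@[simp] theorem loopsLen_cons (ℓ : MatLoop N) (L : List (MatLoop N)) :
    loopsLen (ℓ :: L) = ℓ.len + loopsLen L := by simp [loopsLen]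

theorem loopsLen_perm {L L' : List (MatLoop N)} (h : L.Perm L') : loopsLen L = loopsLen L' :=
  (h.map _).sum_eq

theorem card_loopsEdges (L : List (MatLoop N)) : (loopsEdges L).card = loopsLen L := by
  induction L with
  | nil => simp
  | cons ℓ L ih => simp [ih, MatLoop.card_edges]

theorem length_le_loopsLen (L : List (MatLoop N)) : L.length ≤ loopsLen L := by
  induction L with
  | nil => simp
  | cons ℓ L ih => have := ℓ.len_pos; simp; omega

@[simp] theorem loopsVertices_nil : loopsVertices ([] : List (MatLoop N)) = ∅ := rfl

@[simp] theorem loopsVertices_cons (ℓ : MatLoop N) (L : List (MatLoop N)) :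
    loopsVertices (ℓ :: L) = ℓ.vertices ∪ loopsVertices L := rfl

theorem mem_loopsVertices {L : List (MatLoop N)} {v : Fin N} :
    v ∈ loopsVertices L ↔ ∃ ℓ ∈ L, v ∈ ℓ.vertices := by
  induction L with
  | nil => simp
  | cons ℓ L ih => simp [ih]

theorem loopsVertices_perm {L L' : List (MatLoop N)} (h : L.Perm L') :
    loopsVertices L = loopsVertices L' := by
  ext v; simp [mem_loopsVertices, h.mem_iff]

theorem loopsVertices_mono {L L' : List (MatLoop N)} (h : L ⊆ L') :
    loopsVertices L ⊆ loopsVertices L' := by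
  intro v hv
  obtain ⟨ℓ, hℓ, hv⟩ := mem_loopsVertices.1 hv
  exact mem_loopsVertices.2 ⟨ℓ, h hℓ, hv⟩

theorem fst_mem_loopsVertices {L : List (MatLoop N)} {e : Fin N × Fin N}
    (he : e ∈ loopsEdges L) : e.1 ∈ loopsVertices L := by
  obtain ⟨ℓ, hℓ, h⟩ := mem_loopsEdges.1 he
  exact mem_loopsVertices.2 ⟨ℓ, hℓ, MatLoop.fst_mem_vertices h⟩

theorem snd_mem_loopsVertices {L : List (MatLoop N)} {e : Fin N × Fin N}
    (he : e ∈ loopsEdges L) : e.2 ∈ loopsVertices L := by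
  obtain ⟨ℓ, hℓ, h⟩ := mem_loopsEdges.1 he
  exact mem_loopsVertices.2 ⟨ℓ, hℓ, MatLoop.snd_mem_vertices h⟩

theorem LoopsPinched.sublist {L L' : List (MatLoop N)} (h : L.Sublist L')
    (hp : LoopsPinched L') : LoopsPinched L := by
  induction h with
  | slnil => trivial
  | cons a _ ih => exact ih hp.2
  | @cons_cons l₁ l₂ a hs ih =>
    refine ⟨(Finset.card_le_card ?_).trans hp.1, ih hp.2⟩
    exact Finset.inter_subset_inter_left (loopsVertices_mono hs.subset)

/-- In a pinched product of loops, the only loops that can be formed from the matrix entries are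
the given ones. -/
theorem LoopsPinched.exists_edges_eq {L : List (MatLoop N)} (hp : LoopsPinched L)
    {ℓ : MatLoop N} (hℓ : ∀ e ∈ ℓ.edges, e ∈ loopsEdges L) : ∃ ℓ' ∈ L, ℓ'.edges = ℓ.edges := by
  induction L with
  | nil =>
    exact absurd (hℓ _ (MatLoop.mem_edges.2 ⟨⟨0, ℓ.len_pos⟩, rfl⟩)) (by simp)
  | cons ℓ₁ L ih =>
    have hcase : ∀ e ∈ ℓ.edges, e ∈ ℓ₁.edges ∨ e ∈ loopsEdges L := by simpa using hℓ
    set E : Fin ℓ.len → Fin N × Fin N := fun k => (ℓ.idx k, ℓ.idx (finRotate ℓ.len k)) with hE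
    have hEmem : ∀ k, E k ∈ ℓ.edges := fun k => MatLoop.mem_edges.2 ⟨k, rfl⟩
    by_cases h1 : ∀ k, E k ∈ ℓ₁.edges
    · refine ⟨ℓ₁, by simp, MatLoop.edges_eq_of_subset ?_⟩
      intro e he
      obtain ⟨k, rfl⟩ := MatLoop.mem_edges.1 he
      exact h1 k
    by_cases h2 : ∀ k, E k ∉ ℓ₁.edges
    · obtain ⟨ℓ', h, h'⟩ := ih hp.2 (by
        intro e he
        obtain ⟨k, rfl⟩ := MatLoop.mem_edges.1 he
        exact (hcase _ he).resolve_left (h2 k))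
      exact ⟨ℓ', by simp [h], h'⟩
    push Not at h1 h2
    exfalso
    -- A loop mixing edges of `ℓ₁` with other edges leaves `ℓ₁` at one site and re-enters it at
    -- another place along the loop. Both sites are common to `ℓ₁` and the later loops, so pinching
    -- identifies them, against the distinctness of the indices of `ℓ`.
    obtain ⟨k, hk, hk'⟩ := exists_finRotate_exit h2 h1
    obtain ⟨m, hm, hm'⟩ := exists_finRotate_exit (Q := fun k => E k ∉ ℓ₁.edges) h1
      (by simpa using h2)
    have hkL := (hcase _ (hEmem _)).resolve_left hk'
    have hmL := (hcase _ (hEmem _)).resolve_left hm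
    rw [not_not] at hm'
    have ha : ℓ.idx (finRotate ℓ.len k) ∈ ℓ₁.vertices ∩ loopsVertices L :=
      Finset.mem_inter.2 ⟨MatLoop.snd_mem_vertices hk, fst_mem_loopsVertices hkL⟩
    have hb : ℓ.idx (finRotate ℓ.len m) ∈ ℓ₁.vertices ∩ loopsVertices L :=
      Finset.mem_inter.2 ⟨MatLoop.fst_mem_vertices hm', snd_mem_loopsVertices hmL⟩
    have := Finset.card_le_one.1 hp.1 _ ha _ hb
    have := (finRotate ℓ.len).injective (ℓ.inj this)
    subst this
    exact hm hk

/-- Any loop of another decomposition has the edges of one of the given loops, so the two can be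
cancelled and the rest, still pinched, compared by induction. -/
theorem LoopsPinched.length_eq {L : List (MatLoop N)} (hp : LoopsPinched L)
    {L' : List (MatLoop N)} (h : loopsEdges L' = loopsEdges L) : L'.length = L.length := by
  induction L' generalizing L with
  | nil =>
    cases L with
    | nil => rfl
    | cons ℓ L =>
      have := congrArg Multiset.card h
      rw [card_loopsEdges, card_loopsEdges] at this
      have := ℓ.len_pos
      simp at *
      omega
  | cons ℓ L' ih =>
    obtain ⟨ℓ₁, hmem, he⟩ := hp.exists_edges_eq (ℓ := ℓ) (by
      intro e he; rw [← h]; simp [he])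
    obtain ⟨A, B, rfl⟩ := List.append_of_mem hmem
    have hAB : LoopsPinched (A ++ B) := hp.sublist (by simp)
    have := ih hAB (by
      rw [loopsEdges_append, loopsEdges_cons, loopsEdges_cons, he, add_left_comm] at h
      rw [loopsEdges_append]
      exact add_left_cancel h)
    simp at this ⊢
    omega

/-- Each loop in the list meets one of the later ones. -/
def LoopsChained : List (MatLoop N) → Prop
  | [] => True
  | ℓ :: L => (L ≠ [] → (ℓ.vertices ∩ loopsVertices L).Nonempty) ∧ LoopsChained L

/-- A loop that meets the later ones adds at most `len - 1` new sites; only the last loop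
contributes all of its sites, whence the `+ 1`. -/
theorem LoopsChained.card_add_length_le {L : List (MatLoop N)} (hc : LoopsChained L)
    (hne : L ≠ []) : (loopsVertices L).card + L.length ≤ loopsLen L + 1 := by
  induction L with
  | nil => exact absurd rfl hne
  | cons ℓ L ih =>
    by_cases hL : L = []
    · subst hL; simp [MatLoop.card_vertices]
    · have h1 := ih hc.2 hL
      have h2 := Finset.card_pos.2 (hc.1 hL)
      have h3 := Finset.card_union_add_card_inter ℓ.vertices (loopsVertices L)
      rw [MatLoop.card_vertices] at h3
      simp only [loopsVertices_cons, List.length_cons, loopsLen_cons]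
      omega

/-- The equality case of the preceding count: no loop can afford a second common site. -/
theorem LoopsChained.pinched_of_card {L : List (MatLoop N)} (hc : LoopsChained L)
    (hcard : loopsLen L + 1 ≤ (loopsVertices L).card + L.length) : LoopsPinched L := by
  induction L with
  | nil => trivial
  | cons ℓ L ih =>
    by_cases hL : L = []
    · subst hL; exact ⟨by simp, trivial⟩
    · have h1 := hc.2.card_add_length_le hL
      have h2 := Finset.card_pos.2 (hc.1 hL)
      have h3 := Finset.card_union_add_card_inter ℓ.vertices (loopsVertices L)
      rw [MatLoop.card_vertices] at h3
      simp only [loopsVertices_cons, List.length_cons, loopsLen_cons] at hcard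
      exact ⟨by omega, ih hc.2 (by omega)⟩

/-- Greedy growth of a connected cluster: as long as loops remain, one of them meets the cluster and
is put in front of it. -/
theorem exists_perm_loopsChained {L : List (MatLoop N)}
    (hconn : ∀ A B : List (MatLoop N), (A ++ B).Perm L → A ≠ [] → B ≠ [] →
      (loopsVertices A ∩ loopsVertices B).Nonempty) :
    ∃ L', L'.Perm L ∧ LoopsChained L' := by
  cases L with
  | nil => exact ⟨[], List.Perm.refl _, trivial⟩
  | cons ℓ₀ L₀ =>
    have key : ∀ n (A B : List (MatLoop N)), B.length = n → (A ++ B).Perm (ℓ₀ :: L₀) → A ≠ [] →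
        LoopsChained A → ∃ L', L'.Perm (ℓ₀ :: L₀) ∧ LoopsChained L' := by
      intro n
      induction n with
      | zero =>
        intro A B hB hp _ hA
        rw [List.length_eq_zero_iff] at hB
        subst hB
        exact ⟨A, by simpa using hp, hA⟩
      | succ n ih =>
        intro A B hB hp hne hA
        have hBne : B ≠ [] := by rintro rfl; simp at hB
        obtain ⟨v, hv⟩ := hconn A B hp hne hBne
        obtain ⟨hvA, hvB⟩ := Finset.mem_inter.1 hv
        obtain ⟨ℓ, hℓ, hvℓ⟩ := mem_loopsVertices.1 hvB
        obtain ⟨B₁, B₂, rfl⟩ := List.append_of_mem hℓ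
        refine ih (ℓ :: A) (B₁ ++ B₂) (by simp at hB ⊢; omega) ?_ (by simp)
          ⟨fun _ => ⟨v, Finset.mem_inter.2 ⟨hvℓ, hvA⟩⟩, hA⟩
        refine List.Perm.trans ?_ hp
        rw [← List.append_assoc, ← List.append_assoc, List.cons_append, List.cons_append]
        exact List.perm_middle.symm
    exact key L₀.length [ℓ₀] L₀ rfl (List.Perm.refl _) (by simp) ⟨by simp, trivial⟩

end LoopCombinatorics

/-! ### Closed words and their decompositions into loops -/

section Words

variable {V : Type*}

/-- The steps of the walk that visits the letters of a word one after the other. -/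
def steps : List V → Multiset (V × V)
  | [] => 0
  | [_] => 0
  | a :: b :: l => (a, b) ::ₘ steps (b :: l)

@[simp] theorem steps_nil : steps ([] : List V) = 0 := rfl
@[simp] theorem steps_singleton (a : V) : steps [a] = 0 := rfl
@[simp] theorem steps_cons_cons (a b : V) (l : List V) :
    steps (a :: b :: l) = (a, b) ::ₘ steps (b :: l) := rfl

theorem card_steps (w : List V) : (steps w).card = w.length - 1 := by
  match w with
  | [] => rfl
  | [_] => rfl
  | a :: b :: l => simp [card_steps (b :: l)]

theorem mem_of_mem_steps {w : List V} {e : V × V} (he : e ∈ steps w) : e.1 ∈ w ∧ e.2 ∈ w := by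
  match w with
  | [] => simp at he
  | [_] => simp at he
  | a :: b :: l =>
    rw [steps_cons_cons, Multiset.mem_cons] at he
    rcases he with rfl | he
    · simp
    · have := mem_of_mem_steps he
      exact ⟨List.mem_cons_of_mem _ this.1, List.mem_cons_of_mem _ this.2⟩

theorem exists_step_of_mem {w : List V} (hw : 2 ≤ w.length) {v : V} (hv : v ∈ w) :
    ∃ e ∈ steps w, v = e.1 ∨ v = e.2 := by
  match w with
  | [] => simp at hw
  | [_] => simp at hw
  | [a, b] => 
    refine ⟨(a, b), by simp, by simpa using hv⟩
  | a :: b :: c :: l =>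
    rcases List.mem_cons.1 hv with rfl | hv
    · exact ⟨(v, b), by simp, Or.inl rfl⟩
    · obtain ⟨e, he, h⟩ := exists_step_of_mem (w := b :: c :: l) (by simp) hv
      exact ⟨e, by rw [steps_cons_cons]; exact Multiset.mem_cons_of_mem he, h⟩

theorem iff_of_steps {w : List V} {P : V → Prop} (h : ∀ e ∈ steps w, (P e.1 ↔ P e.2)) :
    ∀ u ∈ w, ∀ v ∈ w, (P u ↔ P v) := by
  match w with
  | [] => simp
  | [_] => simp
  | a :: b :: l =>
    have h1 : P a ↔ P b := h (a, b) (by simp)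
    have ih := iff_of_steps (w := b :: l) (P := P) (fun e he => h e (by simp [he]))
    intro u hu v hv
    have key : ∀ x ∈ a :: b :: l, (P x ↔ P b) := by
      intro x hx
      rcases List.mem_cons.1 hx with rfl | hx
      · exact h1
      · exact ih x hx b (by simp)
    rw [key u hu, key v hv]

theorem steps_append {B : List V} {j : V} (hB : B.getLast? = some j) (r : List V) :
    steps (B ++ r) = steps B + steps (j :: r) := by
  match B with
  | [] => simp at hB
  | [a] => simp at hB; subst hB; simp
  | a :: b :: l =>
    have := steps_append (B := b :: l) (j := j) (by simpa using hB) r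
    rw [List.cons_append, List.cons_append, steps_cons_cons, steps_cons_cons, ← List.cons_append,
      this, Multiset.cons_add]

theorem steps_ofFn {n : ℕ} (f : Fin (n + 1) → V) :
    steps (List.ofFn f) = ↑(List.ofFn fun k : Fin n => (f k.castSucc, f k.succ)) := by
  induction n with
  | zero => simp
  | succ n ih =>
    have := ih (fun k => f k.succ)
    rw [List.ofFn_succ (f := f), List.ofFn_succ (f := fun k : Fin (n + 1) => (f k.castSucc, f k.succ)),
      ← Multiset.cons_coe]
    rw [List.ofFn_succ (f := fun k => f k.succ)] at this ⊢
    rw [steps_cons_cons, this]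
    rfl

/-- A nonempty word whose first and last letter is `j`. -/
def IsClosedAt (j : V) (B : List V) : Prop := B.head? = some j ∧ B.getLast? = some j

theorem IsClosedAt.ne_nil {j : V} {B : List V} (h : IsClosedAt j B) : B ≠ [] := by
  rintro rfl; simp [IsClosedAt] at h

theorem IsClosedAt.mem {j : V} {B : List V} (h : IsClosedAt j B) : j ∈ B :=
  List.mem_of_mem_head? h.1

/-- Each block starts and ends at its letter, so the steps between blocks are those of the skeleton
word `js`, and the blocks are excursions inserted into it. -/
theorem steps_flatten_append {js : List V} {Z : List (List V)} (hZ : List.Forall₂ IsClosedAt js Z)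
    (a i : V) : steps (a :: (Z.flatten ++ [i])) = steps (a :: (js ++ [i])) + (Z.map steps).sum := by
  induction hZ generalizing a with
  | nil => simp
  | @cons j B js Z h _ ih =>
    obtain ⟨t, rfl⟩ : ∃ t, B = j :: t := by
      cases B with
      | nil => exact absurd rfl h.ne_nil
      | cons b t => have := h.1; simp at this; exact ⟨t, by rw [this]⟩
    rw [List.flatten_cons, List.append_assoc, List.cons_append, steps_cons_cons,
      ← List.cons_append, steps_append h.2, ih j, List.cons_append, steps_cons_cons]
    simp only [List.map_cons, List.sum_cons, Multiset.cons_add]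
    congr 1
    abel

theorem steps_flatten {j : V} {js : List V} {Z : List (List V)}
    (hZ : List.Forall₂ IsClosedAt (j :: js) Z) :
    steps (Z.flatten ++ [j]) = steps (j :: js ++ [j]) + (Z.map steps).sum := by
  cases hZ with
  | @cons _ B _ Z h hZ =>
    rw [List.flatten_cons, List.append_assoc, steps_append h.2, steps_flatten_append hZ]
    simp only [List.map_cons, List.sum_cons, List.cons_append]
    abel

theorem exists_last_occurrence {i : V} {w : List V} (h : i ∈ w) :
    ∃ s r, w = s ++ i :: r ∧ i ∉ r := by
  obtain ⟨s, r, h1, h2⟩ := List.eq_append_cons_of_mem (List.mem_reverse.2 h)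
  refine ⟨r.reverse, s.reverse, ?_, by simpa using h2⟩
  have := congrArg List.reverse h1
  simpa using this

/-- Every word splits into closed words at pairwise distinct letters: cut after the last occurrence
of the first letter, and repeat. -/
theorem exists_split (w : List V) :
    ∃ (js : List V) (Z : List (List V)), Z.flatten = w ∧ List.Forall₂ IsClosedAt js Z ∧ js.Nodup ∧
      js ⊆ w := by
  match w with
  | [] => exact ⟨[], [], by simp⟩
  | i :: t =>
    obtain ⟨s, r, h1, h2⟩ := exists_last_occurrence (i := i) (w := i :: t) (by simp)
    have hlen : r.length < (i :: t).length := by rw [h1]; simp; omega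
    obtain ⟨js, Z, hf, hZ, hnd, hsub⟩ := exists_split r
    refine ⟨i :: js, (s ++ [i]) :: Z, ?_, .cons ⟨?_, by simp⟩ hZ, ?_, ?_⟩
    · simp [hf, h1]
    · cases s with
      | nil => simp
      | cons a s => simp at h1 ⊢; exact h1.1.symm
    · exact List.nodup_cons.2 ⟨fun h => h2 (hsub h), hnd⟩
    · intro x hx
      rw [h1]
      rcases List.mem_cons.1 hx with rfl | hx
      · simp
      · simp [hsub hx]
termination_by w.length
decreasing_by simpa using hlen

theorem append_cons_inj_of_notMem {i : V} {s r s' r' : List V} (h : s ++ i :: r = s' ++ i :: r')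
    (hr : i ∉ r) (hr' : i ∉ r') : s = s' ∧ r = r' := by
  induction s generalizing s' with
  | nil =>
    cases s' with
    | nil => simpa using h
    | cons a s' =>
      simp at h
      exact absurd (by rw [h.2]; simp) hr
  | cons a s ih =>
    cases s' with
    | nil =>
      simp at h
      exact absurd (by rw [← h.2]; simp) hr'
    | cons a' s' =>
      simp at h
      have := ih h.2
      simp [h.1, this.1, this.2]

/-- When the blocks are disjoint, the letter closing the first block does not occur afterwards. The
first block thus ends at the last occurrence of the first letter, and the word determines the cut.
-/
theorem split_unique {js js' : List V} {Z Z' : List (List V)} (hZ : List.Forall₂ IsClosedAt js Z)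
    (hZ' : List.Forall₂ IsClosedAt js' Z') (hd : Z.Pairwise List.Disjoint)
    (hd' : Z'.Pairwise List.Disjoint) (h : Z.flatten = Z'.flatten) : js = js' ∧ Z = Z' := by
  have block : ∀ {j : V} {B : List V}, IsClosedAt j B → ∃ s, B = s ++ [j] := by
    intro j B hB
    obtain ⟨s, hs⟩ := List.getLast?_eq_some_iff.1 hB.2
    exact ⟨s, hs⟩
  induction hZ generalizing js' Z' with
  | nil =>
    cases hZ' with
    | nil => simp
    | cons h1 _ => simp at h; exact absurd h.1 h1.ne_nil
  | @cons j B js Z h1 hZ ih =>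
    cases hZ' with
    | nil => simp at h; exact absurd h.1 h1.ne_nil
    | @cons j' B' js' Z' h1' hZ' =>
      rw [List.flatten_cons, List.flatten_cons] at h
      have hj : j = j' := by
        have := congrArg List.head? h
        rw [List.head?_append, List.head?_append, h1.1, h1'.1] at this
        simpa using this
      subst hj
      rw [List.pairwise_cons] at hd hd'
      obtain ⟨s, rfl⟩ := block h1
      obtain ⟨s', rfl⟩ := block h1'
      have n1 : j ∉ Z.flatten := by
        intro hm
        obtain ⟨C, hC, hjC⟩ := List.mem_flatten.1 hm
        exact hd.1 C hC h1.mem hjC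
      have n2 : j ∉ Z'.flatten := by
        intro hm
        obtain ⟨C, hC, hjC⟩ := List.mem_flatten.1 hm
        exact hd'.1 C hC h1'.mem hjC
      have := append_cons_inj_of_notMem (by simpa using h) n1 n2
      have h2 := ih hZ' hd.2 hd'.2 this.2
      rw [h2.1, h2.2, this.1]
      exact ⟨rfl, rfl⟩

theorem length_le_length_flatten {js : List V} {Z : List (List V)}
    (h : List.Forall₂ IsClosedAt js Z) : js.length ≤ Z.flatten.length := by
  induction h with
  | nil => simp
  | cons h _ ih =>
    have := List.length_pos_iff.2 h.ne_nil
    rw [List.flatten_cons, List.length_append, List.length_cons]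
    omega

theorem head_flatten {i : V} {t : List V} {Z : List (List V)}
    (h : List.Forall₂ IsClosedAt (i :: t) Z) : Z.flatten.head? = some i := by
  cases h with
  | cons h _ => rw [List.flatten_cons, List.head?_append, h.1]; rfl

theorem heads_eq {js js' : List V} {Z : List (List V)} (h : List.Forall₂ IsClosedAt js Z)
    (h' : List.Forall₂ IsClosedAt js' Z) : js = js' := by
  induction h generalizing js' with
  | nil => cases h'; rfl
  | cons h1 _ ih =>
    cases h' with
    | cons h1' h' =>
      have := h1.1.symm.trans h1'.1
      rw [ih h', Option.some.inj this]

variable [DecidableEq V]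

theorem card_toFinset_flatten_le (Z : List (List V)) :
    Z.flatten.toFinset.card ≤ (Z.map fun B => B.toFinset.card).sum := by
  induction Z with
  | nil => simp
  | cons B Z ih =>
    rw [List.flatten_cons, List.toFinset_append, List.map_cons, List.sum_cons]
    exact (Finset.card_union_le _ _).trans (by omega)

/-- Equality in the union bound leaves no room for a common letter. -/
theorem pairwise_disjoint_of_sum_card_le {Z : List (List V)}
    (h : (Z.map fun B => B.toFinset.card).sum ≤ Z.flatten.toFinset.card) :
    Z.Pairwise List.Disjoint := by
  induction Z with
  | nil => simp
  | cons B Z ih =>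
    rw [List.flatten_cons, List.toFinset_append, List.map_cons, List.sum_cons] at h
    have h1 := Finset.card_union_add_card_inter B.toFinset Z.flatten.toFinset
    have h2 := card_toFinset_flatten_le Z
    rw [List.pairwise_cons]
    refine ⟨?_, ih (by omega)⟩
    have h0 : B.toFinset ∩ Z.flatten.toFinset = ∅ := by
      rw [← Finset.card_eq_zero]; omega
    intro C hC x hxB hxC
    have : x ∈ B.toFinset ∩ Z.flatten.toFinset := by
      simp only [Finset.mem_inter, List.mem_toFinset]
      exact ⟨hxB, List.mem_flatten.2 ⟨C, hC, hxC⟩⟩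
    simp [h0] at this

end Words

/-! ### Loop decompositions of a walk and the count of sites against loops -/

section LoopDecomposition

variable {N : ℕ}

/-- If two complementary groups of loops had no common site, every step would stay on one side, so
the walk could never pass from one group to the other. -/
theorem loops_connected_of_steps {w : List (Fin N)} {L : List (MatLoop N)}
    (hL : loopsEdges L = steps w) (A B : List (MatLoop N)) (hAB : (A ++ B).Perm L)
    (hA : A ≠ []) (hB : B ≠ []) : (loopsVertices A ∩ loopsVertices B).Nonempty := by
  by_contra hemp
  rw [Finset.not_nonempty_iff_eq_empty] at hemp
  have hnot : ∀ v ∈ loopsVertices B, v ∉ loopsVertices A := by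
    intro v hv hv'
    have : v ∈ loopsVertices A ∩ loopsVertices B := Finset.mem_inter.2 ⟨hv', hv⟩
    simp [hemp] at this
  have hedges : loopsEdges A + loopsEdges B = steps w := by
    rw [← loopsEdges_append, loopsEdges_perm hAB, hL]
  have hiff := iff_of_steps (w := w) (P := fun v => v ∈ loopsVertices A) (by
    intro e he
    rw [← hedges, Multiset.mem_add] at he
    rcases he with he | he
    · exact iff_of_true (fst_mem_loopsVertices he) (snd_mem_loopsVertices he)
    · exact iff_of_false (hnot _ (fst_mem_loopsVertices he)) (hnot _ (snd_mem_loopsVertices he)))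
  have pick : ∀ C : List (MatLoop N), C ≠ [] → ∃ e, e ∈ loopsEdges C := by
    intro C hC
    obtain ⟨ℓ, C', rfl⟩ := List.exists_cons_of_ne_nil hC
    exact ⟨_, mem_loopsEdges.2 ⟨ℓ, by simp, MatLoop.mem_edges.2 ⟨⟨0, ℓ.len_pos⟩, rfl⟩⟩⟩
  obtain ⟨e, he⟩ := pick A hA
  obtain ⟨f, hf⟩ := pick B hB
  have hew := mem_of_mem_steps (w := w) (e := e) (by rw [← hedges]; simp [he])
  have hfw := mem_of_mem_steps (w := w) (e := f) (by rw [← hedges]; simp [hf])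
  exact hnot _ (fst_mem_loopsVertices hf)
    ((hiff _ hew.1 _ hfw.1).1 (fst_mem_loopsVertices he))

theorem loopsVertices_eq_toFinset {w : List (Fin N)} {L : List (MatLoop N)}
    (hL : loopsEdges L = steps w) (hw : 2 ≤ w.length) : loopsVertices L = w.toFinset := by
  ext v
  rw [List.mem_toFinset]
  constructor
  · intro hv
    obtain ⟨ℓ, hℓ, hv⟩ := mem_loopsVertices.1 hv
    obtain ⟨e, he, rfl⟩ := MatLoop.exists_edge_of_mem_vertices hv
    exact (mem_of_mem_steps (hL ▸ mem_loopsEdges.2 ⟨ℓ, hℓ, he⟩)).1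
  · intro hv
    obtain ⟨e, he, h⟩ := exists_step_of_mem hw hv
    rw [← hL] at he
    rcases h with rfl | rfl
    · exact fst_mem_loopsVertices he
    · exact snd_mem_loopsVertices he

theorem loopsLen_eq_of_steps {w : List (Fin N)} {L : List (MatLoop N)}
    (hL : loopsEdges L = steps w) : loopsLen L = w.length - 1 := by
  rw [← card_loopsEdges, hL, card_steps]

/-- The inequality `v + r ≤ n + 1` behind all power counting, with `w.length = n + 1` for a walk of
`n` steps. The loops are connected along the walk, hence can be chained. -/
theorem card_toFinset_add_length_le {w : List (Fin N)} {L : List (MatLoop N)}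
    (hL : loopsEdges L = steps w) (hw : w ≠ []) : w.toFinset.card + L.length ≤ w.length := by
  have hlen := loopsLen_eq_of_steps hL
  have h0 : 0 < w.length := List.length_pos_iff.2 hw
  -- A one-letter word has no step: its site is not visible in the empty list of loops, so this case
  -- is separate.
  rcases Nat.lt_or_ge w.length 2 with h2 | h2
  · have := length_le_loopsLen L
    have := List.toFinset_card_le w
    omega
  · obtain ⟨L', hp, hc⟩ := exists_perm_loopsChained (loops_connected_of_steps hL)
    have h1 := hc.card_add_length_le (by
      rintro rfl
      have := loopsLen_perm hp
      simp at this; omega)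
    rw [loopsVertices_perm hp, loopsLen_perm hp, hp.length_eq, loopsVertices_eq_toFinset hL h2] at h1
    omega

theorem exists_perm_pinched {w : List (Fin N)} {L : List (MatLoop N)}
    (hL : loopsEdges L = steps w) (hw : w ≠ []) (hcard : w.length ≤ w.toFinset.card + L.length) :
    ∃ L', L'.Perm L ∧ LoopsPinched L' := by
  have hlen := loopsLen_eq_of_steps hL
  have h0 : 0 < w.length := List.length_pos_iff.2 hw
  rcases Nat.lt_or_ge w.length 2 with h2 | h2
  · refine ⟨[], ?_, trivial⟩
    have := length_le_loopsLen L
    rw [List.length_eq_zero_iff.1 (show L.length = 0 by omega)]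
  · obtain ⟨L', hp, hc⟩ := exists_perm_loopsChained (loops_connected_of_steps hL)
    refine ⟨L', hp, hc.pinched_of_card ?_⟩
    rw [loopsVertices_perm hp, loopsLen_perm hp, hp.length_eq, loopsVertices_eq_toFinset hL h2]
    omega

/-- Once a decomposition reaches the bound it is pinched up to order, and then all decompositions
have equally many loops. -/
theorem length_eq_of_card {w : List (Fin N)} {L L' : List (MatLoop N)}
    (hL : loopsEdges L = steps w) (hL' : loopsEdges L' = steps w) (hw : w ≠ [])
    (hcard : w.length ≤ w.toFinset.card + L.length) : L'.length = L.length := by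
  obtain ⟨P, hp, hP⟩ := exists_perm_pinched hL hw hcard
  rw [hP.length_eq (L' := L') (by rw [loopsEdges_perm hp, hL, hL']), hp.length_eq]

/-- The loop visiting the values of an injective function in turn. -/
def loopOfFn {m : ℕ} (j : Fin (m + 1) → Fin N) (hj : Function.Injective j) : MatLoop N :=
  ⟨m + 1, j, m.succ_pos, hj⟩

theorem edges_loopOfFn {m : ℕ} (j : Fin (m + 1) → Fin N) (hj : Function.Injective j) :
    (loopOfFn j hj).edges = steps (List.ofFn j ++ [j 0]) := by
  have h1 : List.ofFn j ++ [j 0] = List.ofFn (Fin.snoc j (j 0) : Fin (m + 2) → Fin N) := by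
    rw [List.ofFn_succ' (f := (Fin.snoc j (j 0) : Fin (m + 2) → Fin N))]
    simp
  rw [h1, steps_ofFn, MatLoop.edges, loopOfFn, Fin.univ_val_map]
  congr 2
  funext k
  simp only [Fin.snoc_castSucc]
  congr 1
  refine Fin.lastCases ?_ (fun k => ?_) k
  · rw [Fin.succ_last, Fin.snoc_last, finRotate_last]
  · rw [← Fin.castSucc_succ, Fin.snoc_castSucc, finRotate_apply, Fin.coeSucc_eq_succ]

theorem exists_loop_of_nodup {i : Fin N} {t : List (Fin N)} (h : (i :: t).Nodup) :
    ∃ ℓ : MatLoop N, ℓ.edges = steps (i :: t ++ [i]) := by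
  refine ⟨loopOfFn (fun k : Fin (t.length + 1) => (i :: t).get k)
    (List.nodup_iff_injective_get.1 h), ?_⟩
  rw [edges_loopOfFn]
  congr 2
  exact List.ofFn_get (i :: t)

theorem exists_loops_of_blocks {Z : List (List (Fin N))}
    (h : ∀ B ∈ Z, ∃ L : List (MatLoop N), loopsEdges L = steps B) :
    ∃ Ls : List (List (MatLoop N)), List.Forall₂ (fun L B => loopsEdges L = steps B) Ls Z := by
  induction Z with
  | nil => exact ⟨[], .nil⟩
  | cons B Z ih =>
    obtain ⟨L, hL⟩ := h B (by simp)
    obtain ⟨Ls, hLs⟩ := ih (fun C hC => h C (by simp [hC]))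
    exact ⟨L :: Ls, .cons hL hLs⟩

theorem loopsEdges_flatten {Ls : List (List (MatLoop N))} {Z : List (List (Fin N))}
    (h : List.Forall₂ (fun L B => loopsEdges L = steps B) Ls Z) :
    loopsEdges Ls.flatten = (Z.map steps).sum := by
  induction h with
  | nil => simp
  | cons h _ ih => rw [List.flatten_cons, loopsEdges_append, h, ih]; simp

theorem loopsEdges_glue {ℓ : MatLoop N} {i : Fin N} {t : List (Fin N)} {Z : List (List (Fin N))}
    {Ls : List (List (MatLoop N))} (hℓ : ℓ.edges = steps (i :: t ++ [i]))
    (hZ : List.Forall₂ IsClosedAt (i :: t) Z)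
    (h : List.Forall₂ (fun L B => loopsEdges L = steps B) Ls Z) :
    loopsEdges (ℓ :: Ls.flatten) = steps (Z.flatten ++ [i]) := by
  rw [loopsEdges_cons, hℓ, loopsEdges_flatten h, steps_flatten hZ]

/-- Split the word without its closing letter: the skeleton has distinct letters and closes up to a
loop, and the blocks are shorter closed words, handled by induction. -/
theorem exists_loops (j : Fin N) (B : List (Fin N)) (hB : IsClosedAt j B) :
    ∃ L : List (MatLoop N), loopsEdges L = steps B := by
  induction hn : B.length using Nat.strong_induction_on generalizing j B with
  | _ n ih =>
    subst hn
    obtain ⟨w, rfl⟩ := List.getLast?_eq_some_iff.1 hB.2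
    obtain ⟨js, Z, rfl, hZ, hnd, -⟩ := exists_split w
    cases js with
    | nil => 
      cases hZ
      exact ⟨[], by simp⟩
    | cons i t =>
      have hi : i = j := by
        have h1 := hB.1
        cases hZ with
        | cons h _ =>
          rw [List.flatten_cons, List.append_assoc, List.head?_append, h.1] at h1
          simpa using h1
      subst hi
      obtain ⟨ℓ, hℓ⟩ := exists_loop_of_nodup hnd
      obtain ⟨Ls, hLs⟩ := exists_loops_of_blocks (Z := Z) (by
        intro C hC
        obtain ⟨c, -, hc⟩ : ∃ c ∈ i :: t, IsClosedAt c C := by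
          clear hB ih hnd hℓ
          generalize i :: t = js at hZ ⊢
          induction hZ with
          | nil => simp at hC
          | @cons a b l₁ l₂ h1 _ ih =>
            rcases List.mem_cons.1 hC with rfl | hC
            · exact ⟨a, by simp, h1⟩
            · obtain ⟨c, hc, h⟩ := ih hC
              exact ⟨c, by simp [hc], h⟩
        refine ih _ ?_ c C hc rfl
        have := (List.sublist_flatten_of_mem hC).length_le
        rw [List.length_append, List.length_singleton]
        omega)
      exact ⟨_, loopsEdges_glue hℓ hZ hLs⟩

/-- The blocks of a split of a word are pairwise disjoint if the word, closed up, is a tree of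
loops. -/
theorem split_pairwise_disjoint {ℓ : MatLoop N} {i : Fin N} {t : List (Fin N)}
    {Z : List (List (Fin N))} {Ls : List (List (MatLoop N))} 
    (hZ : List.Forall₂ IsClosedAt (i :: t) Z)
    (h : List.Forall₂ (fun L B => loopsEdges L = steps B) Ls Z)
    (hcard : (Z.flatten ++ [i]).length ≤
      (Z.flatten ++ [i]).toFinset.card + (ℓ :: Ls.flatten).length) :
    Z.Pairwise List.Disjoint := by
  apply pairwise_disjoint_of_sum_card_le
  -- Sum the inequality "sites plus loops at most letters" over the blocks. Compared with `hcard`,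
  -- it bounds the total of the block cardinalities by the cardinality of the union.
  have key : ∀ {js : List (Fin N)} {Z : List (List (Fin N))} {Ls : List (List (MatLoop N))},
      List.Forall₂ IsClosedAt js Z → List.Forall₂ (fun L B => loopsEdges L = steps B) Ls Z →
      (Z.map fun B => B.toFinset.card).sum + Ls.flatten.length ≤ Z.flatten.length := by
    intro js Z Ls hZ h
    induction h generalizing js with
    | nil => simp
    | cons h1 _ ih =>
      cases hZ with
      | cons h2 hZ =>
        have a := ih hZ
        have b := card_toFinset_add_length_le h1 h2.ne_nil
        simp at a b ⊢
        omega
  have h1 := key hZ h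
  have h2 : (Z.flatten ++ [i]).toFinset = Z.flatten.toFinset := by
    cases hZ with
    | cons h _ =>
      ext v
      simp only [List.mem_toFinset, List.mem_append, List.mem_singleton]
      constructor
      · rintro (h' | rfl)
        · exact h'
        · simp [h.mem]
      · exact Or.inl
  rw [h2] at hcard
  simp only [List.length_append, List.length_cons, List.length_nil] at hcard
  omega

end LoopDecomposition

/-! ### Sums over words -/

section WordSums

variable {V : Type*} [Fintype V] [DecidableEq V]

variable (V) in
/-- The words of length `n`. -/
def words : ℕ → Finset (List V)
  | 0 => {[]}
  | n + 1 => (Finset.univ ×ˢ words n).image fun p => p.1 :: p.2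

theorem mem_words {n : ℕ} {w : List V} : w ∈ words V n ↔ w.length = n := by
  induction n generalizing w with
  | zero => simp [words]
  | succ n ih =>
    cases w with
    | nil => simp [words]
    | cons a w => simp [words, ih]

theorem sum_words_succ {R : Type*} [AddCommMonoid R] (n : ℕ) (f : List V → R) :
    ∑ w ∈ words V (n + 1), f w = ∑ a, ∑ w ∈ words V n, f (a :: w) := by
  rw [words, Finset.sum_image, Finset.sum_product]
  rintro ⟨a, w⟩ _ ⟨b, w'⟩ _ h
  simpa using h

theorem sum_fun_eq_sum_words {R : Type*} [AddCommMonoid R] (n : ℕ) (f : List V → R) :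
    ∑ y : Fin n → V, f (List.ofFn y) = ∑ w ∈ words V n, f w := by
  induction n generalizing f with
  | zero => simp [words]
  | succ n ih =>
    rw [sum_words_succ, ← (Fin.consEquiv fun _ => V).sum_comp, Fintype.sum_prod_type]
    refine Finset.sum_congr rfl fun a _ => ?_
    rw [← ih]
    refine Finset.sum_congr rfl fun y _ => ?_
    simp [Fin.consEquiv, List.ofFn_succ]

instance (j : V) (B : List V) : Decidable (IsClosedAt j B) :=
  inferInstanceAs (Decidable (_ ∧ _))

/-- The sequences of closed words at the letters of `js` of total length `n`. -/
def closedBlocks : List V → ℕ → Finset (List (List V))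
  | [], n => if n = 0 then {[]} else ∅
  | j :: js, n => (Finset.HasAntidiagonal.antidiagonal n).biUnion fun p =>
      (((words V p.1).filter (IsClosedAt j)) ×ˢ closedBlocks js p.2).image fun q => q.1 :: q.2

theorem mem_closedBlocks {js : List V} {n : ℕ} {Z : List (List V)} :
    Z ∈ closedBlocks js n ↔ List.Forall₂ IsClosedAt js Z ∧ Z.flatten.length = n := by
  induction js generalizing n Z with
  | nil =>
    rw [closedBlocks, List.forall₂_nil_left_iff]
    split_ifs with h
    · subst h
      simp only [Finset.mem_singleton]
      exact ⟨fun h => by simp [h], fun h => h.1⟩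
    · simp only [Finset.notMem_empty, false_iff]
      rintro ⟨rfl, h'⟩
      exact h (by simpa using h'.symm)
  | cons j js ih =>
    rw [closedBlocks]
    simp only [Finset.mem_biUnion, Finset.mem_image, Finset.mem_product, Finset.mem_filter,
      mem_words, ih, Finset.HasAntidiagonal.mem_antidiagonal]
    constructor
    · rintro ⟨⟨p, q⟩, hpq, ⟨B, Z'⟩, ⟨⟨h1, h2⟩, h3, h4⟩, rfl⟩
      refine ⟨.cons h2 h3, ?_⟩
      simp only at h1 h4 hpq ⊢
      rw [List.flatten_cons, List.length_append, h1, h4, hpq]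
    · rintro ⟨h, hl⟩
      cases h with
      | @cons _ B _ Z' h2 h3 =>
        refine ⟨(B.length, Z'.flatten.length), by simpa using hl, ⟨B, Z'⟩, ⟨⟨rfl, h2⟩, h3, rfl⟩, rfl⟩

/-- Choosing a sequence of blocks means distributing the total length over the letters and then
choosing each block independently: a Cauchy product. -/
theorem sum_closedBlocks {R : Type*} [CommSemiring R] (f : List V → R) (js : List V) (n : ℕ) :
    ∑ Z ∈ closedBlocks js n, (Z.map f).prod =
      PowerSeries.coeff n (js.map fun j =>
        PowerSeries.mk fun p => ∑ B ∈ (words V p).filter (IsClosedAt j), f B).prod := by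
  induction js generalizing n with
  | nil =>
    rw [closedBlocks, List.map_nil, List.prod_nil, PowerSeries.coeff_one]
    split_ifs <;> simp
  | cons j js ih =>
    rw [closedBlocks, Finset.sum_biUnion, List.map_cons, List.prod_cons, PowerSeries.coeff_mul]
    · refine Finset.sum_congr rfl fun p _ => ?_
      rw [Finset.sum_image, Finset.sum_product, ← ih, PowerSeries.coeff_mk, Finset.sum_mul_sum]
      · simp
      · rintro ⟨a, w⟩ _ ⟨b, w'⟩ _ h
        simpa using h
    · intro p _ q _ hpq
      rw [Function.onFun, Finset.disjoint_left]
      intro Z hZ hZ'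
      simp only [Finset.mem_image, Finset.mem_product, Finset.mem_filter, mem_words,
        mem_closedBlocks] at hZ hZ'
      obtain ⟨⟨B, Z'⟩, ⟨⟨h1, -⟩, -, h2⟩, rfl⟩ := hZ
      obtain ⟨⟨B', Z''⟩, ⟨⟨h1', -⟩, -, h2'⟩, h⟩ := hZ'
      simp only [List.cons.injEq] at h h1 h2 h1' h2'
      rw [h.1] at h1'
      rw [h.2] at h2'
      exact hpq (Prod.ext (h1.symm.trans h1') (h2.symm.trans h2'))

/-- Pairs of a word `t` and of a split into closed words at the pairwise distinct letters of
`i :: t`, of total length `n`. -/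
def splits (i : V) (n : ℕ) : Finset ((_ : List V) × List (List V)) :=
  (((Finset.range n).biUnion (words V)).filter fun t => (i :: t).Nodup).sigma
    fun t => closedBlocks (i :: t) n

theorem mem_splits {i : V} {n : ℕ} {p : (_ : List V) × List (List V)} :
    p ∈ splits i n ↔ (i :: p.1).Nodup ∧ List.Forall₂ IsClosedAt (i :: p.1) p.2 ∧
      p.2.flatten.length = n := by
  rw [splits, Finset.mem_sigma, Finset.mem_filter, mem_closedBlocks]
  simp only [Finset.mem_biUnion, Finset.mem_range, mem_words]
  constructor
  · rintro ⟨⟨-, h1⟩, h2, h3⟩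
    exact ⟨h1, h2, h3⟩
  · rintro ⟨h1, h2, h3⟩
    refine ⟨⟨⟨_, ?_, rfl⟩, h1⟩, h2, h3⟩
    have := length_le_length_flatten h2
    simp only [List.length_cons] at this
    omega

/-- For a fixed word, the block lengths determine the blocks, and the blocks determine their base
letters. The block lengths form a composition of `n`. -/
theorem card_splits_fiber_le (i : V) (n : ℕ) (w : List V) :
    ((splits i n).filter fun p => p.2.flatten = w).card ≤ 2 ^ n := by
  have h1 : ((splits i n).filter fun p => p.2.flatten = w).card ≤
      ((Finset.univ : Finset (Composition n)).image Composition.blocks).card := by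
    refine Finset.card_le_card_of_injOn (fun p => p.2.map List.length) ?_ ?_
    · intro p hp
      simp only [Finset.coe_filter, Set.mem_ofPred_eq, mem_splits] at hp
      obtain ⟨⟨-, hZ, hlen⟩, -⟩ := hp
      simp only [Finset.coe_image, Finset.coe_univ, Set.image_univ, Set.mem_range]
      refine ⟨⟨p.2.map List.length, ?_, ?_⟩, rfl⟩
      · clear hlen
        generalize i :: p.1 = js at hZ
        generalize p.2 = Z at hZ
        induction hZ with
        | nil => simp
        | cons h _ ih =>
          intro k hk
          rcases List.mem_cons.1 hk with rfl | hk
          · exact List.length_pos_iff.2 h.ne_nil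
          · exact ih hk
      · rw [← hlen, List.length_flatten]
    · rintro ⟨t, Z⟩ hp ⟨t', Z'⟩ hp' h
      simp only [Finset.coe_filter, Set.mem_ofPred_eq, mem_splits] at hp hp' h
      have hZ : Z = Z' := List.eq_iff_flatten_eq.2 ⟨hp.2.trans hp'.2.symm, h⟩
      subst hZ
      have := heads_eq hp.1.2.1 hp'.1.2.1
      simp only [List.cons.injEq, true_and] at this
      rw [this]
  refine h1.trans (Finset.card_image_le.trans ?_)
  rw [Finset.card_univ, composition_card]
  exact Nat.pow_le_pow_right (by norm_num) (Nat.sub_le _ _)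

/-- A new letter either repeats one of at most `n + 1` known ones, leaving the weight unchanged, or
is one of at most `N` others, each costing a factor `N⁻¹`. So each letter multiplies the sum by at
most `n + 2`. -/
theorem sum_words_inv_pow_card_le {N : ℕ} (hN : 1 ≤ N) (i : Fin N) (n : ℕ) :
    ∑ w ∈ words (Fin N) n, (N : ℝ) ^ (-((insert i w.toFinset).card : ℤ)) ≤
      (n + 1).factorial * (N : ℝ)⁻¹ := by
  have hN0 : (0 : ℝ) < N := by exact_mod_cast hN
  induction n with
  | zero => simp [words]
  | succ n ih =>
    rw [sum_words_succ, Finset.sum_comm]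
    have key : ∀ w ∈ words (Fin N) n,
        ∑ a : Fin N, (N : ℝ) ^ (-((insert i (a :: w).toFinset).card : ℤ)) ≤
          (n + 1 + 1) * (N : ℝ) ^ (-((insert i w.toFinset).card : ℤ)) := by
      intro w hw
      set S := insert i w.toFinset with hS
      have hcard : S.card ≤ n + 1 := by
        refine (Finset.card_insert_le _ _).trans ?_
        have := List.toFinset_card_le w
        rw [mem_words.1 hw] at this
        omega
      have hcard' : (S.card : ℝ) ≤ n + 1 := by exact_mod_cast hcard
      have hins : ∀ a, insert i (a :: w).toFinset = insert a S := by
        intro a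
        rw [List.toFinset_cons, hS, Finset.insert_comm]
      have hpos : 0 < (N : ℝ) ^ (-(S.card : ℤ)) := by positivity
      calc ∑ a : Fin N, (N : ℝ) ^ (-((insert i (a :: w).toFinset).card : ℤ))
          ≤ ∑ a : Fin N, ((if a ∈ S then (N : ℝ) ^ (-(S.card : ℤ)) else 0) +
              (N : ℝ)⁻¹ * (N : ℝ) ^ (-(S.card : ℤ))) := by
            refine Finset.sum_le_sum fun a _ => ?_
            rw [hins]
            split_ifs with h
            · rw [Finset.insert_eq_of_mem h]
              have : 0 ≤ (N : ℝ)⁻¹ * (N : ℝ) ^ (-(S.card : ℤ)) := by positivity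
              linarith
            · rw [Finset.card_insert_of_notMem h, zero_add, ← zpow_neg_one, ← zpow_add₀ hN0.ne']
              apply le_of_eq
              congr 1
              push_cast
              ring
        _ = (S.card + 1) * (N : ℝ) ^ (-(S.card : ℤ)) := by
            rw [Finset.sum_add_distrib, Finset.sum_ite_mem, Finset.univ_inter, Finset.sum_const,
              Finset.sum_const, Finset.card_univ, Fintype.card_fin]
            simp only [nsmul_eq_mul]
            field_simp
        _ ≤ _ := by gcongr
    calc _ ≤ ∑ w ∈ words (Fin N) n, (n + 1 + 1) * (N : ℝ) ^ (-((insert i w.toFinset).card : ℤ)) :=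
          Finset.sum_le_sum key
      _ = (n + 1 + 1) * ∑ w ∈ words (Fin N) n, (N : ℝ) ^ (-((insert i w.toFinset).card : ℤ)) := by
          rw [Finset.mul_sum]
      _ ≤ (n + 1 + 1) * ((n + 1).factorial * (N : ℝ)⁻¹) := by gcongr
      _ = _ := by
          rw [Nat.factorial_succ (n + 1)]; push_cast; ring

end WordSums

/-! ### Estimates for expectations along closed words -/

section Estimates

variable {N : ℕ}

/-- The bounds (ii) and (iii) for products of at most `n` matrix entries, for a fixed `N`, with
`e S` the expectation of the product of the entries at the positions in `S`. -/
structure MomentBound (N n : ℕ) (C : ℝ) (e : Multiset (Fin N × Fin N) → ℂ) : Prop where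
  loop : ∀ ℓ : MatLoop N, ℓ.len ≤ n → ‖e ℓ.edges‖ ≤ C * (N : ℝ) ^ (1 - (ℓ.len : ℤ))
  factorization : ∀ L : List (MatLoop N), loopsLen L ≤ n → LoopsPinched L →
    ‖e (loopsEdges L) - (L.map fun ℓ => e ℓ.edges).prod‖ ≤
      C * (N : ℝ) ^ ((L.length : ℤ) - loopsLen L - 1)
  coincidences : ∀ L : List (MatLoop N), loopsLen L ≤ n → LoopsFinest L →
    ‖e (loopsEdges L)‖ ≤ C * (N : ℝ) ^ ((L.length : ℤ) - loopsLen L)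

theorem loopsLen_append (L L' : List (MatLoop N)) :
    loopsLen (L ++ L') = loopsLen L + loopsLen L' := by simp [loopsLen]

theorem norm_prod_map_le {C : ℝ} (hC : 1 ≤ C) (hN : 1 ≤ N) {n : ℕ}
    {e : Multiset (Fin N × Fin N) → ℂ} (he : MomentBound N n C e) {L : List (MatLoop N)}
    (hL : loopsLen L ≤ n) :
    ‖(L.map fun ℓ => e ℓ.edges).prod‖ ≤ C ^ n * (N : ℝ) ^ ((L.length : ℤ) - loopsLen L) := by
  have hN0 : (0 : ℝ) < N := by exact_mod_cast hN
  have key : ‖(L.map fun ℓ => e ℓ.edges).prod‖ ≤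
      C ^ L.length * (N : ℝ) ^ ((L.length : ℤ) - loopsLen L) := by
    induction L with
    | nil => simp
    | cons ℓ L ih =>
      rw [loopsLen_cons] at hL
      rw [List.map_cons, List.prod_cons, norm_mul]
      calc _ ≤ (C * (N : ℝ) ^ (1 - (ℓ.len : ℤ))) *
            (C ^ L.length * (N : ℝ) ^ ((L.length : ℤ) - loopsLen L)) := by
            gcongr
            · exact he.loop ℓ (by omega)
            · exact ih (by omega)
        _ = C ^ (ℓ :: L).length * ((N : ℝ) ^ (1 - (ℓ.len : ℤ)) *
              (N : ℝ) ^ ((L.length : ℤ) - loopsLen L)) := by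
            rw [List.length_cons, pow_succ]; ring
        _ = _ := by
            rw [← zpow_add₀ hN0.ne', List.length_cons, loopsLen_cons]
            congr 2
            push_cast; ring
  refine key.trans ?_
  gcongr
  exact (length_le_loopsLen L).trans hL

/-- Each block of the split is decomposed into as many loops as possible. -/
theorem exists_finest_loops {B : List (Fin N)} (h : ∃ L : List (MatLoop N), loopsEdges L = steps B) :
    ∃ L : List (MatLoop N), loopsEdges L = steps B ∧ LoopsFinest L := by
  classical
  have hb : ∀ m, (∃ L : List (MatLoop N), loopsEdges L = steps B ∧ L.length = m) →
      m ≤ B.length := by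
    rintro m ⟨L, hL, rfl⟩
    have := length_le_loopsLen L
    rw [loopsLen_eq_of_steps hL] at this
    omega
  obtain ⟨L₀, hL₀⟩ := h
  obtain ⟨L, hL, hlen⟩ := Nat.findGreatest_spec (P := fun m =>
    ∃ L : List (MatLoop N), loopsEdges L = steps B ∧ L.length = m) (hb _ ⟨L₀, hL₀, rfl⟩)
    ⟨L₀, hL₀, rfl⟩
  refine ⟨L, hL, fun L' hL' => ?_⟩
  rw [hlen]
  exact Nat.le_findGreatest (hb _ ⟨L', hL'.trans hL, rfl⟩) ⟨L', hL'.trans hL, rfl⟩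

theorem norm_prod_blocks_le {C : ℝ} (hC : 1 ≤ C) (hN : 1 ≤ N) {n : ℕ}
    {e : Multiset (Fin N × Fin N) → ℂ} (he : MomentBound N n C e)
    {Ls : List (List (MatLoop N))} {Z : List (List (Fin N))}
    (h : List.Forall₂ (fun L B => loopsEdges L = steps B ∧ LoopsFinest L) Ls Z)
    (hlen : loopsLen Ls.flatten ≤ n) :
    ‖(Z.map fun B => e (steps B)).prod‖ ≤
      C ^ Z.length * (N : ℝ) ^ ((Ls.flatten.length : ℤ) - loopsLen Ls.flatten) := by
  have hN0 : (0 : ℝ) < N := by exact_mod_cast hN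
  induction h with
  | nil => simp
  | @cons L B Ls Z h1 _ ih =>
    rw [List.flatten_cons, loopsLen_append] at hlen
    rw [List.map_cons, List.prod_cons, norm_mul]
    have h2 := he.coincidences L (by omega) h1.2
    rw [h1.1] at h2
    calc _ ≤ (C * (N : ℝ) ^ ((L.length : ℤ) - loopsLen L)) *
          (C ^ Z.length * (N : ℝ) ^ ((Ls.flatten.length : ℤ) - loopsLen Ls.flatten)) := by
          gcongr
          exact ih (by omega)
      _ = C ^ (B :: Z).length * ((N : ℝ) ^ ((L.length : ℤ) - loopsLen L) *
            (N : ℝ) ^ ((Ls.flatten.length : ℤ) - loopsLen Ls.flatten)) := by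
          rw [List.length_cons, pow_succ]; ring
      _ = _ := by
          rw [← zpow_add₀ hN0.ne', List.flatten_cons, List.length_append, loopsLen_append]
          congr 2
          push_cast; ring

/-- Blocks whose loops are pinched are factorized one after the other, by `x X - y Y = (x - y) X + y
(X - Y)`; each replacement costs a factor `N⁻¹`. The constant `C ^ (n + 1)` dominates both `C` and
`C ^ n`. -/
theorem norm_prod_blocks_sub_le {C : ℝ} (hC : 1 ≤ C) (hN : 1 ≤ N) {n : ℕ}
    {e : Multiset (Fin N × Fin N) → ℂ} (he : MomentBound N n C e)
    {Ls : List (List (MatLoop N))} {Z : List (List (Fin N))}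
    (h : List.Forall₂ (fun L B => loopsEdges L = steps B ∧ LoopsFinest L) Ls Z)
    (hp : ∀ L ∈ Ls, ∃ L', L'.Perm L ∧ LoopsPinched L')
    (hlen : loopsLen Ls.flatten ≤ n) :
    ‖(Z.map fun B => e (steps B)).prod - (Ls.flatten.map fun ℓ => e ℓ.edges).prod‖ ≤
      Z.length * (C ^ (n + 1)) ^ Z.length *
        (N : ℝ) ^ ((Ls.flatten.length : ℤ) - loopsLen Ls.flatten - 1) := by
  have hN0 : (0 : ℝ) < N := by exact_mod_cast hN
  set K := C ^ (n + 1) with hK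
  have hCK : C ≤ K := le_self_pow₀ hC (by omega)
  have hK1 : 1 ≤ K := hC.trans hCK
  have hCK' : C ^ n ≤ K := pow_le_pow_right₀ hC (by omega)
  induction h with
  | nil => simp
  | @cons L B Ls Z h1 h ih =>
    rw [List.flatten_cons, loopsLen_append] at hlen
    have h2 := ih (fun L hL => hp L (by simp [hL])) (by omega)
    obtain ⟨L', hL', hpin⟩ := hp L (by simp)
    have h3 := he.factorization L' (by rw [loopsLen_perm hL']; omega) hpin
    rw [loopsLen_perm hL', hL'.length_eq, loopsEdges_perm hL', (hL'.map _).prod_eq, h1.1] at h3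
    have h4 := norm_prod_blocks_le hC hN he h (by omega)
    have h5 := norm_prod_map_le hC hN he (L := L) (by omega)
    rw [List.map_cons, List.prod_cons, List.flatten_cons, List.map_append, List.prod_append]
    set x := e (steps B)
    set y := (L.map fun ℓ => e ℓ.edges).prod
    set X := (Z.map fun B => e (steps B)).prod
    set Y := (Ls.flatten.map fun ℓ => e ℓ.edges).prod
    set s : ℤ := (L.length : ℤ) - loopsLen L
    set S : ℤ := (Ls.flatten.length : ℤ) - loopsLen Ls.flatten
    set m := Z.length
    have hexp : (((L ++ Ls.flatten).length : ℤ) - loopsLen (L ++ Ls.flatten) - 1) = s + S - 1 := by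
      rw [List.length_append, loopsLen_append]; push_cast; ring
    rw [hexp, List.length_cons]
    have e1 : (N : ℝ) ^ (s + S - 1) = (N : ℝ) ^ (s - 1) * (N : ℝ) ^ S := by
      rw [← zpow_add₀ hN0.ne']; congr 1; ring
    have e2 : (N : ℝ) ^ (s + S - 1) = (N : ℝ) ^ s * (N : ℝ) ^ (S - 1) := by
      rw [← zpow_add₀ hN0.ne']; congr 1; ring
    calc ‖x * X - y * Y‖ = ‖(x - y) * X + y * (X - Y)‖ := by congr 1; ring
      _ ≤ ‖x - y‖ * ‖X‖ + ‖y‖ * ‖X - Y‖ := by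
          refine (norm_add_le _ _).trans ?_
          rw [norm_mul, norm_mul]
      _ ≤ (K * (N : ℝ) ^ (s - 1)) * (K ^ m * (N : ℝ) ^ S) +
          (K * (N : ℝ) ^ s) * (m * K ^ m * (N : ℝ) ^ (S - 1)) := by
          gcongr
          · exact h3.trans (by gcongr)
          · exact h4.trans (by gcongr)
          · exact h5.trans (by gcongr)
      _ = K ^ (m + 1) * ((N : ℝ) ^ (s - 1) * (N : ℝ) ^ S) +
          m * K ^ (m + 1) * ((N : ℝ) ^ s * (N : ℝ) ^ (S - 1)) := by ring
      _ = _ := by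
          rw [← e1, ← e2]; push_cast; ring

theorem exists_finest_loops_of_blocks {js : List (Fin N)} {Z : List (List (Fin N))}
    (hZ : List.Forall₂ IsClosedAt js Z) :
    ∃ Ls : List (List (MatLoop N)),
      List.Forall₂ (fun L B => loopsEdges L = steps B ∧ LoopsFinest L) Ls Z := by
  induction hZ with
  | nil => exact ⟨[], .nil⟩
  | cons h _ ih =>
    obtain ⟨L, hL⟩ := exists_finest_loops (exists_loops _ _ h)
    obtain ⟨Ls, hLs⟩ := ih
    exact ⟨L :: Ls, .cons hL hLs⟩

/-- The expectation along a closed word agrees, up to an error that is negligible by a factor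
`N⁻¹` in the sum over all words, with the sum over its splits. -/
theorem norm_moment_sub_splits_le {C : ℝ} (hC : 1 ≤ C) (hN : 1 ≤ N) {n : ℕ}
    {e : Multiset (Fin N × Fin N) → ℂ} (he : MomentBound N n C e) (i : Fin N) {w : List (Fin N)}
    (hw : w.length = n) (hhead : w.head? = some i) :
    ‖e (steps (w ++ [i])) - ∑ p ∈ (splits i n).filter (fun p => p.2.flatten = w),
        e (steps (i :: p.1 ++ [i])) * (p.2.map fun B => e (steps B)).prod‖ ≤
      (C + 2 ^ n * (C * C ^ n) + C * (n * (C ^ (n + 1)) ^ n)) *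
        (N : ℝ) ^ (-((insert i w.toFinset).card : ℤ)) := by
  have hN0 : (0 : ℝ) < N := by exact_mod_cast hN
  have hN1 : (1 : ℝ) ≤ N := by exact_mod_cast hN
  have hset : insert i w.toFinset = (w ++ [i]).toFinset := by
    ext; simp
  rw [hset]
  set F := (splits i n).filter (fun p => p.2.flatten = w) with hF
  set v := (w ++ [i]).toFinset.card with hv
  have hWclosed : IsClosedAt i (w ++ [i]) := ⟨by rw [List.head?_append, hhead]; rfl, by simp⟩
  have hWne := hWclosed.ne_nil
  have hWlen : (w ++ [i]).length = n + 1 := by simp [hw]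
  have hsplit : ∀ p ∈ F,
      ∃ (ℓ : MatLoop N) (Ls : List (List (MatLoop N))), ℓ.edges = steps (i :: p.1 ++ [i]) ∧
        List.Forall₂ (fun L B => loopsEdges L = steps B ∧ LoopsFinest L) Ls p.2 ∧
        loopsEdges (ℓ :: Ls.flatten) = steps (w ++ [i]) ∧ p.2.length ≤ n ∧
        List.Forall₂ IsClosedAt (i :: p.1) p.2 := by
    intro p hp
    rw [hF, Finset.mem_filter, mem_splits] at hp
    obtain ⟨⟨hnd, hZ, hlen⟩, hfl⟩ := hp
    obtain ⟨ℓ, hℓ⟩ := exists_loop_of_nodup hnd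
    obtain ⟨Ls, hLs⟩ := exists_finest_loops_of_blocks hZ
    refine ⟨ℓ, Ls, hℓ, hLs, ?_, ?_, hZ⟩
    · rw [← hfl]
      exact loopsEdges_glue hℓ hZ (hLs.imp fun _ _ h => h.1)
    · have := length_le_length_flatten hZ
      rw [hZ.length_eq] at this
      omega
  have hterm : ∀ (ℓ : MatLoop N) (Ls : List (List (MatLoop N))),
      loopsEdges (ℓ :: Ls.flatten) = steps (w ++ [i]) → ℓ.len + loopsLen Ls.flatten = n ∧
        v + (1 + Ls.flatten.length) ≤ n + 1 := by
    intro ℓ Ls h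
    have h1 := loopsLen_eq_of_steps h
    have h2 := card_toFinset_add_length_le h hWne
    rw [loopsLen_cons, hWlen] at h1
    rw [hWlen, List.length_cons] at h2
    exact ⟨by omega, by omega⟩
  obtain ⟨L, hL, hfin⟩ := exists_finest_loops (exists_loops i _ hWclosed)
  have hLlen : loopsLen L = n := by rw [loopsLen_eq_of_steps hL, hWlen]; rfl
  have hLcard := card_toFinset_add_length_le hL hWne
  rw [hWlen, ← hv] at hLcard
  have hX : 0 ≤ (N : ℝ) ^ (-(v : ℤ)) := by positivity
  have hC0 : 0 ≤ C := by linarith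
  rcases Nat.lt_or_ge (v + L.length) (n + 1) with hbad | hgood
  · -- every decomposition has too few loops
    have hb1 : ‖e (steps (w ++ [i]))‖ ≤ C * (N : ℝ) ^ (-(v : ℤ)) := by
      rw [← hL]
      refine (he.coincidences L hLlen.le hfin).trans ?_
      gcongr
      · omega
    have hb2 : ∀ p ∈ F,
        ‖e (steps (i :: p.1 ++ [i])) * (p.2.map fun B => e (steps B)).prod‖ ≤
          C * C ^ n * (N : ℝ) ^ (-(v : ℤ)) := by
      intro p hp
      obtain ⟨ℓ, Ls, hℓ, hLs, hglue, hlen, -⟩ := hsplit p hp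
      obtain ⟨h1, h2⟩ := hterm ℓ Ls hglue
      -- Gluing the split yields another decomposition of the same walk, so its number of loops is
      -- at most the maximal one, which already misses the bound.
      have h3 := hfin _ (hglue.trans hL.symm)
      rw [List.length_cons] at h3
      rw [norm_mul, ← hℓ]
      calc _ ≤ (C * (N : ℝ) ^ (1 - (ℓ.len : ℤ))) *
            (C ^ p.2.length * (N : ℝ) ^ ((Ls.flatten.length : ℤ) - loopsLen Ls.flatten)) := by
            gcongr
            · exact he.loop ℓ (by omega)
            · exact norm_prod_blocks_le hC hN he hLs (by omega)
        _ = C * C ^ p.2.length * ((N : ℝ) ^ (1 - (ℓ.len : ℤ)) *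
              (N : ℝ) ^ ((Ls.flatten.length : ℤ) - loopsLen Ls.flatten)) := by ring
        _ ≤ _ := by
            rw [← zpow_add₀ hN0.ne']
            gcongr
            omega
    calc _ ≤ ‖e (steps (w ++ [i]))‖ + ‖∑ p ∈ F,
          e (steps (i :: p.1 ++ [i])) * (p.2.map fun B => e (steps B)).prod‖ := norm_sub_le _ _
      _ ≤ C * (N : ℝ) ^ (-(v : ℤ)) +
          F.card •
            (C * C ^ n * (N : ℝ) ^ (-(v : ℤ))) := by
          gcongr
          refine (norm_sum_le _ _).trans (Finset.sum_le_card_nsmul _ _ _ hb2)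
      _ ≤ C * (N : ℝ) ^ (-(v : ℤ)) + 2 ^ n * (C * C ^ n * (N : ℝ) ^ (-(v : ℤ))) := by
          rw [nsmul_eq_mul]
          gcongr
          exact_mod_cast card_splits_fiber_le i n w
      _ = (C + 2 ^ n * (C * C ^ n) + 0) * (N : ℝ) ^ (-(v : ℤ)) := by ring
      _ ≤ _ := by gcongr; positivity
  · -- a tree of loops: there is exactly one split
    have hcardL : (w ++ [i]).length ≤ (w ++ [i]).toFinset.card + L.length := by
      rw [hWlen]; exact hgood
    -- Every split glues to a decomposition with the same number of loops as `L`, hence saturating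
    -- the bound, and saturation makes the blocks disjoint.
    have hdisj : ∀ p ∈ F,
        p.2.Pairwise List.Disjoint := by
      intro p hp
      obtain ⟨ℓ, Ls, hℓ, hLs, hglue, hlen, hZ⟩ := hsplit p hp
      have hfl := (Finset.mem_filter.1 hp).2
      have hlen' := length_eq_of_card hL hglue hWne hcardL
      refine split_pairwise_disjoint (ℓ := ℓ) hZ (hLs.imp fun _ _ h => h.1) ?_
      rw [hfl, hlen']
      exact hcardL
    obtain ⟨p₀, hp₀, huniq⟩ : ∃ p₀ ∈ F,
        ∀ p ∈ F, p = p₀ := by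
      obtain ⟨js, Z, hfl, hZ, hnd, -⟩ := exists_split w
      cases js with
      | nil =>
        cases hZ
        subst hfl
        simp at hhead
      | cons i' t =>
        have hi : i = i' := by
          have := head_flatten hZ
          rw [hfl, hhead] at this
          exact Option.some.inj this
        subst hi
        have hmem : (⟨t, Z⟩ : (_ : List (Fin N)) × List (List (Fin N))) ∈
            F := by
          rw [hF, Finset.mem_filter, mem_splits]
          exact ⟨⟨hnd, hZ, by rw [hfl, hw]⟩, hfl⟩
        refine ⟨⟨t, Z⟩, hmem, fun p hp => ?_⟩
        have hp' := hp
        rw [hF, Finset.mem_filter, mem_splits] at hp'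
        have := split_unique hp'.1.2.1 hZ (hdisj p hp) (hdisj _ hmem) (hp'.2.trans hfl.symm)
        obtain ⟨t', Z'⟩ := p
        simp only [List.cons.injEq, true_and] at this
        rw [this.1, this.2]
    have hsing : F = {p₀} := by
      ext p
      rw [Finset.mem_singleton]
      exact ⟨huniq p, fun h => h ▸ hp₀⟩
    rw [hsing, Finset.sum_singleton]
    obtain ⟨ℓ, Ls, hℓ, hLs, hglue, hlen, -⟩ := hsplit p₀ hp₀
    obtain ⟨h1, h2⟩ := hterm ℓ Ls hglue
    have hlen' := length_eq_of_card hL hglue hWne hcardL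
    -- The whole family is pinched in a suitable order, and so is the subfamily of each block;
    -- factorization applies to the full walk as well as block by block.
    obtain ⟨P, hperm, hpin⟩ := exists_perm_pinched hglue hWne (by rw [hlen']; exact hcardL)
    have hpins : ∀ L ∈ Ls, ∃ L', L'.Perm L ∧ LoopsPinched L' := by
      intro L hL
      have hsub : L.Subperm P :=
        (((List.sublist_flatten_of_mem hL).trans (List.sublist_cons_self _ _)).subperm).trans
          hperm.symm.subperm
      obtain ⟨L', hL', hs⟩ := hsub
      exact ⟨L', hL', hpin.sublist hs⟩
    have hf := he.factorization P (by rw [loopsLen_perm hperm, loopsLen_cons]; omega) hpin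
    rw [loopsLen_perm hperm, hperm.length_eq, loopsEdges_perm hperm, (hperm.map _).prod_eq,
      hglue, List.map_cons, List.prod_cons, loopsLen_cons, List.length_cons] at hf
    have hd := norm_prod_blocks_sub_le hC hN he hLs hpins (by omega)
    have hl := he.loop ℓ (by omega)
    rw [← hℓ]
    set x := e (steps (w ++ [i]))
    set y := e ℓ.edges
    set X := (p₀.2.map fun B => e (steps B)).prod
    set Y := (Ls.flatten.map fun ℓ => e ℓ.edges).prod
    set K := C ^ (n + 1) with hK
    have hK1 : 1 ≤ K := one_le_pow₀ hC
    have hzp : 0 ≤ (C + 2 ^ n * (C * C ^ n) + C * (n * K ^ n)) := by positivity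
    -- Both the expectation of the walk and the product over the split are compared with the product
    -- over all individual loops. Each error has exponent `r - n - 1 ≤ -v`.
    calc ‖x - y * X‖ = ‖(x - y * Y) - y * (X - Y)‖ := by congr 1; ring
      _ ≤ ‖x - y * Y‖ + ‖y‖ * ‖X - Y‖ := by
          refine (norm_sub_le _ _).trans ?_
          rw [norm_mul]
      _ ≤ C * (N : ℝ) ^ (-(v : ℤ)) + (C * (N : ℝ) ^ (1 - (ℓ.len : ℤ))) *
          (n * K ^ n * (N : ℝ) ^ ((Ls.flatten.length : ℤ) - loopsLen Ls.flatten - 1)) := by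
          gcongr
          · refine hf.trans ?_
            gcongr
            · push_cast; omega
          · refine hd.trans ?_
            gcongr
      _ = C * (N : ℝ) ^ (-(v : ℤ)) + (C * (n * K ^ n)) * ((N : ℝ) ^ (1 - (ℓ.len : ℤ)) *
            (N : ℝ) ^ ((Ls.flatten.length : ℤ) - loopsLen Ls.flatten - 1)) := by ring
      _ ≤ C * (N : ℝ) ^ (-(v : ℤ)) + (C * (n * K ^ n)) * (N : ℝ) ^ (-(v : ℤ)) := by
          rw [← zpow_add₀ hN0.ne']
          gcongr
          · omega
      _ = (C + 0 + C * (n * K ^ n)) * (N : ℝ) ^ (-(v : ℤ)) := by ring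
      _ ≤ _ := by gcongr; positivity

/-- The crude bound `N^(1 - v)`, from `v + r ≤ n + 1` for the finest decomposition. -/
theorem norm_moment_le {C : ℝ} (hC : 1 ≤ C) (hN : 1 ≤ N) {n : ℕ}
    {e : Multiset (Fin N × Fin N) → ℂ} (he : MomentBound N n C e) (i : Fin N) {w : List (Fin N)}
    (hw : w.length = n) (hhead : w.head? = some i) :
    ‖e (steps (w ++ [i]))‖ ≤ C * N * (N : ℝ) ^ (-((insert i w.toFinset).card : ℤ)) := by
  have hN0 : (0 : ℝ) < N := by exact_mod_cast hN
  have hN1 : (1 : ℝ) ≤ N := by exact_mod_cast hN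
  have hset : insert i w.toFinset = (w ++ [i]).toFinset := by
    ext; simp
  have hWclosed : IsClosedAt i (w ++ [i]) := ⟨by rw [List.head?_append, hhead]; rfl, by simp⟩
  have hWlen : (w ++ [i]).length = n + 1 := by simp [hw]
  obtain ⟨L, hL, hfin⟩ := exists_finest_loops (exists_loops i _ hWclosed)
  have hLlen : loopsLen L = n := by rw [loopsLen_eq_of_steps hL, hWlen]; rfl
  have hLcard := card_toFinset_add_length_le hL hWclosed.ne_nil
  rw [hset, mul_assoc, ← zpow_one_add₀ hN0.ne', ← hL]
  refine (he.coincidences L hLlen.le hfin).trans ?_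
  gcongr
  · omega

end Estimates

/-! ### The recursion for the moments at finite `N` -/

section Recursion

variable {N : ℕ}

/-- The generating function of the closed words at `j`, a word of `p` letters being weighted by
`X ^ p`, by `H` at every letter, and by the expectation along the word. -/
noncomputable def wordSeries (e : Multiset (Fin N × Fin N) → ℂ) (H : Fin N → ℂ) (j : Fin N) : ℂ⟦X⟧ :=
  PowerSeries.mk fun p =>
    ∑ B ∈ (words (Fin N) p).filter (IsClosedAt j), (B.map H).prod * e (steps B)

/-- The sum of the expectations along the closed walks of `n` steps from `i`, weighted by `H` at
every starting point of a step. -/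
noncomputable def walkSum (e : Multiset (Fin N × Fin N) → ℂ) (H : Fin N → ℂ) (n : ℕ) (i : Fin N) : ℂ :=
  ∑ w ∈ (words (Fin N) n).filter (fun w => w.head? = some i), (w.map H).prod * e (steps (w ++ [i]))

theorem norm_map_prod_le {H : Fin N → ℂ} {D : ℝ} (hH : ∀ i, ‖H i‖ ≤ D) (w : List (Fin N)) :
    ‖(w.map H).prod‖ ≤ D ^ w.length := by
  induction w with
  | nil => simp
  | cons a w ih =>
    rw [List.map_cons, List.prod_cons, norm_mul, List.length_cons, pow_succ']
    have := (norm_nonneg _).trans (hH a)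
    gcongr
    exact hH a

/-- The factor `N` in the bound for each walk is compensated by the `N⁻¹` in the count of words; the
bound does not depend on `N` or `i`, as needed for dominated convergence. -/
theorem norm_walkSum_le {C : ℝ} (hC : 1 ≤ C) (hN : 1 ≤ N) {n : ℕ}
    {e : Multiset (Fin N × Fin N) → ℂ} (he : MomentBound N n C e) {H : Fin N → ℂ} {D : ℝ}
    (hD : 0 ≤ D) (hH : ∀ i, ‖H i‖ ≤ D) (i : Fin N) :
    ‖walkSum e H n i‖ ≤ D ^ n * (C * (n + 1).factorial) := by
  have hN0 : (0 : ℝ) < N := by exact_mod_cast hN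
  have hs := sum_words_inv_pow_card_le hN i n
  calc ‖walkSum e H n i‖ ≤ ∑ w ∈ (words (Fin N) n).filter (fun w => w.head? = some i),
        D ^ n * (C * N * (N : ℝ) ^ (-((insert i w.toFinset).card : ℤ))) := by
        refine (norm_sum_le _ _).trans (Finset.sum_le_sum fun w hw => ?_)
        rw [Finset.mem_filter, mem_words] at hw
        rw [norm_mul]
        gcongr
        · have := norm_map_prod_le hH w
          rwa [hw.1] at this
        · exact norm_moment_le hC hN he i hw.1 hw.2
    _ ≤ ∑ w ∈ words (Fin N) n,
        D ^ n * (C * N * (N : ℝ) ^ (-((insert i w.toFinset).card : ℤ))) := by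
        apply Finset.sum_le_sum_of_subset_of_nonneg (Finset.filter_subset _ _)
        intros; positivity
    _ = D ^ n * (C * N * ∑ w ∈ words (Fin N) n, (N : ℝ) ^ (-((insert i w.toFinset).card : ℤ))) := by
        rw [Finset.mul_sum, Finset.mul_sum]
    _ ≤ D ^ n * (C * N * ((n + 1).factorial * (N : ℝ)⁻¹)) := by gcongr
    _ = _ := by field_simp

open Classical in
/-- The sum over first loops of the right hand side of the recursion. -/
noncomputable def loopSum (e : Multiset (Fin N × Fin N) → ℂ) (A : Fin N → ℂ⟦X⟧) (n : ℕ) (i : Fin N) :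
    ℂ :=
  ∑ m ∈ Finset.range n, ∑ y : Fin m → Fin N,
    if hy : Function.Injective (Fin.cons i y : Fin (m + 1) → Fin N) then
      e (loopOfFn _ hy).edges *
        PowerSeries.coeff n (∏ k, A ((Fin.cons i y : Fin (m + 1) → Fin N) k))
    else 0

/-- The letters `i :: t` of the skeleton are the indices of the first loop, and the coefficient of
the product of the word series is the sum over the blocks attached there. -/
theorem loopSum_eq_sum_splits (e : Multiset (Fin N × Fin N) → ℂ) (H : Fin N → ℂ) (n : ℕ)
    (i : Fin N) :
    loopSum e (wordSeries e H) n i = ∑ p ∈ splits i n, e (steps (i :: p.1 ++ [i])) *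
      (p.2.map fun B => (B.map H).prod * e (steps B)).prod := by
  rw [splits, Finset.sum_sigma, Finset.sum_filter, Finset.sum_biUnion, loopSum]
  · refine Finset.sum_congr rfl fun m _ => ?_
    rw [← sum_fun_eq_sum_words]
    refine Finset.sum_congr rfl fun y _ => ?_
    have h0 : i :: List.ofFn y = List.ofFn (Fin.cons i y : Fin (m + 1) → Fin N) := by
      rw [List.ofFn_succ]; simp
    rw [h0]
    by_cases hy : Function.Injective (Fin.cons i y : Fin (m + 1) → Fin N)
    · rw [dif_pos hy, if_pos (List.nodup_ofFn.2 hy), edges_loopOfFn]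
      dsimp only
      rw [h0, ← Finset.mul_sum, sum_closedBlocks, List.map_ofFn, List.prod_ofFn]
      rfl
    · rw [dif_neg hy, if_neg (fun h => hy (List.nodup_ofFn.1 h))]
  · intro a _ b _ hab
    rw [Function.onFun, Finset.disjoint_left]
    intro w hw hw'
    exact hab ((mem_words.1 hw).symm.trans (mem_words.1 hw'))

theorem prod_map_flatten (H : Fin N → ℂ) (e : Multiset (Fin N × Fin N) → ℂ)
    (Z : List (List (Fin N))) : (Z.map fun B => (B.map H).prod * e (steps B)).prod =
      (Z.flatten.map H).prod * (Z.map fun B => e (steps B)).prod := by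
  induction Z with
  | nil => simp
  | cons B Z ih =>
    rw [List.map_cons, List.prod_cons, ih, List.flatten_cons, List.map_append, List.prod_append,
      List.map_cons, List.prod_cons]
    ring

/-- Group the splits by the word they assemble to. The weight by `H` depends on that word alone, so
the error of each word can be summed with `sum_words_inv_pow_card_le`. -/
theorem norm_walkSum_sub_loopSum_le {C : ℝ} (hC : 1 ≤ C) (hN : 1 ≤ N) {n : ℕ}
    {e : Multiset (Fin N × Fin N) → ℂ} (he : MomentBound N n C e) {H : Fin N → ℂ} {D : ℝ}
    (hD : 0 ≤ D) (hH : ∀ i, ‖H i‖ ≤ D) (i : Fin N) :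
    ‖walkSum e H n i - loopSum e (wordSeries e H) n i‖ ≤
      D ^ n * (C + 2 ^ n * (C * C ^ n) + C * (n * (C ^ (n + 1)) ^ n)) * (n + 1).factorial *
        (N : ℝ)⁻¹ := by
  have hN0 : (0 : ℝ) < N := by exact_mod_cast hN
  have hs := sum_words_inv_pow_card_le hN i n
  set K := C + 2 ^ n * (C * C ^ n) + C * (n * (C ^ (n + 1)) ^ n) with hK
  have hK0 : 0 ≤ K := by positivity
  have hmaps : ∀ p ∈ splits i n, p.2.flatten ∈
      (words (Fin N) n).filter (fun w => w.head? = some i) := by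
    intro p hp
    rw [mem_splits] at hp
    rw [Finset.mem_filter, mem_words]
    exact ⟨hp.2.2, head_flatten hp.2.1⟩
  rw [loopSum_eq_sum_splits, ← Finset.sum_fiberwise_of_maps_to hmaps, walkSum,
    ← Finset.sum_sub_distrib]
  calc _ ≤ ∑ w ∈ (words (Fin N) n).filter (fun w => w.head? = some i),
        D ^ n * (K * (N : ℝ) ^ (-((insert i w.toFinset).card : ℤ))) := by
        refine (norm_sum_le _ _).trans (Finset.sum_le_sum fun w hw => ?_)
        rw [Finset.mem_filter, mem_words] at hw
        have h1 : ∑ p ∈ (splits i n).filter (fun p => p.2.flatten = w),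
            e (steps (i :: p.1 ++ [i])) *
              (p.2.map fun B => (B.map H).prod * e (steps B)).prod =
            (w.map H).prod * ∑ p ∈ (splits i n).filter (fun p => p.2.flatten = w),
              e (steps (i :: p.1 ++ [i])) * (p.2.map fun B => e (steps B)).prod := by
          rw [Finset.mul_sum]
          refine Finset.sum_congr rfl fun p hp => ?_
          rw [prod_map_flatten, (Finset.mem_filter.1 hp).2]
          ring
        rw [h1, ← mul_sub, norm_mul]
        gcongr
        · have := norm_map_prod_le hH w
          rwa [hw.1] at this
        · exact norm_moment_sub_splits_le hC hN he i hw.1 hw.2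
    _ ≤ ∑ w ∈ words (Fin N) n,
        D ^ n * (K * (N : ℝ) ^ (-((insert i w.toFinset).card : ℤ))) := by
        apply Finset.sum_le_sum_of_subset_of_nonneg (Finset.filter_subset _ _)
        intros; positivity
    _ = D ^ n * (K * ∑ w ∈ words (Fin N) n, (N : ℝ) ^ (-((insert i w.toFinset).card : ℤ))) := by
        rw [Finset.mul_sum, Finset.mul_sum]
    _ ≤ D ^ n * (K * ((n + 1).factorial * (N : ℝ)⁻¹)) := by gcongr
    _ = _ := by ring

theorem walkSum_succ (e : Multiset (Fin N × Fin N) → ℂ) (H : Fin N → ℂ) (n : ℕ) (i : Fin N) :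
    walkSum e H (n + 1) i = ∑ t ∈ words (Fin N) n,
      (((i :: t).map H).prod) * e (steps (i :: t ++ [i])) := by
  rw [walkSum, Finset.sum_filter, sum_words_succ, Finset.sum_eq_single i]
  · simp
  · intro b _ hb
    simp [hb]
  · simp

theorem coeff_wordSeries_zero (e : Multiset (Fin N × Fin N) → ℂ) (H : Fin N → ℂ) (j : Fin N) :
    PowerSeries.coeff 0 (wordSeries e H j) = 0 := by
  rw [wordSeries, PowerSeries.coeff_mk, Finset.sum_eq_zero]
  intro B hB
  rw [Finset.mem_filter, mem_words, List.length_eq_zero_iff] at hB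
  exact absurd hB.1 hB.2.ne_nil

theorem coeff_wordSeries_one (e : Multiset (Fin N × Fin N) → ℂ) (H : Fin N → ℂ) (j : Fin N) :
    PowerSeries.coeff 1 (wordSeries e H j) = H j * e 0 := by
  have : (words (Fin N) 1).filter (IsClosedAt j) = {[j]} := by
    ext B
    rw [Finset.mem_filter, mem_words, List.length_eq_one_iff, Finset.mem_singleton]
    constructor
    · rintro ⟨⟨a, rfl⟩, h⟩
      simpa using h.1
    · rintro rfl
      exact ⟨⟨j, rfl⟩, rfl, rfl⟩
  rw [wordSeries, PowerSeries.coeff_mk, this]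
  simp

/-- A closed block of `n + 2` letters makes `n + 1` steps, and its repeated final letter carries an
extra `H j`. This is the shift by one between `a` and the diagonal moments. -/
theorem coeff_wordSeries_add_two (e : Multiset (Fin N × Fin N) → ℂ) (H : Fin N → ℂ) (n : ℕ)
    (j : Fin N) :
    PowerSeries.coeff (n + 2) (wordSeries e H j) = H j * walkSum e H (n + 1) j := by
  rw [wordSeries, PowerSeries.coeff_mk, walkSum_succ, Finset.mul_sum]
  symm
  refine Finset.sum_bij (fun t _ => j :: t ++ [j]) ?_ ?_ ?_ ?_
  · intro t ht
    rw [mem_words] at ht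
    rw [Finset.mem_filter, mem_words]
    exact ⟨by simp [ht], by simp, by rw [List.getLast?_append]; rfl⟩
  · intro t _ t' _ h
    simpa using h
  · intro B hB
    rw [Finset.mem_filter, mem_words] at hB
    obtain ⟨hlen, h1, h2⟩ := hB
    obtain ⟨s, rfl⟩ := List.getLast?_eq_some_iff.1 h2
    cases s with
    | nil => simp at hlen
    | cons a t =>
      simp only [List.cons_append, List.head?_cons, Option.some.injEq] at h1
      subst h1
      exact ⟨t, by rw [mem_words]; simpa using hlen, rfl⟩
  · intro t _
    rw [List.map_append, List.prod_append]
    simp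
    ring

end Recursion

/-! ### Matrix powers as sums over walks -/

section MatrixEntries

variable {N : ℕ}

/-- The product of the matrix entries at the positions in `S`. -/
def entriesProd (A : Matrix (Fin N) (Fin N) ℂ) (S : Multiset (Fin N × Fin N)) : ℂ :=
  (S.map fun p => A p.1 p.2).prod

@[simp] theorem entriesProd_zero (A : Matrix (Fin N) (Fin N) ℂ) : entriesProd A 0 = 1 := by
  simp [entriesProd]

@[simp] theorem entriesProd_cons (A : Matrix (Fin N) (Fin N) ℂ) (p : Fin N × Fin N)
    (S : Multiset (Fin N × Fin N)) : entriesProd A (p ::ₘ S) = A p.1 p.2 * entriesProd A S := by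
  simp [entriesProd]

@[simp] theorem entriesProd_singleton (A : Matrix (Fin N) (Fin N) ℂ) (p : Fin N × Fin N) :
    entriesProd A {p} = A p.1 p.2 := by
  simp [entriesProd]

theorem entriesProd_add (A : Matrix (Fin N) (Fin N) ℂ) (S T : Multiset (Fin N × Fin N)) :
    entriesProd A (S + T) = entriesProd A S * entriesProd A T := by
  simp [entriesProd]

theorem MatLoop.value_eq (ℓ : MatLoop N) (A : Matrix (Fin N) (Fin N) ℂ) :
    ℓ.value A = entriesProd A ℓ.edges := by
  rw [MatLoop.value, entriesProd, MatLoop.edges, Multiset.map_map]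
  rfl

theorem loopsValue_eq (L : List (MatLoop N)) (A : Matrix (Fin N) (Fin N) ℂ) :
    loopsValue L A = entriesProd A (loopsEdges L) := by
  induction L with
  | nil => simp [loopsValue]
  | cons ℓ L ih =>
    rw [loopsEdges_cons, entriesProd_add, ← ih, ← MatLoop.value_eq]
    simp [loopsValue]

theorem pow_succ_apply_eq_sum_words (A : Matrix (Fin N) (Fin N) ℂ) (n : ℕ) (i j : Fin N) :
    (A ^ (n + 1)) i j = ∑ t ∈ words (Fin N) n, entriesProd A (steps (i :: t ++ [j])) := by
  induction n generalizing i with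
  | zero => simp [words]
  | succ n ih =>
    rw [pow_succ', Matrix.mul_apply, sum_words_succ]
    refine Finset.sum_congr rfl fun a _ => ?_
    rw [ih, Finset.mul_sum]
    refine Finset.sum_congr rfl fun t _ => ?_
    simp

theorem entriesProd_dressed_steps (h : ℝ → ℝ) (A : Matrix (Fin N) (Fin N) ℂ) (i j : Fin N)
    (t : List (Fin N)) :
    entriesProd (dressed h A) (steps (i :: t ++ [j])) =
      ((i :: t).map fun i => (Real.sqrt (h (sitePos i)) : ℂ)).prod *
        ((t ++ [j]).map fun i => (Real.sqrt (h (sitePos i)) : ℂ)).prod *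
        entriesProd A (steps (i :: t ++ [j])) := by
  have hent : ∀ a b, dressed h A a b =
      (Real.sqrt (h (sitePos a)) : ℂ) * A a b * (Real.sqrt (h (sitePos b)) : ℂ) := by
    intro a b
    rw [dressed, Matrix.mul_diagonal, Matrix.diagonal_mul]
  induction t generalizing i with
  | nil => simp [hent]; ring
  | cons a t ih =>
    have := ih a
    simp only [List.cons_append, steps_cons_cons, entriesProd_cons, List.map_cons,
      List.prod_cons, hent] at this ⊢
    rw [this]
    ring

/-- Along a closed walk every site contributes one square root on arrival and one on departure. -/
theorem entriesProd_dressed_closed {h : ℝ → ℝ} (hpos : ∀ i : Fin N, 0 ≤ h (sitePos i))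
    (A : Matrix (Fin N) (Fin N) ℂ) (i : Fin N) (t : List (Fin N)) :
    entriesProd (dressed h A) (steps (i :: t ++ [i])) =
      ((i :: t).map fun i => (h (sitePos i) : ℂ)).prod * entriesProd A (steps (i :: t ++ [i])) := by
  rw [entriesProd_dressed_steps, List.map_append, List.prod_append]
  congr 1
  have hsq : ∀ i : Fin N, (Real.sqrt (h (sitePos i)) : ℂ) * (Real.sqrt (h (sitePos i)) : ℂ) =
      (h (sitePos i) : ℂ) := by
    intro i
    rw [← Complex.ofReal_mul, Real.mul_self_sqrt (hpos i)]
  have hlist : ∀ t : List (Fin N), (t.map fun i => (Real.sqrt (h (sitePos i)) : ℂ)).prod *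
      (t.map fun i => (Real.sqrt (h (sitePos i)) : ℂ)).prod =
      (t.map fun i => (h (sitePos i) : ℂ)).prod := by
    intro t
    induction t with
    | nil => simp
    | cons a t ih =>
      simp only [List.map_cons, List.prod_cons]
      rw [← ih, ← hsq]; ring
  simp only [List.map_cons, List.prod_cons, List.map_nil, List.prod_nil, mul_one]
  rw [← hlist, ← hsq]
  ring

end MatrixEntries

/-! ### Moments of the entries of the ensemble -/

section Ensemble

/-- The expectation of the product of the matrix entries at the positions in `S`. -/
noncomputable def entriesMoment {N : ℕ} {Ω : Type*} [MeasurableSpace Ω] (μ : Measure Ω)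
    (M : Ω → Matrix (Fin N) (Fin N) ℂ) (S : Multiset (Fin N × Fin N)) : ℂ :=
  ∫ ω, entriesProd (M ω) S ∂μ

theorem memLp_entriesProd {N : ℕ} {Ω : Type*} [MeasurableSpace Ω] {μ : Measure Ω}
    [IsProbabilityMeasure μ] {M : Ω → Matrix (Fin N) (Fin N) ℂ}
    (hM : ∀ (i j : Fin N) (p : ℕ), MemLp (fun ω => M ω i j) (p : ℝ≥0∞) μ)
    (S : Multiset (Fin N × Fin N)) (p : ℕ) :
    MemLp (fun ω => entriesProd (M ω) S) (p : ℝ≥0∞) μ := by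
  induction S using Multiset.induction_on generalizing p with
  | empty => simpa using memLp_const (1 : ℂ)
  | cons a S ih =>
    simp only [entriesProd_cons]
    -- By Hölder, two factors in `L^(2p)` have their product in `L^p`; this is why the induction
    -- runs over all exponents at once.
    have : ENNReal.HolderTriple ((2 * p : ℕ) : ℝ≥0∞) ((2 * p : ℕ) : ℝ≥0∞) (p : ℝ≥0∞) := by
      constructor
      push_cast
      rcases Nat.eq_zero_or_pos p with rfl | hp
      · simp
      · rw [ENNReal.mul_inv (by simp) (by simp), ← add_mul, ENNReal.inv_two_add_inv_two, one_mul]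
    exact (ih (2 * p)).mul (hM a.1 a.2 (2 * p))

theorem integrable_entriesProd {N : ℕ} {Ω : Type*} [MeasurableSpace Ω] {μ : Measure Ω}
    [IsProbabilityMeasure μ] {M : Ω → Matrix (Fin N) (Fin N) ℂ}
    (hM : ∀ (i j : Fin N) (p : ℕ), MemLp (fun ω => M ω i j) (p : ℝ≥0∞) μ)
    (S : Multiset (Fin N × Fin N)) : Integrable (fun ω => entriesProd (M ω) S) μ := by
  rw [← memLp_one_iff_integrable]
  simpa using memLp_entriesProd hM S 1

/-- The expectation of a diagonal entry of `(M_h)^n`. -/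
noncomputable def diagMoment {N : ℕ} {Ω : Type*} [MeasurableSpace Ω] (μ : Measure Ω)
    (M : Ω → Matrix (Fin N) (Fin N) ℂ) (h : ℝ → ℝ) (n : ℕ) (i : Fin N) : ℂ :=
  ∫ ω, (dressed h (M ω) ^ n) i i ∂μ

/-! ### Identities at fixed `N` -/

section Fixed

variable {N : ℕ} {Ω : Type*} [MeasurableSpace Ω] {μ : Measure Ω}
    [IsProbabilityMeasure μ] {M : Ω → Matrix (Fin N) (Fin N) ℂ} {h : ℝ → ℝ}

theorem diagMoment_zero (i : Fin N) : diagMoment μ M h 0 i = 1 := by simp [diagMoment]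

theorem entriesMoment_zero : entriesMoment μ M 0 = 1 := by simp [entriesMoment]

theorem integrable_dressed_pow_diag
    (hM : ∀ (i j : Fin N) (p : ℕ), MemLp (fun ω => M ω i j) (p : ℝ≥0∞) μ)
    (hpos : ∀ i : Fin N, 0 ≤ h (sitePos i)) (n : ℕ) (i : Fin N) :
    Integrable (fun ω => (dressed h (M ω) ^ n) i i) μ := by
  cases n with
  | zero => simp
  | succ n =>
    simp only [pow_succ_apply_eq_sum_words, entriesProd_dressed_closed hpos]
    exact integrable_finsetSum _ fun t _ => (integrable_entriesProd hM _).const_mul _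

theorem diagMoment_succ
    (hM : ∀ (i j : Fin N) (p : ℕ), MemLp (fun ω => M ω i j) (p : ℝ≥0∞) μ)
    (hpos : ∀ i : Fin N, 0 ≤ h (sitePos i)) (n : ℕ) (i : Fin N) :
    diagMoment μ M h (n + 1) i =
      walkSum (entriesMoment μ M) (fun i => (h (sitePos i) : ℂ)) (n + 1) i := by
  rw [diagMoment, walkSum_succ]
  simp only [pow_succ_apply_eq_sum_words, entriesProd_dressed_closed hpos]
  rw [integral_finsetSum _ fun t _ => (integrable_entriesProd hM _).const_mul _]
  refine Finset.sum_congr rfl fun t _ => ?_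
  rw [integral_const_mul, entriesMoment]

theorem wordSeries_eq
    (hM : ∀ (i j : Fin N) (p : ℕ), MemLp (fun ω => M ω i j) (p : ℝ≥0∞) μ)
    (hpos : ∀ i : Fin N, 0 ≤ h (sitePos i)) (j : Fin N) (n : ℕ) :
    PowerSeries.coeff (n + 1)
      (wordSeries (entriesMoment μ M) (fun i => (h (sitePos i) : ℂ)) j) =
      h (sitePos j) * diagMoment μ M h n j := by
  cases n with
  | zero => rw [zero_add, coeff_wordSeries_one, entriesMoment_zero, diagMoment_zero]
  | succ n => rw [coeff_wordSeries_add_two, diagMoment_succ hM hpos]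

theorem traceMoment_eq
    (hM : ∀ (i j : Fin N) (p : ℕ), MemLp (fun ω => M ω i j) (p : ℝ≥0∞) μ)
    (hpos : ∀ i : Fin N, 0 ≤ h (sitePos i)) (n : ℕ) :
    traceMoment μ M h n = (∑ i, diagMoment μ M h n i) / N := by
  rw [traceMoment, integral_div]
  congr 1
  simp only [Matrix.trace, Matrix.diag_apply, diagMoment]
  rw [integral_finsetSum _ fun i _ => integrable_dressed_pow_diag hM hpos n i]

/-- A proper nonempty part of a loop has an open end, a site that occurs in it once as a column
index and never as a row index. Rotating this site by the angle `π` flips the sign of the product,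
so its expectation equals its own negative. -/
theorem integral_partial_loop_eq_zero {μ : Measure Ω}
    (hU : ∀ θ : Fin N → ℝ, IdentDistrib (fun ω (i j : Fin N) => M ω i j)
      (fun ω (i j : Fin N) =>
        Complex.exp (-(Complex.I * θ i)) * M ω i j * Complex.exp (Complex.I * θ j)) μ μ)
    {n : ℕ} {i : Fin n → Fin N} (hi : Function.Injective i) {B : Finset (Fin n)}
    (hB : B.Nonempty) (hB' : B ≠ Finset.univ) :
    ∫ ω, ∏ k ∈ B, M ω (i k) (i (finRotate n k)) ∂μ = 0 := by
  obtain ⟨k₀, hk₀, hk₁⟩ := exists_finRotate_exit (Q := fun k => k ∈ B) hB (by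
    by_contra! hc
    exact hB' (Finset.eq_univ_iff_forall.2 hc))
  set θ : Fin N → ℝ := fun v => if v = i (finRotate n k₀) then Real.pi else 0 with hθ
  have hu : Measurable (fun A : Fin N → Fin N → ℂ => ∏ k ∈ B, A (i k) (i (finRotate n k))) := by
    fun_prop
  have h1 := ((hU θ).comp hu).integral_eq
  simp only [Function.comp_def] at h1
  have h2 : ∀ ω, ∏ k ∈ B, (Complex.exp (-(Complex.I * θ (i k))) * M ω (i k) (i (finRotate n k)) *
      Complex.exp (Complex.I * θ (i (finRotate n k)))) =
      -∏ k ∈ B, M ω (i k) (i (finRotate n k)) := by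
    intro ω
    have h3 : ∀ k ∈ B, Complex.exp (-(Complex.I * θ (i k))) * M ω (i k) (i (finRotate n k)) *
        Complex.exp (Complex.I * θ (i (finRotate n k))) =
        (if k = k₀ then -1 else 1) * M ω (i k) (i (finRotate n k)) := by
      intro k hk
      have hne : i k ≠ i (finRotate n k₀) := fun h => hk₁ (hi h ▸ hk)
      have e1 : θ (i k) = 0 := if_neg hne
      rw [e1]
      by_cases hkk : k = k₀
      · subst hkk
        have e2 : θ (i (finRotate n k)) = Real.pi := if_pos rfl
        rw [e2, mul_comm Complex.I (Real.pi : ℂ), Complex.exp_pi_mul_I]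
        simp
      · have e2 : θ (i (finRotate n k)) = 0 :=
          if_neg fun h => hkk ((finRotate n).injective (hi h))
        rw [e2, if_neg hkk]
        simp
    rw [Finset.prod_congr rfl h3, Finset.prod_mul_distrib, Finset.prod_ite_eq' B k₀, if_pos hk₀]
    ring
  simp only [h2, integral_neg] at h1
  exact self_eq_neg.1 h1

/-- Every partition with more than one block contains a proper part of the loop, with zero
expectation; only the one-block term, with coefficient one, survives. -/
theorem jointCumulant_loop {μ : Measure Ω}
    (hU : ∀ θ : Fin N → ℝ, IdentDistrib (fun ω (i j : Fin N) => M ω i j)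
      (fun ω (i j : Fin N) =>
        Complex.exp (-(Complex.I * θ i)) * M ω i j * Complex.exp (Complex.I * θ j)) μ μ)
    {n : ℕ} {i : Fin (n + 1) → Fin N} (hi : Function.Injective i) :
    jointCumulant μ (fun k ω => M ω (i k) (i (finRotate (n + 1) k))) =
      entriesMoment μ M (loopOfFn i hi).edges := by
  have hne : (Finset.univ : Finset (Fin (n + 1))) ≠ ⊥ := Finset.univ_nonempty.ne_empty
  rw [jointCumulant, Finset.sum_eq_single (Finpartition.indiscrete hne)]
  · simp only [Finpartition.indiscrete_parts, Finset.card_singleton, Finset.prod_singleton]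
    simp only [entriesMoment, ← MatLoop.value_eq]
    simp [MatLoop.value, loopOfFn, -finRotate_apply]
    rfl
  · intro π _ hπ
    have : ∃ B ∈ π.parts, B ≠ Finset.univ := by
      by_contra! hc
      apply hπ
      ext B
      rw [Finpartition.indiscrete_parts, Finset.mem_singleton]
      refine ⟨hc B, ?_⟩
      rintro rfl
      obtain ⟨B, hB⟩ := π.parts_nonempty hne
      obtain rfl := hc B hB
      exact hB
    obtain ⟨B, hB, hBne⟩ := this
    rw [Finset.prod_eq_zero hB, mul_zero]
    exact integral_partial_loop_eq_zero hU hi (π.nonempty_of_mem_parts hB) hBne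
  · simp

end Fixed

variable {Ω : ℕ → Type*} [∀ N, MeasurableSpace (Ω N)] {μ : ∀ N, Measure (Ω N)}
  {M : ∀ N, Ω N → Matrix (Fin N) (Fin N) ℂ}

/-- The assumptions provide one constant for each number of entries; the finitely many constants up
to `n` are dominated together. -/
theorem IsLoopEnsemble.exists_momentBound (hM : IsLoopEnsemble μ M) (n : ℕ) :
    ∃ C : ℝ, 1 ≤ C ∧ ∀ᶠ N in atTop, MomentBound N n C (entriesMoment (μ N) (M N)) := by
  choose C₁ h₁ using hM.scaling
  choose C₂ h₂ using hM.factorization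
  choose C₃ h₃ using hM.coincidences
  set C : ℝ := 1 + ∑ k ∈ Finset.range (n + 1), (|C₁ k| + |C₂ k| + |C₃ k|) with hC
  have hterm : ∀ k ≤ n, |C₁ k| + |C₂ k| + |C₃ k| ≤ C := by
    intro k hk
    have := Finset.single_le_sum (f := fun k => |C₁ k| + |C₂ k| + |C₃ k|)
      (fun i _ => by positivity) (Finset.mem_range.2 (Nat.lt_succ_of_le hk))
    linarith
  have hC1 : ∀ k ≤ n, C₁ k ≤ C := fun k hk => by
    linarith [hterm k hk, le_abs_self (C₁ k), abs_nonneg (C₂ k), abs_nonneg (C₃ k)]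
  have hC2 : ∀ k ≤ n, C₂ k ≤ C := fun k hk => by
    linarith [hterm k hk, abs_nonneg (C₁ k), le_abs_self (C₂ k), abs_nonneg (C₃ k)]
  have hC3 : ∀ k ≤ n, C₃ k ≤ C := fun k hk => by
    linarith [hterm k hk, abs_nonneg (C₁ k), abs_nonneg (C₂ k), le_abs_self (C₃ k)]
  refine ⟨C, ?_, ?_⟩
  · have : 0 ≤ ∑ k ∈ Finset.range (n + 1), (|C₁ k| + |C₂ k| + |C₃ k|) :=
      Finset.sum_nonneg fun _ _ => by positivity
    linarith
  · have hall : ∀ᶠ N in atTop, ∀ k ∈ Finset.range (n + 1),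
        (∀ ℓ : MatLoop N, ℓ.len = k →
          ‖∫ ω, ℓ.value (M N ω) ∂(μ N)‖ ≤ C₁ k * (N : ℝ) ^ (1 - (k : ℤ))) ∧
        (∀ L : List (MatLoop N), loopsLen L = k → LoopsPinched L →
          ‖(∫ ω, loopsValue L (M N ω) ∂(μ N)) -
            (L.map fun ℓ => ∫ ω, ℓ.value (M N ω) ∂(μ N)).prod‖
            ≤ C₂ k * (N : ℝ) ^ ((L.length : ℤ) - k - 1)) ∧
        (∀ L : List (MatLoop N), loopsLen L = k → LoopsFinest L →
          ‖∫ ω, loopsValue L (M N ω) ∂(μ N)‖ ≤ C₃ k * (N : ℝ) ^ ((L.length : ℤ) - k)) := by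
      rw [Filter.eventually_all_finset]
      intro k _
      exact (h₁ k).and ((h₂ k).and (h₃ k))
    filter_upwards [hall] with N hN
    have hmem : ∀ k ≤ n, k ∈ Finset.range (n + 1) := fun k hk =>
      Finset.mem_range.2 (Nat.lt_succ_of_le hk)
    simp only [MatLoop.value_eq, loopsValue_eq] at hN
    constructor
    · intro ℓ hℓ
      refine ((hN _ (hmem _ hℓ)).1 ℓ rfl).trans ?_
      gcongr
      exact hC1 _ hℓ
    · intro L hL hp
      refine ((hN _ (hmem _ hL)).2.1 L rfl hp).trans ?_
      gcongr
      exact hC2 _ hL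
    · intro L hL hp
      refine ((hN _ (hmem _ hL)).2.2 L rfl hp).trans ?_
      gcongr
      exact hC3 _ hL

end Ensemble

/-! ### From sums over sites to integrals over the unit cube -/

section Sites

/-- Lebesgue measure on `[0, 1]`. -/
noncomputable abbrev unitMeasure : Measure ℝ := volume.restrict (Set.Icc (0 : ℝ) 1)

instance : IsProbabilityMeasure unitMeasure := ⟨by simp [unitMeasure]⟩

/-- Lebesgue measure on the unit cube. -/
noncomputable abbrev cubeMeasure (m : ℕ) : Measure (Fin m → ℝ) := Measure.pi fun _ => unitMeasure

theorem cubeMeasure_eq (m : ℕ) :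
    cubeMeasure m = volume.restrict (Set.Icc (0 : Fin m → ℝ) 1) := by
  rw [cubeMeasure, ← Measure.restrict_pi_pi, ← Set.pi_univ_Icc]
  rfl

theorem ae_mem_unit : ∀ᵐ x ∂unitMeasure, x ∈ Set.Icc (0 : ℝ) 1 :=
  ae_restrict_mem measurableSet_Icc

theorem ae_cube_of_ae {m : ℕ} {P : ℝ → Prop} (h : ∀ᵐ x ∂unitMeasure, P x) :
    ∀ᵐ y ∂cubeMeasure m, ∀ k, P (y k) := by
  rw [ae_all_iff]
  intro k
  exact Measure.tendsto_eval_ae_ae.eventually h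

/-- The diagonals are proper linear subspaces, hence null sets; off them the kernels `g` are
controlled by the ensemble. -/
theorem ae_injective_cube (m : ℕ) : ∀ᵐ y ∂cubeMeasure m, Function.Injective y := by
  rw [cubeMeasure_eq]
  apply ae_restrict_of_ae
  have : ∀ k l : Fin m, k ≠ l → ∀ᵐ y : Fin m → ℝ, y k ≠ y l := by
    intro k l hkl
    set S : Submodule ℝ (Fin m → ℝ) :=
      LinearMap.ker (LinearMap.proj (R := ℝ) (φ := fun _ : Fin m => ℝ) k - LinearMap.proj l) with hS
    have hne : S ≠ ⊤ := by
      intro htop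
      have : (Pi.single k 1 : Fin m → ℝ) ∈ S := by rw [htop]; trivial
      simp [hS, hkl.symm] at this
    have h0 := Measure.addHaar_submodule (volume : Measure (Fin m → ℝ)) S hne
    rw [ae_iff]
    convert h0 using 2
    ext y
    simp [hS, sub_eq_zero]
  have h2 : ∀ᵐ y : Fin m → ℝ, ∀ k l : Fin m, k ≠ l → y k ≠ y l := by
    rw [ae_all_iff]; intro k
    rw [ae_all_iff]; intro l
    by_cases hkl : k = l
    · simp [hkl]
    · filter_upwards [this k l hkl] with y hy _ using hy
  filter_upwards [h2] with y hy k l hkl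
  by_contra hne
  exact hy k l hne hkl

theorem ae_cons_injective {m : ℕ} (x : ℝ) :
    ∀ᵐ y ∂cubeMeasure m, Function.Injective (Fin.cons x y : Fin (m + 1) → ℝ) := by
  have h1 : ∀ᵐ t ∂unitMeasure, t ≠ x := ae_restrict_of_ae (Measure.ae_ne volume x)
  filter_upwards [ae_injective_cube m, ae_cube_of_ae h1] with y hy hy'
  rw [Fin.cons_injective_iff]
  refine ⟨?_, hy⟩
  rintro ⟨k, hk⟩
  exact hy' k hk

/-- The site among `N + 1` sites whose lattice cell contains `x`. -/
noncomputable def siteAt (N : ℕ) (x : ℝ) : Fin (N + 1) :=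
  ⟨min ⌊((N + 1 : ℕ) : ℝ) * x⌋₊ N, Nat.lt_succ_of_le (min_le_right _ _)⟩

theorem measurable_siteAt (N : ℕ) : Measurable (siteAt N) := by
  have h : Measurable fun k : ℕ => (⟨min k N, Nat.lt_succ_of_le (min_le_right _ _)⟩ : Fin (N + 1)) :=
    measurable_from_nat
  exact h.comp (Nat.measurable_floor.comp (measurable_const_mul _))

/-- The position of a site is the right end of its cell, so the distance is at most one lattice
spacing, the tolerance in `IsLocalFreeCumulants`. The point `x = 1` falls to the last site, at
distance zero. -/
theorem abs_sitePos_siteAt_sub_le {N : ℕ} {x : ℝ} (hx : x ∈ Set.Icc (0 : ℝ) 1) :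
    |sitePos (siteAt N x) - x| ≤ 1 / ((N + 1 : ℕ) : ℝ) := by
  have hN : (0 : ℝ) < ((N + 1 : ℕ) : ℝ) := by positivity
  have hx0 : 0 ≤ ((N + 1 : ℕ) : ℝ) * x := mul_nonneg hN.le hx.1
  have h1 := Nat.floor_le hx0
  have h2 := Nat.lt_floor_add_one (((N + 1 : ℕ) : ℝ) * x)
  have h3 : ((N + 1 : ℕ) : ℝ) * x ≤ N + 1 := by
    have := mul_le_mul_of_nonneg_left hx.2 hN.le
    push_cast at this ⊢; linarith
  have hval : |(((siteAt N x : ℕ) : ℝ) + 1) - ((N + 1 : ℕ) : ℝ) * x| ≤ 1 := by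
    rcases le_total ⌊((N + 1 : ℕ) : ℝ) * x⌋₊ N with h | h
    · have : (siteAt N x : ℕ) = ⌊((N + 1 : ℕ) : ℝ) * x⌋₊ := min_eq_left h
      rw [this, abs_le]; constructor <;> linarith
    · have : (siteAt N x : ℕ) = N := min_eq_right h
      have h' : (N : ℝ) ≤ ⌊((N + 1 : ℕ) : ℝ) * x⌋₊ := by exact_mod_cast h
      rw [this, abs_le]; constructor <;> linarith
  rw [sitePos]
  have : (((siteAt N x : ℕ) : ℝ) + 1) / ((N + 1 : ℕ) : ℝ) - x =
      ((((siteAt N x : ℕ) : ℝ) + 1) - ((N + 1 : ℕ) : ℝ) * x) / ((N + 1 : ℕ) : ℝ) := by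
    field_simp
  rw [this, abs_div, abs_of_pos hN]
  gcongr

theorem sitePos_mem {N : ℕ} (i : Fin N) : sitePos i ∈ Set.Icc (0 : ℝ) 1 := by
  have hN : (0 : ℝ) < N := by exact_mod_cast i.pos
  have : ((i : ℕ) : ℝ) + 1 ≤ N := by exact_mod_cast i.isLt
  rw [sitePos]
  exact ⟨by positivity, (div_le_one hN).2 this⟩

theorem tendsto_sitePos_siteAt {x : ℝ} (hx : x ∈ Set.Icc (0 : ℝ) 1) :
    Tendsto (fun N => sitePos (siteAt N x)) atTop (𝓝 x) := by
  rw [tendsto_iff_dist_tendsto_zero]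
  refine squeeze_zero (fun _ => dist_nonneg) (fun N => ?_)
    ((tendsto_add_atTop_iff_nat 1).2 tendsto_one_div_atTop_nhds_zero_nat)
  rw [Real.dist_eq]
  exact abs_sitePos_siteAt_sub_le hx

theorem map_siteAt_singleton (N : ℕ) (i : Fin (N + 1)) :
    (unitMeasure.map (siteAt N)) {i} = ENNReal.ofReal (1 / ((N + 1 : ℕ) : ℝ)) := by
  have hN : (0 : ℝ) < ((N + 1 : ℕ) : ℝ) := by positivity
  have hi : ((i : ℕ) : ℝ) + 1 ≤ ((N + 1 : ℕ) : ℝ) := by exact_mod_cast i.isLt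
  -- Without the null endpoint `1` the truncation in `siteAt` is inactive and the preimage is
  -- exactly a half-open cell.
  rw [Measure.map_apply (measurable_siteAt N) (MeasurableSet.singleton i), unitMeasure,
    ← restrict_Ico_eq_restrict_Icc, Measure.restrict_apply (measurable_siteAt N (.singleton i))]
  have : siteAt N ⁻¹' {i} ∩ Set.Ico 0 1 =
      Set.Ico (((i : ℕ) : ℝ) / ((N + 1 : ℕ) : ℝ)) ((((i : ℕ) : ℝ) + 1) / ((N + 1 : ℕ) : ℝ)) := by
    ext x
    simp only [Set.mem_inter_iff, Set.mem_preimage, Set.mem_singleton_iff, Set.mem_Ico,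
      div_le_iff₀ hN, lt_div_iff₀ hN]
    constructor
    · rintro ⟨h, h0, h1⟩
      have hx0 : 0 ≤ ((N + 1 : ℕ) : ℝ) * x := mul_nonneg hN.le h0
      have h2 : ⌊((N + 1 : ℕ) : ℝ) * x⌋₊ ≤ N := by
        rw [← Nat.lt_succ_iff, Nat.floor_lt hx0]
        have := mul_lt_mul_of_pos_left h1 hN
        simpa using this
      have h3 : (i : ℕ) = ⌊((N + 1 : ℕ) : ℝ) * x⌋₊ := by
        rw [← h]; exact min_eq_left h2
      rw [h3, mul_comm x]
      exact ⟨Nat.floor_le hx0, Nat.lt_floor_add_one _⟩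
    · rintro ⟨h1, h2⟩
      have h0 : 0 ≤ x := by
        by_contra! hc
        have : x * ((N + 1 : ℕ) : ℝ) < 0 := mul_neg_of_neg_of_pos hc hN
        have : (0 : ℝ) ≤ (i : ℕ) := by positivity
        linarith
      refine ⟨?_, h0, ?_⟩
      · have h3 : ⌊((N + 1 : ℕ) : ℝ) * x⌋₊ = i := by
          rw [Nat.floor_eq_iff (by positivity), mul_comm]
          exact ⟨h1, h2⟩
        apply Fin.ext
        rw [siteAt]
        simp only [h3]
        exact min_eq_left (Nat.lt_succ_iff.1 i.isLt)
      · by_contra! hc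
        have : ((N + 1 : ℕ) : ℝ) ≤ x * ((N + 1 : ℕ) : ℝ) := le_mul_of_one_le_left hN.le hc
        linarith
  rw [this, Real.volume_Ico]
  congr 1
  ring

/-- Averages over sites are exactly integrals of step functions, since the cells have equal measure.
The limit of the sums becomes a matter of dominated convergence. -/
theorem integral_cube_siteAt {m N : ℕ} (F : (Fin m → Fin (N + 1)) → ℂ) :
    ∫ y, F (fun k => siteAt N (y k)) ∂cubeMeasure m =
      (((N + 1 : ℕ) : ℂ) ^ m)⁻¹ * ∑ j, F j := by
  have hprob : IsProbabilityMeasure (unitMeasure.map (siteAt N)) :=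
    Measure.isProbabilityMeasure_map (measurable_siteAt N).aemeasurable
  have h1 := Measure.pi_map_pi (μ := fun _ : Fin m => unitMeasure) (f := fun _ => siteAt N)
    (fun _ => (measurable_siteAt N).aemeasurable)
  have hmeas : Measurable fun (y : Fin m → ℝ) (k : Fin m) => siteAt N (y k) :=
    measurable_pi_lambda _ fun k => (measurable_siteAt N).comp (measurable_pi_apply k)
  rw [← integral_map (φ := fun (y : Fin m → ℝ) (k : Fin m) => siteAt N (y k)) hmeas.aemeasurable
    (AEStronglyMeasurable.of_discrete (f := F)), h1,
    integral_fintype (Integrable.of_finite), Finset.mul_sum]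
  refine Finset.sum_congr rfl fun j _ => ?_
  rw [Measure.real, Measure.pi_singleton]
  simp only [map_siteAt_singleton, Finset.prod_const, Finset.card_univ, Fintype.card_fin]
  rw [ENNReal.toReal_pow, ENNReal.toReal_ofReal (by positivity), Complex.real_smul]
  push_cast
  rw [one_div, inv_pow]

theorem integral_unit_siteAt {N : ℕ} (F : Fin (N + 1) → ℂ) :
    ∫ x, F (siteAt N x) ∂unitMeasure = (((N + 1 : ℕ) : ℂ))⁻¹ * ∑ j, F j := by
  have hprob : IsProbabilityMeasure (unitMeasure.map (siteAt N)) :=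
    Measure.isProbabilityMeasure_map (measurable_siteAt N).aemeasurable
  rw [← integral_map (φ := siteAt N) (measurable_siteAt N).aemeasurable
    (AEStronglyMeasurable.of_discrete (f := F)),
    integral_fintype (Integrable.of_finite), Finset.mul_sum]
  refine Finset.sum_congr rfl fun j _ => ?_
  rw [Measure.real, map_siteAt_singleton, ENNReal.toReal_ofReal (by positivity), Complex.real_smul]
  push_cast
  rw [one_div]

theorem measurable_comp_siteAt {m N : ℕ} {E : Type*} [MeasurableSpace E]
    (F : (Fin m → Fin (N + 1)) → E) :
    Measurable fun y : Fin m → ℝ => F (fun k => siteAt N (y k)) :=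
  (Measurable.of_discrete (f := F)).comp
    (measurable_pi_lambda _ fun k => (measurable_siteAt N).comp (measurable_pi_apply k))

theorem tendsto_coeff_prod {ι κ : Type*} [Fintype κ] {l : Filter ι} {n : ℕ} {A : ι → κ → ℂ⟦X⟧}
    {a : κ → ℂ⟦X⟧} (h : ∀ k, ∀ q ≤ n,
      Tendsto (fun t => PowerSeries.coeff q (A t k)) l (𝓝 (PowerSeries.coeff q (a k)))) :
    Tendsto (fun t => PowerSeries.coeff n (∏ k, A t k)) l
      (𝓝 (PowerSeries.coeff n (∏ k, a k))) := by
  classical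
  simp only [PowerSeries.coeff_prod]
  refine tendsto_finsetSum _ fun c hc => tendsto_finsetProd _ fun k _ => h k _ ?_
  rw [Finset.mem_finsuppAntidiag] at hc
  rw [← hc.1]
  exact Finset.single_le_sum (fun _ _ => Nat.zero_le _) (Finset.mem_univ k)

theorem exists_norm_coeff_prod_le (m n : ℕ) (K : ℝ) : ∃ K' : ℝ, ∀ f : Fin m → ℂ⟦X⟧,
    (∀ k, ∀ q ≤ n, ‖PowerSeries.coeff q (f k)‖ ≤ K) → ‖PowerSeries.coeff n (∏ k, f k)‖ ≤ K' := by
  classical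
  refine ⟨∑ c ∈ Finset.finsuppAntidiag (Finset.univ : Finset (Fin m)) n, ∏ _k : Fin m, K,
    fun f hf => ?_⟩
  rw [PowerSeries.coeff_prod]
  refine (norm_sum_le _ _).trans (Finset.sum_le_sum fun c hc => ?_)
  rw [norm_prod]
  refine Finset.prod_le_prod (fun _ _ => norm_nonneg _) fun k _ => hf k _ ?_
  rw [Finset.mem_finsuppAntidiag] at hc
  rw [← hc.1]
  exact Finset.single_le_sum (fun _ _ => Nat.zero_le _) (Finset.mem_univ k)

end Sites

/-! ### The large `N` limit of the moments -/

section Limit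

open Classical in
/-- The rescaled expectation `N^m E[M_{j₀j₁} ⋯ M_{j_mj₀}]` of a loop, and `0` if the indices are not
distinct. -/
noncomputable def loopDensity {N : ℕ} (e : Multiset (Fin N × Fin N) → ℂ) (m : ℕ)
    (j : Fin (m + 1) → Fin N) : ℂ :=
  (N : ℂ) ^ m * if hj : Function.Injective j then e (loopOfFn j hj).edges else 0

theorem MomentBound.norm_loopDensity_le {N n : ℕ} {C : ℝ} (hC : 0 ≤ C) (hN : 1 ≤ N)
    {e : Multiset (Fin N × Fin N) → ℂ} (he : MomentBound N n C e) {m : ℕ} (hm : m < n)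
    (j : Fin (m + 1) → Fin N) : ‖loopDensity e m j‖ ≤ C := by
  have hN0 : (0 : ℝ) < N := by exact_mod_cast hN
  rw [loopDensity]
  split_ifs with hj
  · have := he.loop (loopOfFn j hj) hm
    rw [norm_mul, norm_pow, Complex.norm_natCast]
    calc (N : ℝ) ^ m * ‖e (loopOfFn j hj).edges‖
        ≤ (N : ℝ) ^ m * (C * (N : ℝ) ^ (1 - ((m + 1 : ℕ) : ℤ))) := by gcongr; exact this
      _ = C * ((N : ℝ) ^ (m : ℤ) * (N : ℝ) ^ (1 - ((m + 1 : ℕ) : ℤ))) := by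
          rw [zpow_natCast]; ring
      _ = C := by
          rw [← zpow_add₀ hN0.ne']
          simp
  · simpa using hC

variable {Ω : ℕ → Type*} [∀ N, MeasurableSpace (Ω N)] {μ : ∀ N, Measure (Ω N)}
  {M : ∀ N, Ω N → Matrix (Fin N) (Fin N) ℂ}
  {g : (n : ℕ) → (Fin n → ℝ) → ℂ}

theorem eventually_siteAt_injective {m : ℕ} {y : Fin m → ℝ} (hy : ∀ k, y k ∈ Set.Icc (0 : ℝ) 1)
    (hinj : Function.Injective y) :
    ∀ᶠ N in atTop, Function.Injective fun k => siteAt N (y k) := by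
  have h : ∀ k l : Fin m, k ≠ l → ∀ᶠ N in atTop, siteAt N (y k) ≠ siteAt N (y l) := by
    intro k l hkl
    have := ((tendsto_sitePos_siteAt (hy k)).sub (tendsto_sitePos_siteAt (hy l))).eventually_ne
      (sub_ne_zero.2 (hinj.ne hkl))
    filter_upwards [this] with N hN heq
    exact hN (by rw [heq, sub_self])
  have h2 : ∀ᶠ N in atTop, ∀ k l : Fin m, k ≠ l → siteAt N (y k) ≠ siteAt N (y l) := by
    rw [eventually_all]; intro k
    rw [eventually_all]; intro l
    by_cases hkl : k = l
    · simp [hkl]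
    · filter_upwards [h k l hkl] with N hN _ using hN
  filter_upwards [h2] with N hN k l hkl
  by_contra hne
  exact hN k l hne hkl

theorem tendsto_loopDensity (hM : IsLoopEnsemble μ M) (hg : IsLocalFreeCumulants μ M g) {m : ℕ}
    {y : Fin (m + 1) → ℝ} (hy : ∀ k, y k ∈ Set.Icc (0 : ℝ) 1) (hinj : Function.Injective y) :
    Tendsto (fun N => loopDensity (entriesMoment (μ (N + 1)) (M (N + 1))) m
      fun k => siteAt N (y k)) atTop (𝓝 (g (m + 1) y)) := by
  rw [Metric.tendsto_nhds]
  intro ε hε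
  have h1 := hg (m + 1) (by omega) y hy hinj ε hε
  filter_upwards [(tendsto_add_atTop_nat 1).eventually h1, eventually_siteAt_injective hy hinj]
    with N hN hNinj
  have h2 := hN (fun k => siteAt N (y k)) hNinj fun k => abs_sitePos_siteAt_sub_le (hy k)
  rw [jointCumulant_loop (hM.u1_invariance (N + 1)) hNinj] at h2
  rw [dist_eq_norm, loopDensity, dif_pos hNinj]
  simpa using h2

theorem exists_norm_loopDensity_le (hM : IsLoopEnsemble μ M) (m : ℕ) :
    ∃ C : ℝ, ∀ᶠ N in atTop, ∀ j : Fin (m + 1) → Fin (N + 1),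
      ‖loopDensity (entriesMoment (μ (N + 1)) (M (N + 1))) m j‖ ≤ C := by
  obtain ⟨C, hC, h⟩ := hM.exists_momentBound (m + 1)
  refine ⟨C, ?_⟩
  filter_upwards [(tendsto_add_atTop_nat 1).eventually h] with N hN j
  exact hN.norm_loopDensity_le (by linarith) (by omega) (by omega) j

/-- Measurability and boundedness of `g` are not assumed. Both pass to the almost everywhere limit
of the rescaled loop expectations, which are uniformly bounded step functions. -/
theorem memLp_localFreeCumulants (hM : IsLoopEnsemble μ M) (hg : IsLocalFreeCumulants μ M g)
    (m : ℕ) : MemLp (g (m + 1)) ∞ (cubeMeasure (m + 1)) := by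
  have hlim : ∀ᵐ y ∂cubeMeasure (m + 1),
      Tendsto (fun N => loopDensity (entriesMoment (μ (N + 1)) (M (N + 1))) m
        fun k => siteAt N (y k)) atTop (𝓝 (g (m + 1) y)) := by
    filter_upwards [ae_injective_cube (m + 1), ae_cube_of_ae ae_mem_unit] with y h1 h2
    exact tendsto_loopDensity hM hg h2 h1
  obtain ⟨C, hC⟩ := exists_norm_loopDensity_le hM m
  refine memLp_top_of_bound (aestronglyMeasurable_of_tendsto_ae atTop (fun N =>
    (measurable_comp_siteAt (loopDensity (entriesMoment (μ (N + 1)) (M (N + 1))) m)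
      ).aestronglyMeasurable) hlim) C ?_
  filter_upwards [hlim] with y hy
  refine le_of_tendsto hy.norm ?_
  filter_upwards [hC] with N hN using hN _

/-- Starting a loop at another of its sites leaves its multiset of edges unchanged, so both kernels
are limits of the same expectations. -/
theorem localFreeCumulants_rotate (hM : IsLoopEnsemble μ M) (hg : IsLocalFreeCumulants μ M g)
    {m : ℕ} {y : Fin (m + 1) → ℝ} (hy : ∀ k, y k ∈ Set.Icc (0 : ℝ) 1)
    (hinj : Function.Injective y) (j : Fin (m + 1)) :
    g (m + 1) (fun k => y (k + j)) = g (m + 1) y := by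
  have hinj' : Function.Injective fun k => y (k + j) := fun k l h => by simpa using hinj h
  refine tendsto_nhds_unique (tendsto_loopDensity hM hg (fun k => hy _) hinj') ?_
  refine (tendsto_loopDensity hM hg hy hinj).congr' ?_
  filter_upwards [eventually_siteAt_injective hy hinj,
    eventually_siteAt_injective (fun k => hy _) hinj'] with N h1 h2
  rw [loopDensity, loopDensity, dif_pos h1, dif_pos h2]
  congr 2
  apply MatLoop.edges_eq_of_subset
  intro e he
  obtain ⟨k, rfl⟩ := MatLoop.mem_edges.1 he
  change Fin (m + 1) at k
  refine MatLoop.mem_edges.2 ⟨(k + j : Fin (m + 1)), ?_⟩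
  change (siteAt N (y (k + j)), siteAt N (y (finRotate (m + 1) (k + j)))) =
    (siteAt N (y (k + j)), siteAt N (y (finRotate (m + 1) k + j)))
  rw [finRotate_apply, finRotate_apply, add_right_comm]

/-! ### Convergence of the moments dressed by the profile `h` -/

section Profile

variable [∀ N, IsProbabilityMeasure (μ N)] {h : ℝ → ℝ}

theorem tendsto_profile_siteAt
    (h_cont : ∀ᵐ x ∂unitMeasure, ContinuousWithinAt h (Set.Icc (0 : ℝ) 1) x) :
    ∀ᵐ x ∂unitMeasure, Tendsto (fun N => h (sitePos (siteAt N x))) atTop (𝓝 (h x)) := by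
  filter_upwards [h_cont, ae_mem_unit] with x hx hx'
  refine hx.tendsto.comp (tendsto_nhdsWithin_iff.2 ⟨tendsto_sitePos_siteAt hx', ?_⟩)
  exact Eventually.of_forall fun N => sitePos_mem _

theorem memLp_profile {D : ℝ} (hD : ∀ x ∈ Set.Icc (0 : ℝ) 1, |h x| ≤ D)
    (h_cont : ∀ᵐ x ∂unitMeasure, ContinuousWithinAt h (Set.Icc (0 : ℝ) 1) x) :
    MemLp (fun x => (h x : ℂ)) ∞ unitMeasure := by
  have h1 : AEStronglyMeasurable h unitMeasure :=
    aestronglyMeasurable_of_tendsto_ae atTop (fun N =>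
      ((Measurable.of_discrete (f := fun i : Fin (N + 1) => h (sitePos i))).comp
        (measurable_siteAt N)).aestronglyMeasurable) (tendsto_profile_siteAt h_cont)
  refine memLp_top_of_bound (Complex.continuous_ofReal.comp_aestronglyMeasurable h1) D ?_
  filter_upwards [ae_mem_unit] with x hx
  simpa using hD x hx

/-- The factor `N^m` in `loopDensity` compensates the averaging over the `m` free sites, and
non-injective choices contribute zero on both sides. -/
theorem loopSum_eq_integral {N : ℕ} (e : Multiset (Fin (N + 1) × Fin (N + 1)) → ℂ)
    (A : Fin (N + 1) → ℂ⟦X⟧) (n : ℕ) (x : ℝ) :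
    loopSum e A n (siteAt N x) = ∑ m ∈ Finset.range n,
      ∫ y, loopDensity e m (fun k => siteAt N ((Fin.cons x y : Fin (m + 1) → ℝ) k)) *
        PowerSeries.coeff n (∏ k, A (siteAt N ((Fin.cons x y : Fin (m + 1) → ℝ) k)))
        ∂cubeMeasure m := by
  rw [loopSum]
  refine Finset.sum_congr rfl fun m _ => ?_
  have hcons : ∀ y : Fin m → ℝ, (fun k => siteAt N ((Fin.cons x y : Fin (m + 1) → ℝ) k)) =
      (Fin.cons (siteAt N x) fun k => siteAt N (y k) : Fin (m + 1) → Fin (N + 1)) := by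
    intro y
    funext k
    refine Fin.cases ?_ (fun k => ?_) k <;> simp
  have h1 := integral_cube_siteAt (N := N) (fun j : Fin m → Fin (N + 1) =>
    loopDensity e m (Fin.cons (siteAt N x) j : Fin (m + 1) → Fin (N + 1)) *
      PowerSeries.coeff n (∏ k, A ((Fin.cons (siteAt N x) j : Fin (m + 1) → Fin (N + 1)) k)))
  have hcons' : ∀ (y : Fin m → ℝ) k, siteAt N ((Fin.cons x y : Fin (m + 1) → ℝ) k) =
      (Fin.cons (siteAt N x) fun k => siteAt N (y k) : Fin (m + 1) → Fin (N + 1)) k :=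
    fun y k => congrFun (hcons y) k
  simp only [hcons']
  rw [h1, Finset.mul_sum]
  refine Finset.sum_congr rfl fun j _ => ?_
  have hN : (((N + 1 : ℕ) : ℂ)) ≠ 0 := by exact_mod_cast Nat.succ_ne_zero N
  rw [loopDensity]
  split_ifs with hj
  · field_simp
  · simp

theorem exists_norm_diagMoment_le (hM : IsLoopEnsemble μ M) {D : ℝ}
    (hpos : ∀ x ∈ Set.Icc (0 : ℝ) 1, 0 ≤ h x) (hD : ∀ x ∈ Set.Icc (0 : ℝ) 1, |h x| ≤ D) (n : ℕ) :
    ∃ K : ℝ, ∀ᶠ N in atTop, ∀ i, ‖diagMoment (μ (N + 1)) (M (N + 1)) h n i‖ ≤ K := by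
  have hD0 : 0 ≤ D := (abs_nonneg _).trans (hD 0 (by simp))
  cases n with
  | zero => exact ⟨1, Eventually.of_forall fun N i => by rw [diagMoment_zero]; simp⟩
  | succ n =>
    obtain ⟨C, hC, hb⟩ := hM.exists_momentBound (n + 1)
    refine ⟨D ^ (n + 1) * (C * (n + 1 + 1).factorial), ?_⟩
    filter_upwards [(tendsto_add_atTop_nat 1).eventually hb] with N hN i
    rw [diagMoment_succ (hM.moments (N + 1)) (fun i => hpos _ (sitePos_mem i))]
    refine norm_walkSum_le hC (by omega) hN hD0 (fun i => ?_) i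
    simpa using hD _ (sitePos_mem i)

theorem tendsto_diagMoment_sub_loopSum (hM : IsLoopEnsemble μ M) {D : ℝ}
    (hpos : ∀ x ∈ Set.Icc (0 : ℝ) 1, 0 ≤ h x) (hD : ∀ x ∈ Set.Icc (0 : ℝ) 1, |h x| ≤ D) (n : ℕ)
    (x : ℝ) :
    Tendsto (fun N => diagMoment (μ (N + 1)) (M (N + 1)) h (n + 1) (siteAt N x) -
      loopSum (entriesMoment (μ (N + 1)) (M (N + 1)))
        (wordSeries (entriesMoment (μ (N + 1)) (M (N + 1))) fun i => (h (sitePos i) : ℂ))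
        (n + 1) (siteAt N x)) atTop (𝓝 0) := by
  have hD0 : 0 ≤ D := (abs_nonneg _).trans (hD 0 (by simp))
  obtain ⟨C, hC, hb⟩ := hM.exists_momentBound (n + 1)
  have hlim : Tendsto (fun N : ℕ => D ^ (n + 1) * (C + 2 ^ (n + 1) * (C * C ^ (n + 1)) +
      C * (((n + 1 : ℕ) : ℝ) * (C ^ (n + 1 + 1)) ^ (n + 1))) * (n + 1 + 1).factorial *
      ((N + 1 : ℕ) : ℝ)⁻¹) atTop (𝓝 0) := by
    rw [← mul_zero (D ^ (n + 1) * (C + 2 ^ (n + 1) * (C * C ^ (n + 1)) +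
      C * (((n + 1 : ℕ) : ℝ) * (C ^ (n + 1 + 1)) ^ (n + 1))) * (n + 1 + 1).factorial)]
    exact ((tendsto_add_atTop_iff_nat 1).2 tendsto_inv_atTop_nhds_zero_nat).const_mul _
  refine squeeze_zero_norm' ?_ hlim
  filter_upwards [(tendsto_add_atTop_nat 1).eventually hb] with N hN
  rw [diagMoment_succ (hM.moments (N + 1)) (fun i => hpos _ (sitePos_mem i))]
  refine norm_walkSum_sub_loopSum_le hC (by omega) hN hD0 (fun i => ?_) _
  simpa using hD _ (sitePos_mem i)

/-- The limits of the diagonal moments solve the same recursion as the coefficients of an extremum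
of the action. -/
theorem tendsto_diagMoment (hM : IsLoopEnsemble μ M) (hg : IsLocalFreeCumulants μ M g) {D : ℝ}
    (hpos : ∀ x ∈ Set.Icc (0 : ℝ) 1, 0 ≤ h x) (hD : ∀ x ∈ Set.Icc (0 : ℝ) 1, |h x| ≤ D)
    (h_cont : ∀ᵐ x ∂unitMeasure, ContinuousWithinAt h (Set.Icc (0 : ℝ) 1) x)
    {a : ℝ → ℂ⟦X⟧} {d : ℕ → ℝ → ℂ}
    (ha₀ : ∀ᵐ x ∂unitMeasure, PowerSeries.coeff 0 (a x) = 0)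
    (ha : ∀ᵐ x ∂unitMeasure, ∀ n, PowerSeries.coeff (n + 1) (a x) = h x * d n x)
    (hd₀ : ∀ᵐ x ∂unitMeasure, d 0 x = 1)
    (hd : ∀ᵐ x ∂unitMeasure, ∀ n, d (n + 1) x = ∑ m ∈ Finset.range (n + 1),
      ∫ y, g (m + 1) (Fin.cons x y) *
        PowerSeries.coeff (n + 1) (∏ k, a ((Fin.cons x y : Fin (m + 1) → ℝ) k)) ∂cubeMeasure m)
    (n : ℕ) :
    ∀ᵐ x ∂unitMeasure, Tendsto
      (fun N => diagMoment (μ (N + 1)) (M (N + 1)) h n (siteAt N x)) atTop (𝓝 (d n x)) := by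
  induction n using Nat.strong_induction_on with
  | _ n ih =>
  cases n with
  | zero =>
    filter_upwards [hd₀] with x hx
    simp only [diagMoment_zero, hx]
    exact tendsto_const_nhds
  | succ n =>
    set A : ∀ N, Fin (N + 1) → ℂ⟦X⟧ := fun N =>
      wordSeries (entriesMoment (μ (N + 1)) (M (N + 1))) fun i => (h (sitePos i) : ℂ) with hA
    have hA0 : ∀ N j, PowerSeries.coeff 0 (A N j) = 0 := fun N j => coeff_wordSeries_zero _ _ _
    have hA1 : ∀ N j q, PowerSeries.coeff (q + 1) (A N j) =
        h (sitePos j) * diagMoment (μ (N + 1)) (M (N + 1)) h q j := fun N j q =>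
      wordSeries_eq (hM.moments (N + 1)) (fun i => hpos _ (sitePos_mem i)) j q
    -- Coefficient `q + 1` of the word series involves only the diagonal moment of order `q`. The
    -- recursion for order `n + 1` therefore uses only orders up to `n`, covered by the induction
    -- hypothesis.
    have hAlim : ∀ᵐ x ∂unitMeasure, ∀ q ≤ n + 1,
        Tendsto (fun N => PowerSeries.coeff q (A N (siteAt N x))) atTop
          (𝓝 (PowerSeries.coeff q (a x))) := by
      have hall : ∀ᵐ x ∂unitMeasure, ∀ q, q < n + 1 → Tendsto
          (fun N => diagMoment (μ (N + 1)) (M (N + 1)) h q (siteAt N x)) atTop (𝓝 (d q x)) := by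
        rw [ae_all_iff]; intro q
        by_cases hq : q < n + 1
        · filter_upwards [ih q hq] with x hx _ using hx
        · simp [hq]
      filter_upwards [hall, ha₀, ha, tendsto_profile_siteAt h_cont] with x h1 h2 h3 h4 q hq
      cases q with
      | zero => simp only [hA0, h2]; exact tendsto_const_nhds
      | succ q =>
        simp only [hA1, h3]
        exact ((Complex.continuous_ofReal.tendsto _).comp h4).mul (h1 q (by omega))
    obtain ⟨K, hK⟩ : ∃ K : ℝ, ∀ᶠ N in atTop, ∀ j, ∀ q ≤ n + 1,
        ‖PowerSeries.coeff q (A N j)‖ ≤ K := by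
      choose K hK using exists_norm_diagMoment_le hM hpos hD
      have hD0 : 0 ≤ D := (abs_nonneg _).trans (hD 0 (by simp))
      refine ⟨∑ q ∈ Finset.range (n + 1), D * |K q|, ?_⟩
      have hall : ∀ᶠ N in atTop, ∀ q ∈ Finset.range (n + 1), ∀ i,
          ‖diagMoment (μ (N + 1)) (M (N + 1)) h q i‖ ≤ K q := by
        rw [Filter.eventually_all_finset]
        exact fun q _ => hK q
      filter_upwards [hall] with N hN j q hq
      cases q with
      | zero =>
        rw [hA0, norm_zero]
        exact Finset.sum_nonneg fun _ _ => by positivity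
      | succ q =>
        have hq' : q ∈ Finset.range (n + 1) := Finset.mem_range.2 (by omega)
        refine le_trans ?_ (Finset.single_le_sum (f := fun q => D * |K q|)
          (fun _ _ => by positivity) hq')
        rw [hA1, norm_mul]
        gcongr
        · simpa using hD _ (sitePos_mem j)
        · exact (hN q hq' j).trans (le_abs_self _)
    filter_upwards [hd, hAlim, ae_mem_unit] with x hx hxA hxmem
    have h0 := tendsto_diagMoment_sub_loopSum hM hpos hD n x
    suffices hs : Tendsto (fun N => loopSum (entriesMoment (μ (N + 1)) (M (N + 1))) (A N)
        (n + 1) (siteAt N x)) atTop (𝓝 (d (n + 1) x)) by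
      have := h0.add hs
      simp only [hA, sub_add_cancel, zero_add] at this
      exact this
    rw [hx]
    simp only [loopSum_eq_integral]
    refine tendsto_finsetSum _ fun m _ => ?_
    obtain ⟨C, hC⟩ := exists_norm_loopDensity_le hM m
    obtain ⟨K', hK'⟩ := exists_norm_coeff_prod_le (m + 1) (n + 1) K
    -- The loop density is bounded by `C`, and a coefficient of a product is a polynomial in
    -- boundedly many coefficients of the factors, bounded by `K'` uniformly in `N`.
    refine tendsto_integral_filter_of_dominated_convergence (fun _ => C * K') ?_ ?_
      (integrable_const _) ?_
    · refine Eventually.of_forall fun N => Measurable.aestronglyMeasurable ?_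
      have := measurable_comp_siteAt (N := N) (fun j : Fin m → Fin (N + 1) =>
        loopDensity (entriesMoment (μ (N + 1)) (M (N + 1))) m
          (Fin.cons (siteAt N x) j : Fin (m + 1) → Fin (N + 1)) *
        PowerSeries.coeff (n + 1)
          (∏ k, A N ((Fin.cons (siteAt N x) j : Fin (m + 1) → Fin (N + 1)) k)))
      convert this using 4 with y
      · funext k
        refine Fin.cases ?_ (fun k => ?_) k <;> simp
      · refine Finset.prod_congr rfl fun k _ => ?_
        congr 1
        refine Fin.cases ?_ (fun k => ?_) k <;> simp
    · filter_upwards [hC, hK] with N hN hNK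
      refine Eventually.of_forall fun y => ?_
      rw [norm_mul]
      have h1 := hN fun k => siteAt N ((Fin.cons x y : Fin (m + 1) → ℝ) k)
      have h2 := hK' (fun k => A N (siteAt N ((Fin.cons x y : Fin (m + 1) → ℝ) k)))
        fun k q hq => hNK _ q hq
      exact mul_le_mul h1 h2 (norm_nonneg _) ((norm_nonneg _).trans h1)
    · filter_upwards [ae_cons_injective x, ae_cube_of_ae ae_mem_unit, ae_cube_of_ae hAlim]
        with y hinj hmem hyA
      refine (tendsto_loopDensity hM hg (Fin.cases ?_ fun k => ?_) hinj).mul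
        (tendsto_coeff_prod (Fin.cases ?_ fun k => ?_))
      · simpa using hxmem
      · simpa using hmem k
      · simpa using hxA
      · simpa using hyA k

theorem tendsto_traceMoment (hM : IsLoopEnsemble μ M) {D : ℝ}
    (hpos : ∀ x ∈ Set.Icc (0 : ℝ) 1, 0 ≤ h x) (hD : ∀ x ∈ Set.Icc (0 : ℝ) 1, |h x| ≤ D) {n : ℕ}
    {d : ℝ → ℂ} (hd : ∀ᵐ x ∂unitMeasure, Tendsto
      (fun N => diagMoment (μ (N + 1)) (M (N + 1)) h n (siteAt N x)) atTop (𝓝 (d x))) :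
    Tendsto (fun N => traceMoment (μ N) (M N) h n) atTop (𝓝 (∫ x, d x ∂unitMeasure)) := by
  rw [← tendsto_add_atTop_iff_nat 1]
  obtain ⟨K, hK⟩ := exists_norm_diagMoment_le hM hpos hD n
  have heq : ∀ N, traceMoment (μ (N + 1)) (M (N + 1)) h n =
      ∫ x, diagMoment (μ (N + 1)) (M (N + 1)) h n (siteAt N x) ∂unitMeasure := by
    intro N
    rw [traceMoment_eq (hM.moments (N + 1)) (fun i => hpos _ (sitePos_mem i)),
      integral_unit_siteAt (fun i => diagMoment (μ (N + 1)) (M (N + 1)) h n i), div_eq_inv_mul]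
  simp only [heq]
  refine tendsto_integral_filter_of_dominated_convergence (fun _ => K) ?_ ?_
    (integrable_const _) hd
  · exact Eventually.of_forall fun N => ((Measurable.of_discrete
      (f := fun i => diagMoment (μ (N + 1)) (M (N + 1)) h n i)).comp
        (measurable_siteAt N)).aestronglyMeasurable
  · filter_upwards [hK] with N hN
    exact Eventually.of_forall fun x => hN _

end Profile

end Limit

/-! ### Power series identities -/

section SeriesIdentities

theorem coeff_eq_zero_of_X_pow_dvd {f : ℂ⟦X⟧} {n k : ℕ} (h : PowerSeries.X ^ n ∣ f) (hk : k < n) :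
    PowerSeries.coeff k f = 0 := PowerSeries.X_pow_dvd_iff.1 h k hk

theorem one_sub_X_mul_ne_zero (u : ℂ⟦X⟧) : PowerSeries.constantCoeff (1 - PowerSeries.X * u) ≠ 0 := by
  simp

theorem one_sub_X_mul_mul_inv (u : ℂ⟦X⟧) :
    (1 - PowerSeries.X * u) * (1 - PowerSeries.X * u)⁻¹ = 1 :=
  PowerSeries.mul_inv_cancel _ (one_sub_X_mul_ne_zero u)

theorem coeff_mul_inv_one_sub (u w : ℂ⟦X⟧) (n : ℕ) {k : ℕ} (hk : k < n) :
    PowerSeries.coeff k (w * (1 - PowerSeries.X * u)⁻¹) =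
      ∑ m ∈ Finset.range n, PowerSeries.coeff k (w * (PowerSeries.X * u) ^ m) := by
  have h1 : (1 - PowerSeries.X * u) * ∑ m ∈ Finset.range n, (PowerSeries.X * u) ^ m =
      1 - (PowerSeries.X * u) ^ n := mul_neg_geom_sum _ _
  have h2 : w * ∑ m ∈ Finset.range n, (PowerSeries.X * u) ^ m =
      w * (1 - PowerSeries.X * u)⁻¹ -
        PowerSeries.X ^ n * (w * (1 - PowerSeries.X * u)⁻¹ * u ^ n) := by
    have h3 := one_sub_X_mul_mul_inv u
    calc w * ∑ m ∈ Finset.range n, (PowerSeries.X * u) ^ m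
        = w * ((1 - PowerSeries.X * u) * (1 - PowerSeries.X * u)⁻¹) *
            ∑ m ∈ Finset.range n, (PowerSeries.X * u) ^ m := by rw [h3, mul_one]
      _ = w * (1 - PowerSeries.X * u)⁻¹ * ((1 - PowerSeries.X * u) *
            ∑ m ∈ Finset.range n, (PowerSeries.X * u) ^ m) := by ring
      _ = _ := by rw [h1, mul_pow]; ring
  rw [← map_sum, ← Finset.mul_sum, h2, map_sub,
    coeff_eq_zero_of_X_pow_dvd (Dvd.intro _ rfl) hk, sub_zero]

theorem coeff_X_mul_mul_inv_one_sub (u w : ℂ⟦X⟧) (k : ℕ) :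
    PowerSeries.coeff k (PowerSeries.X * w * (1 - PowerSeries.X * u)⁻¹) =
      ∑ m ∈ Finset.range k, PowerSeries.coeff k (PowerSeries.X * w * (PowerSeries.X * u) ^ m) := by
  rw [coeff_mul_inv_one_sub _ _ (k + 1) (Nat.lt_succ_self k), Finset.sum_range_succ, add_eq_left]
  refine coeff_eq_zero_of_X_pow_dvd (n := k + 1) ⟨w * u ^ k, ?_⟩ (Nat.lt_succ_self k)
  ring

/-- Powers of `X * u` beyond the degree do not contribute, so each coefficient is a finite sum,
polynomial in `u`; this makes the variation of the action elementary. -/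
theorem coeff_logZSub (u : ℂ⟦X⟧) (k : ℕ) :
    PowerSeries.coeff k (logZSub u) =
      ∑ n ∈ Finset.range k, -(1 / ((n : ℂ) + 1)) *
        PowerSeries.coeff k ((PowerSeries.X * u) ^ (n + 1)) := by
  have hs : PowerSeries.HasSubst (-(PowerSeries.X * u)) :=
    PowerSeries.HasSubst.of_constantCoeff_zero' (by simp)
  rw [logZSub, PowerSeries.logOf_eq, show (1 - PowerSeries.X * u - 1 : ℂ⟦X⟧) =
    -(PowerSeries.X * u) by ring, PowerSeries.coeff_subst' hs,
    finsum_eq_sum_of_support_subset (s := Finset.range (k + 1)), Finset.sum_range_succ']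
  · simp only [PowerSeries.coeff_log, Nat.succ_ne_zero, if_false, if_true, zero_smul, add_zero]
    refine Finset.sum_congr rfl fun n _ => ?_
    have : (-(PowerSeries.X * u) : ℂ⟦X⟧) ^ (n + 1) =
        PowerSeries.C ((-1 : ℂ) ^ (n + 1)) * (PowerSeries.X * u) ^ (n + 1) := by
      rw [neg_pow]; simp
    rw [this, PowerSeries.coeff_C_mul, smul_eq_mul, ← mul_assoc]
    congr 1
    have h1 : ((-1 : ℂ) ^ (n + 1)) * (-1) ^ (n + 1) = 1 := by
      rw [← mul_pow]; simp
    simp only [map_div₀, map_pow, map_neg, map_one, map_natCast]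
    rw [pow_succ (-1 : ℂ) (n + 1)]
    push_cast
    calc _ = -(((-1 : ℂ) ^ (n + 1)) * (-1) ^ (n + 1) * (1 / ((n : ℂ) + 1))) := by ring
      _ = _ := by rw [h1]; ring
  · intro d hd
    by_contra hc
    apply hd
    have hkd : k < d := by
      simp only [Finset.coe_range, Set.mem_Iio, not_lt] at hc
      omega
    have : PowerSeries.coeff k ((-(PowerSeries.X * u)) ^ d) = 0 := by
      refine coeff_eq_zero_of_X_pow_dvd (n := d) ⟨(-u) ^ d, ?_⟩ hkd
      rw [← mul_pow]; ring
    simp [this]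

/-- The Euler operator `X d/dX`. -/
noncomputable def eulerOp : Derivation ℂ ℂ⟦X⟧ ℂ⟦X⟧ := (PowerSeries.X : ℂ⟦X⟧) • PowerSeries.derivative ℂ

theorem coeff_eulerOp (f : ℂ⟦X⟧) (k : ℕ) :
    PowerSeries.coeff k (eulerOp f) = k * PowerSeries.coeff k f := by
  rw [eulerOp, Derivation.smul_apply, smul_eq_mul]
  cases k with
  | zero => simp
  | succ k =>
    rw [PowerSeries.coeff_succ_X_mul, PowerSeries.coeff_derivative]
    push_cast; ring

theorem eulerOp_C_mul (c : ℂ) (f : ℂ⟦X⟧) :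
    eulerOp (PowerSeries.C c * f) = PowerSeries.C c * eulerOp f := by
  ext k
  simp only [coeff_eulerOp, PowerSeries.coeff_C_mul]
  ring

theorem eulerOp_X : eulerOp (PowerSeries.X : ℂ⟦X⟧) = PowerSeries.X := by
  simp [eulerOp, Derivation.smul_apply]

theorem Derivation.leibniz_finset_prod {R A ι : Type*} [CommSemiring R] [CommSemiring A]
    [Algebra R A] [DecidableEq ι] (D : Derivation R A A) (s : Finset ι) (f : ι → A) :
    D (∏ i ∈ s, f i) = ∑ j ∈ s, ∏ i ∈ s, Function.update f j (D (f j)) i := by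
  induction s using Finset.induction_on with
  | empty => simp
  | insert a s ha ih =>
    rw [Finset.prod_insert ha, D.leibniz, ih, Finset.sum_insert ha, Finset.prod_insert ha,
      Function.update_self, smul_eq_mul, smul_eq_mul, Finset.mul_sum, add_comm]
    congr 1
    · rw [mul_comm]
      congr 1
      refine Finset.prod_congr rfl fun i hi => ?_
      rw [Function.update_of_ne]
      rintro rfl; exact ha hi
    · refine Finset.sum_congr rfl fun j hj => ?_
      rw [Finset.prod_insert ha, Function.update_of_ne]
      rintro rfl; exact ha hj

/-- With `θ = X d/dX`, this is `θ log(1 - X u) = -θ(X u)/(1 - X u)`, where `θ(X u) = X (u + θ u)`.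
-/
theorem mul_coeff_logZSub (u : ℂ⟦X⟧) (k : ℕ) :
    (k : ℂ) * PowerSeries.coeff k (logZSub u) =
      -PowerSeries.coeff k (PowerSeries.X * (u + eulerOp u) * (1 - PowerSeries.X * u)⁻¹) := by
  rw [coeff_logZSub, coeff_X_mul_mul_inv_one_sub, Finset.mul_sum, ← Finset.sum_neg_distrib]
  refine Finset.sum_congr rfl fun n _ => ?_
  have h1 : eulerOp ((PowerSeries.X * u) ^ (n + 1)) =
      PowerSeries.C ((n : ℂ) + 1) * (PowerSeries.X * (u + eulerOp u) * (PowerSeries.X * u) ^ n) := by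
    rw [Derivation.leibniz_pow, Derivation.leibniz, eulerOp_X]
    simp only [smul_eq_mul, nsmul_eq_mul, Nat.add_sub_cancel, map_add, map_natCast, map_one]
    push_cast
    ring
  have h2 := coeff_eulerOp ((PowerSeries.X * u) ^ (n + 1)) k
  rw [h1, PowerSeries.coeff_C_mul] at h2
  have hn : ((n : ℂ) + 1) ≠ 0 := by exact_mod_cast Nat.succ_ne_zero n
  calc (k : ℂ) * (-(1 / ((n : ℂ) + 1)) * PowerSeries.coeff k ((PowerSeries.X * u) ^ (n + 1)))
      = -(1 / ((n : ℂ) + 1)) * (k * PowerSeries.coeff k ((PowerSeries.X * u) ^ (n + 1))) := by ring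
    _ = _ := by rw [← h2]; field_simp

end SeriesIdentities

/-! ### Power series with bounded measurable coefficients -/

section FieldSeries

variable {E : Type*} [MeasurableSpace E] {κ : Measure E}

theorem memLp_top_mul {f f' : E → ℂ} (hf : MemLp f ∞ κ) (hf' : MemLp f' ∞ κ) :
    MemLp (fun x => f x * f' x) ∞ κ := hf'.mul' hf

theorem memLp_top_prod {ι : Type*} (s : Finset ι) {f : ι → E → ℂ} [IsFiniteMeasure κ]
    (hf : ∀ i ∈ s, MemLp (f i) ∞ κ) : MemLp (fun x => ∏ i ∈ s, f i x) ∞ κ := by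
  classical
  induction s using Finset.induction_on with
  | empty => simpa using memLp_const (1 : ℂ)
  | insert a s ha ih =>
    simp only [Finset.prod_insert ha]
    exact memLp_top_mul (hf a (by simp)) (ih fun i hi => hf i (by simp [hi]))

theorem integrable_of_memLp_top [IsFiniteMeasure κ] {f : E → ℂ} (hf : MemLp f ∞ κ) :
    Integrable f κ := hf.integrable le_top

theorem IsFieldSeries.add {p q : ℝ → ℂ⟦X⟧} (hp : IsFieldSeries p) (hq : IsFieldSeries q) :
    IsFieldSeries (fun x => p x + q x) := fun k => by
  simp only [map_add]
  exact (hp k).add (hq k)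

theorem IsFieldSeries.sub {p q : ℝ → ℂ⟦X⟧} (hp : IsFieldSeries p) (hq : IsFieldSeries q) :
    IsFieldSeries (fun x => p x - q x) := fun k => by
  simp only [map_sub]
  exact (hp k).sub (hq k)

theorem IsFieldSeries.mul {p q : ℝ → ℂ⟦X⟧} (hp : IsFieldSeries p) (hq : IsFieldSeries q) :
    IsFieldSeries (fun x => p x * q x) := fun k => by
  simp only [PowerSeries.coeff_mul]
  exact memLp_finsetSum _ fun c _ => memLp_top_mul (hp _) (hq _)

theorem isFieldSeries_const (c : ℂ⟦X⟧) : IsFieldSeries (fun _ => c) := fun _ => memLp_const _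

theorem IsFieldSeries.pow {p : ℝ → ℂ⟦X⟧} (hp : IsFieldSeries p) (n : ℕ) :
    IsFieldSeries (fun x => p x ^ n) := by
  induction n with
  | zero => simpa using isFieldSeries_const 1
  | succ n ih => simpa only [pow_succ] using ih.mul hp

theorem isFieldSeries_C {f : ℝ → ℂ} (hf : MemLp f ∞ unitMeasure) :
    IsFieldSeries (fun x => PowerSeries.C (f x)) := fun k => by
  simp only [PowerSeries.coeff_C]
  split_ifs
  · exact hf
  · exact memLp_const _

theorem IsFieldSeries.inv {u : ℝ → ℂ⟦X⟧} (hu : IsFieldSeries u) :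
    IsFieldSeries (fun x => (1 - PowerSeries.X * u x)⁻¹) := fun k => by
  have h : ∀ x, PowerSeries.coeff k ((1 - PowerSeries.X * u x)⁻¹) =
      ∑ m ∈ Finset.range (k + 1), PowerSeries.coeff k ((PowerSeries.X * u x) ^ m) := by
    intro x
    have := coeff_mul_inv_one_sub (u x) 1 (k + 1) (Nat.lt_succ_self k)
    simpa using this
  simp only [h]
  exact memLp_finsetSum _ fun m _ => ((isFieldSeries_const _).mul hu).pow m k

theorem IsFieldSeries.logZSub {u : ℝ → ℂ⟦X⟧} (hu : IsFieldSeries u) :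
    IsFieldSeries (fun x => logZSub (u x)) := fun k => by
  simp only [coeff_logZSub]
  exact memLp_finsetSum _ fun m _ => (((isFieldSeries_const _).mul hu).pow _ k).const_mul _

theorem IsFieldSeries.eulerOp {u : ℝ → ℂ⟦X⟧} (hu : IsFieldSeries u) :
    IsFieldSeries (fun x => eulerOp (u x)) := fun k => by
  simp only [coeff_eulerOp]
  exact (hu k).const_mul _

theorem IsFieldSeries.integrable {p : ℝ → ℂ⟦X⟧} (hp : IsFieldSeries p) (k : ℕ) :
    Integrable (fun x => PowerSeries.coeff k (p x)) unitMeasure := (hp k).integrable le_top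

theorem coeff_fieldIntegral (p : ℝ → ℂ⟦X⟧) (k : ℕ) :
    PowerSeries.coeff k (fieldIntegral p) = ∫ x, PowerSeries.coeff k (p x) ∂unitMeasure := by
  rw [fieldIntegral, PowerSeries.coeff_mk]

/-- Each coefficient to be varied is a polynomial in `t`; its derivative at `0` collects the terms
of degree one. -/
theorem hasDerivAt_sum_pow_mul {ι : Type*} (s : Finset ι) (e : ι → ℕ) (c : ι → ℂ) :
    HasDerivAt (fun t : ℂ => ∑ i ∈ s, t ^ e i * c i) (∑ i ∈ s, if e i = 1 then c i else 0) 0 := by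
  refine HasDerivAt.fun_sum fun i _ => ?_
  refine ((hasDerivAt_pow (e i) (0 : ℂ)).mul_const (c i)).congr_deriv ?_
  by_cases h1 : e i = 1
  · simp [h1]
  · rw [if_neg h1]
    rcases Nat.eq_zero_or_pos (e i) with h0 | h0
    · simp [h0]
    · rw [zero_pow (by omega)]; simp

/-- The variation of the integral of `r b^n`. -/
theorem hasDerivAt_integral_mul_pow {r b β : ℝ → ℂ⟦X⟧} (hr : IsFieldSeries r)
    (hb : IsFieldSeries b) (hβ : IsFieldSeries β) (n k : ℕ) :
    HasDerivAt (fun t : ℂ => ∫ x, PowerSeries.coeff k (r x * (b x + t • β x) ^ (n + 1)) ∂unitMeasure)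
      (((n : ℂ) + 1) * ∫ x, PowerSeries.coeff k (r x * β x * b x ^ n) ∂unitMeasure) 0 := by
  have h1 : ∀ t : ℂ, ∫ x, PowerSeries.coeff k (r x * (b x + t • β x) ^ (n + 1)) ∂unitMeasure =
      ∑ d ∈ Finset.range (n + 2), t ^ d * (((n + 1).choose d : ℂ) *
        ∫ x, PowerSeries.coeff k (r x * β x ^ d * b x ^ (n + 1 - d)) ∂unitMeasure) := by
    intro t
    have h2 : ∀ x, PowerSeries.coeff k (r x * (b x + t • β x) ^ (n + 1)) =
        ∑ d ∈ Finset.range (n + 2), t ^ d * (((n + 1).choose d : ℂ) *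
          PowerSeries.coeff k (r x * β x ^ d * b x ^ (n + 1 - d))) := by
      intro x
      rw [add_comm, add_pow, Finset.mul_sum, map_sum]
      refine Finset.sum_congr rfl fun d _ => ?_
      rw [← PowerSeries.coeff_C_mul, ← PowerSeries.coeff_C_mul]
      congr 1
      rw [PowerSeries.smul_eq_C_mul, mul_pow, map_pow, map_natCast]
      ring
    simp only [h2]
    rw [integral_finsetSum _ fun d _ => ((((hr.mul (hβ.pow d)).mul
      (hb.pow (n + 1 - d))).integrable k).const_mul _).const_mul _]
    refine Finset.sum_congr rfl fun d _ => ?_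
    rw [integral_const_mul, integral_const_mul]
  simp only [h1]
  refine (hasDerivAt_sum_pow_mul _ (fun d : ℕ => d) _).congr_deriv ?_
  rw [Finset.sum_ite_eq' (Finset.range (n + 2)) 1, if_pos (by simp)]
  simp

/-- The variation of the local part of the action. -/
theorem hasDerivAt_local_action {u : ℝ → ℂ} (hu : MemLp u ∞ unitMeasure) {a b α β : ℝ → ℂ⟦X⟧}
    (ha : IsFieldSeries a) (hb : IsFieldSeries b) (hα : IsFieldSeries α) (hβ : IsFieldSeries β)
    (k : ℕ) :
    HasDerivAt (fun t : ℂ => PowerSeries.coeff k (fieldIntegral fun x =>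
        logZSub (PowerSeries.C (u x) * (b + t • β) x) + (a + t • α) x * (b + t • β) x))
      (∫ x, PowerSeries.coeff k ((a x - PowerSeries.C (u x) *
        invZSub (PowerSeries.C (u x) * b x)) * β x + b x * α x) ∂unitMeasure) 0 := by
  have hC := isFieldSeries_C hu
  have hX : IsFieldSeries (fun _ => (PowerSeries.X : ℂ⟦X⟧)) := isFieldSeries_const _
  have hbt : ∀ t : ℂ, IsFieldSeries fun x => b x + t • β x := by
    intro t
    refine hb.add ?_
    simp only [PowerSeries.smul_eq_C_mul]
    exact (isFieldSeries_const _).mul hβ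
  have h1 : ∀ t : ℂ, PowerSeries.coeff k (fieldIntegral fun x =>
      logZSub (PowerSeries.C (u x) * (b + t • β) x) + (a + t • α) x * (b + t • β) x) =
      (∑ n ∈ Finset.range k, -(1 / ((n : ℂ) + 1)) * ∫ x, PowerSeries.coeff k
        ((PowerSeries.X * PowerSeries.C (u x)) ^ (n + 1) * (b x + t • β x) ^ (n + 1)) ∂unitMeasure) +
      ((∫ x, PowerSeries.coeff k (a x * (b x + t • β x) ^ (0 + 1)) ∂unitMeasure) +
        t * ∫ x, PowerSeries.coeff k (α x * (b x + t • β x) ^ (0 + 1)) ∂unitMeasure) := by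
    intro t
    rw [coeff_fieldIntegral]
    have h2 : ∀ x, PowerSeries.coeff k (logZSub (PowerSeries.C (u x) * (b + t • β) x) +
        (a + t • α) x * (b + t • β) x) =
        (∑ n ∈ Finset.range k, -(1 / ((n : ℂ) + 1)) * PowerSeries.coeff k
          ((PowerSeries.X * PowerSeries.C (u x)) ^ (n + 1) * (b x + t • β x) ^ (n + 1))) +
        (PowerSeries.coeff k (a x * (b x + t • β x) ^ (0 + 1)) +
          t * PowerSeries.coeff k (α x * (b x + t • β x) ^ (0 + 1))) := by
      intro x
      rw [map_add, coeff_logZSub]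
      congr 1
      · refine Finset.sum_congr rfl fun n _ => ?_
        rw [← mul_pow]
        simp only [Pi.add_apply, Pi.smul_apply, mul_assoc]
      · rw [← PowerSeries.coeff_C_mul, ← map_add]
        simp only [Pi.add_apply, Pi.smul_apply, PowerSeries.smul_eq_C_mul]
        congr 1
        ring
    simp only [h2]
    have i1 : ∀ n : ℕ, Integrable (fun x => -(1 / ((n : ℂ) + 1)) * PowerSeries.coeff k
        ((PowerSeries.X * PowerSeries.C (u x)) ^ (n + 1) * (b x + t • β x) ^ (n + 1)))
        unitMeasure := fun n =>
      ((((hX.mul hC).pow _).mul ((hbt t).pow _)).integrable k).const_mul _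
    have i2 := (ha.mul ((hbt t).pow (0 + 1))).integrable k
    have i3 := ((hα.mul ((hbt t).pow (0 + 1))).integrable k).const_mul t
    have i23 : Integrable (fun x => PowerSeries.coeff k (a x * (b x + t • β x) ^ (0 + 1)) +
        t * PowerSeries.coeff k (α x * (b x + t • β x) ^ (0 + 1))) unitMeasure := i2.add i3
    rw [integral_add (integrable_finsetSum _ fun n _ => i1 n) i23, integral_add i2 i3,
      integral_finsetSum _ fun n _ => i1 n, integral_const_mul]
    simp only [integral_const_mul]
  simp only [h1]
  have d1 : ∀ n : ℕ, n ∈ Finset.range k → HasDerivAt (fun t : ℂ => -(1 / ((n : ℂ) + 1)) *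
      ∫ x, PowerSeries.coeff k
        ((PowerSeries.X * PowerSeries.C (u x)) ^ (n + 1) * (b x + t • β x) ^ (n + 1)) ∂unitMeasure)
      (-(1 / ((n : ℂ) + 1)) * (((n : ℂ) + 1) * ∫ x, PowerSeries.coeff k
        ((PowerSeries.X * PowerSeries.C (u x)) ^ (n + 1) * β x * b x ^ n) ∂unitMeasure)) 0 := fun n _ =>
    (hasDerivAt_integral_mul_pow ((hX.mul hC).pow (n + 1)) hb hβ n k).const_mul _
  have d2 := hasDerivAt_integral_mul_pow ha hb hβ 0 k
  have d3 := (hasDerivAt_id (0 : ℂ)).mul (hasDerivAt_integral_mul_pow hα hb hβ 0 k)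
  refine ((HasDerivAt.fun_sum d1).add (d2.add d3)).congr_deriv ?_
  symm
  have h3 : ∀ x, PowerSeries.coeff k ((a x - PowerSeries.C (u x) *
      invZSub (PowerSeries.C (u x) * b x)) * β x + b x * α x) =
      (∑ n ∈ Finset.range k, -PowerSeries.coeff k ((PowerSeries.X * PowerSeries.C (u x)) ^ (n + 1) *
        β x * b x ^ n)) + (PowerSeries.coeff k (a x * β x * b x ^ 0) +
          PowerSeries.coeff k (α x * (b x) ^ (0 + 1))) := by
    intro x
    have e1 : (a x - PowerSeries.C (u x) * invZSub (PowerSeries.C (u x) * b x)) * β x + b x * α x =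
        -(PowerSeries.X * (PowerSeries.C (u x) * β x) *
          (1 - PowerSeries.X * (PowerSeries.C (u x) * b x))⁻¹) +
          (a x * β x * b x ^ 0 + α x * (b x) ^ (0 + 1)) := by
      rw [invZSub]; ring
    rw [e1, map_add, map_neg, coeff_X_mul_mul_inv_one_sub, map_add, Finset.sum_neg_distrib]
    congr 2
    refine Finset.sum_congr rfl fun n _ => ?_
    congr 1
    ring
  simp only [h3]
  have i1 : ∀ n : ℕ, Integrable (fun x => -PowerSeries.coeff k
      ((PowerSeries.X * PowerSeries.C (u x)) ^ (n + 1) * β x * b x ^ n)) unitMeasure := fun n =>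
    (((((hX.mul hC).pow _).mul hβ).mul (hb.pow _)).integrable k).neg
  have i2 := ((ha.mul hβ).mul (hb.pow 0)).integrable k
  have i3 := (hα.mul (hb.pow (0 + 1))).integrable k
  have i23 : Integrable (fun x => PowerSeries.coeff k (a x * β x * b x ^ 0) +
      PowerSeries.coeff k (α x * (b x) ^ (0 + 1))) unitMeasure := i2.add i3
  rw [integral_add (integrable_finsetSum _ fun n _ => i1 n) i23, integral_add i2 i3,
    integral_finsetSum _ fun n _ => i1 n]
  congr 1
  · refine Finset.sum_congr rfl fun n _ => ?_
    have hn : ((n : ℂ) + 1) ≠ 0 := by exact_mod_cast Nat.succ_ne_zero n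
    rw [integral_neg]
    field_simp
  · simp

/-- A bounded function which is orthogonal to all bounded functions vanishes. -/
theorem ae_eq_zero_of_forall_integral_mul {f : ℝ → ℂ} (hf : MemLp f ∞ unitMeasure)
    (h : ∀ φ : ℝ → ℂ, MemLp φ ∞ unitMeasure → ∫ x, f x * φ x ∂unitMeasure = 0) :
    ∀ᵐ x ∂unitMeasure, f x = 0 := by
  have hconj : MemLp (fun x => star (f x)) ∞ unitMeasure := hf.star
  have h1 := h _ hconj
  have h2 : ∀ x, f x * star (f x) = ((‖f x‖ ^ 2 : ℝ) : ℂ) := by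
    intro x
    have := Complex.mul_conj' (f x)
    push_cast
    exact this
  simp only [h2] at h1
  rw [integral_complex_ofReal, Complex.ofReal_eq_zero, integral_eq_zero_iff_of_nonneg] at h1
  · filter_upwards [h1] with x hx
    simpa using hx
  · intro x; positivity
  · have h3 := integrable_of_memLp_top (memLp_top_mul hf hconj)
    simp only [h2] at h3
    exact h3.re.congr (Eventually.of_forall fun x => Complex.ofReal_re _)

end FieldSeries

/-! ### The functional `F₀` and its derivative -/

section FreeEnergy

theorem memLp_coeff_prod_cube {m : ℕ} {p : Fin m → ℝ → ℂ⟦X⟧} (hp : ∀ j, IsFieldSeries (p j))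
    (k : ℕ) : MemLp (fun y : Fin m → ℝ => PowerSeries.coeff k (∏ j, p j (y j))) ∞
      (cubeMeasure m) := by
  classical
  simp only [PowerSeries.coeff_prod]
  exact memLp_finsetSum _ fun c _ => memLp_top_prod _ fun j _ =>
    (hp j (c j)).comp_measurePreserving (measurePreserving_eval (fun _ => unitMeasure) j)

/-- The kernels are bounded and measurable, and invariant under cyclic permutations. -/
structure IsCyclicKernel (g : (n : ℕ) → (Fin n → ℝ) → ℂ) : Prop where
  memLp : ∀ m, MemLp (g (m + 1)) ∞ (cubeMeasure (m + 1))
  rotate : ∀ m (j : Fin (m + 1)), ∀ᵐ y ∂cubeMeasure (m + 1),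
    g (m + 1) (fun k => y (k + j)) = g (m + 1) y

variable {g : (n : ℕ) → (Fin n → ℝ) → ℂ}

theorem IsCyclicKernel.memLp_mul (hg : IsCyclicKernel g) {n : ℕ} (hn : 1 ≤ n)
    {p : Fin n → ℝ → ℂ⟦X⟧} (hp : ∀ j, IsFieldSeries (p j)) (k : ℕ) :
    MemLp (fun y => PowerSeries.coeff k (∏ j, p j (y j)) * g n y) ∞ (cubeMeasure n) := by
  obtain ⟨m, rfl⟩ := Nat.exists_eq_add_of_le' hn
  exact memLp_top_mul (memLp_coeff_prod_cube hp k) (hg.memLp m)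

theorem coeff_F₀ (p : ℝ → ℂ⟦X⟧) (k : ℕ) :
    PowerSeries.coeff k (F₀ g p) = ∑ n ∈ Finset.Icc 1 k, (1 / (n : ℂ)) *
      ∫ x, PowerSeries.coeff k (∏ j, p (x j)) * g n x ∂cubeMeasure n := by
  simp only [F₀, PowerSeries.coeff_mk, cubeMeasure_eq]

/-- The `k`-th coefficient of the first variation of `F₀` at `a` in the direction `α`. -/
noncomputable def varF₀ (g : (n : ℕ) → (Fin n → ℝ) → ℂ) (a α : ℝ → ℂ⟦X⟧) (k : ℕ) : ℂ :=
  ∑ n ∈ Finset.Icc 1 k, (1 / (n : ℂ)) * ∑ j : Fin n,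
    ∫ x, PowerSeries.coeff k (∏ i, Function.update (fun i => a (x i)) j (α (x j)) i) * g n x
      ∂cubeMeasure n

/-- Expand the product over the set `S` of positions that carry `α`; the degree in `t` is the size
of `S`, so the singletons give the derivative. -/
theorem hasDerivAt_integral_prod (hg : IsCyclicKernel g) {a α : ℝ → ℂ⟦X⟧}
    (ha : IsFieldSeries a) (hα : IsFieldSeries α) {n : ℕ} (hn : 1 ≤ n) (k : ℕ) :
    HasDerivAt (fun t : ℂ => ∫ x, PowerSeries.coeff k (∏ j, (a + t • α) (x j)) * g n x
        ∂cubeMeasure n)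
      (∑ j : Fin n, ∫ x, PowerSeries.coeff k
        (∏ i, Function.update (fun i => a (x i)) j (α (x j)) i) * g n x ∂cubeMeasure n) 0 := by
  have h1 : ∀ t : ℂ, ∫ x, PowerSeries.coeff k (∏ j, (a + t • α) (x j)) * g n x ∂cubeMeasure n =
      ∑ S ∈ (Finset.univ : Finset (Fin n)).powerset, t ^ S.card * ∫ x, PowerSeries.coeff k
        (∏ i, (if i ∈ S then α else a) (x i)) * g n x ∂cubeMeasure n := by
    intro t
    have h2 : ∀ x : Fin n → ℝ, PowerSeries.coeff k (∏ j, (a + t • α) (x j)) * g n x =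
        ∑ S ∈ (Finset.univ : Finset (Fin n)).powerset, t ^ S.card * (PowerSeries.coeff k
          (∏ i, (if i ∈ S then α else a) (x i)) * g n x) := by
      intro x
      simp only [Pi.add_apply, Pi.smul_apply]
      rw [Finset.prod_congr rfl fun j _ => add_comm (a (x j)) _, Finset.prod_add, map_sum,
        Finset.sum_mul]
      refine Finset.sum_congr rfl fun S _ => ?_
      rw [← mul_assoc, ← PowerSeries.coeff_C_mul]
      congr 2
      have h3 : ∏ i, (if i ∈ S then α else a) (x i) =
          ∏ i, S.piecewise (fun i => α (x i)) (fun i => a (x i)) i := by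
        refine Finset.prod_congr rfl fun i _ => ?_
        rw [Finset.piecewise]
        split_ifs <;> rfl
      rw [h3, Finset.prod_piecewise, Finset.univ_inter]
      simp only [PowerSeries.smul_eq_C_mul]
      rw [Finset.prod_mul_distrib, Finset.prod_const, map_pow]
      ring
    simp only [h2]
    rw [integral_finsetSum]
    · simp only [integral_const_mul]
    · intro S _
      refine (integrable_of_memLp_top (hg.memLp_mul hn (fun i => ?_) k)).const_mul _
      split_ifs <;> assumption
  simp only [h1]
  refine (hasDerivAt_sum_pow_mul _ (fun S : Finset (Fin n) => S.card) _).congr_deriv ?_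
  rw [← Finset.sum_filter, ← Finset.powersetCard_eq_filter, Finset.powersetCard_one,
    Finset.sum_map]
  refine Finset.sum_congr rfl fun j _ => ?_
  congr 1
  funext x
  congr 2
  refine Finset.prod_congr rfl fun i _ => ?_
  by_cases hij : i = j
  · subst hij; simp
  · simp [hij]

theorem hasDerivAt_F₀ (hg : IsCyclicKernel g) {a α : ℝ → ℂ⟦X⟧}
    (ha : IsFieldSeries a) (hα : IsFieldSeries α) (k : ℕ) :
    HasDerivAt (fun t : ℂ => PowerSeries.coeff k (F₀ g (a + t • α))) (varF₀ g a α k) 0 := by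
  simp only [coeff_F₀]
  exact HasDerivAt.fun_sum fun n hn =>
    (hasDerivAt_integral_prod hg ha hα (Finset.mem_Icc.1 hn).1 k).const_mul _

/-- In the direction `θ a` the sum over the varied position is the Leibniz rule for `θ` applied to
the product, and `θ` multiplies coefficient `k` by `k`. -/
theorem varF₀_eulerOp (hg : IsCyclicKernel g) {a : ℝ → ℂ⟦X⟧} (ha : IsFieldSeries a) (k : ℕ) :
    varF₀ g a (fun x => eulerOp (a x)) k = k * PowerSeries.coeff k (F₀ g a) := by
  rw [coeff_F₀, varF₀, Finset.mul_sum]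
  refine Finset.sum_congr rfl fun n hn => ?_
  rw [← mul_assoc, mul_comm (k : ℂ), mul_assoc]
  congr 1
  rw [← integral_const_mul, ← integral_finsetSum]
  · congr 1
    funext x
    rw [← Finset.sum_mul, ← map_sum, ← Derivation.leibniz_finset_prod eulerOp, coeff_eulerOp,
      mul_assoc]
  · intro j _
    have h1 : ∀ x : Fin n → ℝ, ∏ i, Function.update (fun i => a (x i)) j (eulerOp (a (x j))) i =
        ∏ i, (if i = j then (fun x => eulerOp (a x)) else a) (x i) := by
      intro x
      refine Finset.prod_congr rfl fun i _ => ?_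
      by_cases hij : i = j
      · subst hij; simp
      · simp [hij]
    simp only [h1]
    refine integrable_of_memLp_top (hg.memLp_mul (Finset.mem_Icc.1 hn).1 (fun i => ?_) k)
    split_ifs
    · exact ha.eulerOp
    · exact ha

/-- Splitting off the first coordinate. -/
theorem measurePreserving_cons (m : ℕ) :
    MeasurePreserving (fun p : ℝ × (Fin m → ℝ) => (Fin.cons p.1 p.2 : Fin (m + 1) → ℝ))
      (unitMeasure.prod (cubeMeasure m)) (cubeMeasure (m + 1)) := by
  have h := (measurePreserving_piFinSuccAbove (fun _ : Fin (m + 1) => unitMeasure) 0).symm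
  convert h using 1
  funext p
  simp [MeasurableEquiv.piFinSuccAbove, Fin.insertNthEquiv]

theorem integral_cons {m : ℕ} {F : (Fin (m + 1) → ℝ) → ℂ} (hF : MemLp F ∞ (cubeMeasure (m + 1))) :
    ∫ y, F y ∂cubeMeasure (m + 1) =
      ∫ x, ∫ y, F (Fin.cons x y) ∂cubeMeasure m ∂unitMeasure := by
  have hm := measurePreserving_cons m
  rw [← hm.map_eq, integral_map hm.measurable.aemeasurable (by rw [hm.map_eq]; exact hF.1),
    integral_prod]
  exact integrable_of_memLp_top (hF.comp_measurePreserving hm)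

theorem ae_memLp_cons {m : ℕ} {F : (Fin (m + 1) → ℝ) → ℂ} (hF : MemLp F ∞ (cubeMeasure (m + 1))) :
    ∀ᵐ x ∂unitMeasure, Integrable (fun y => F (Fin.cons x y)) (cubeMeasure m) :=
  (integrable_of_memLp_top (hF.comp_measurePreserving (measurePreserving_cons m))).prod_right_ae

theorem memLp_integral_cons {m : ℕ} {F : (Fin (m + 1) → ℝ) → ℂ}
    (hF : MemLp F ∞ (cubeMeasure (m + 1))) :
    MemLp (fun x => ∫ y, F (Fin.cons x y) ∂cubeMeasure m) ∞ unitMeasure := by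
  have h := hF.comp_measurePreserving (measurePreserving_cons m)
  obtain ⟨K, hK⟩ : ∃ K : ℝ, ∀ᵐ p ∂unitMeasure.prod (cubeMeasure m),
      ‖F (Fin.cons p.1 p.2)‖ ≤ K := by
    refine ⟨(eLpNorm (F ∘ fun p : ℝ × (Fin m → ℝ) => (Fin.cons p.1 p.2 : Fin (m + 1) → ℝ)) ∞
      (unitMeasure.prod (cubeMeasure m))).toReal, ?_⟩
    have h2 := ae_le_eLpNormEssSup (f := F ∘ fun p : ℝ × (Fin m → ℝ) =>
      (Fin.cons p.1 p.2 : Fin (m + 1) → ℝ)) (μ := unitMeasure.prod (cubeMeasure m))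
    filter_upwards [h2] with p hp
    rw [eLpNorm_exponent_top]
    have h3 := h.2.ne
    rw [eLpNorm_exponent_top] at h3
    have := ENNReal.toReal_mono h3 hp
    simpa using this
  refine memLp_top_of_bound h.1.integral_prod_right' K ?_
  filter_upwards [Measure.ae_ae_of_ae_prod hK] with x hx
  have := norm_integral_le_of_norm_le_const hx
  simpa using this

/-- The functional derivative of `F₀` at `a`, as a field. -/
noncomputable def gradF₀ (g : (n : ℕ) → (Fin n → ℝ) → ℂ) (a : ℝ → ℂ⟦X⟧) (x : ℝ) : ℂ⟦X⟧ :=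
  PowerSeries.mk fun q => ∑ m ∈ Finset.range (q + 1),
    ∫ y, PowerSeries.coeff q (∏ k, a (y k)) * g (m + 1) (Fin.cons x y) ∂cubeMeasure m

theorem prod_cons_eq {m : ℕ} (f a : ℝ → ℂ⟦X⟧) (x : ℝ) (y : Fin m → ℝ) :
    ∏ k : Fin (m + 1), (if k = 0 then f else a) ((Fin.cons x y : Fin (m + 1) → ℝ) k) =
      f x * ∏ k, a (y k) := by
  rw [Fin.prod_univ_succ]
  simp [Fin.succ_ne_zero]

theorem IsCyclicKernel.memLp_mul_cons (hg : IsCyclicKernel g) {f a : ℝ → ℂ⟦X⟧}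
    (hf : IsFieldSeries f) (ha : IsFieldSeries a) (m k : ℕ) :
    MemLp (fun y : Fin (m + 1) → ℝ => PowerSeries.coeff k
      (∏ i, (if i = 0 then f else a) (y i)) * g (m + 1) y) ∞ (cubeMeasure (m + 1)) := by
  refine hg.memLp_mul (by omega) (fun i => ?_) k
  split_ifs <;> assumption

theorem isFieldSeries_gradF₀ (hg : IsCyclicKernel g) {a : ℝ → ℂ⟦X⟧} (ha : IsFieldSeries a) :
    IsFieldSeries (gradF₀ g a) := fun q => by
  simp only [gradF₀, PowerSeries.coeff_mk]
  refine memLp_finsetSum _ fun m _ => ?_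
  have := memLp_integral_cons (hg.memLp_mul_cons (isFieldSeries_const 1) ha m q)
  simpa only [prod_cons_eq, one_mul] using this

theorem coeff_prod_eq_zero {m : ℕ} {f : Fin m → ℂ⟦X⟧} (hf : ∀ k, PowerSeries.coeff 0 (f k) = 0)
    {q : ℕ} (hq : q < m) : PowerSeries.coeff q (∏ k, f k) = 0 := by
  have : (PowerSeries.X : ℂ⟦X⟧) ^ m ∣ ∏ k, f k := by
    have h := Finset.prod_dvd_prod_of_dvd (s := Finset.univ) (fun _ : Fin m => (PowerSeries.X : ℂ⟦X⟧))
      f fun k _ => PowerSeries.X_dvd_iff.2 (by simpa using hf k)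
    simpa using h
  exact coeff_eq_zero_of_X_pow_dvd this hq

theorem coeff_zero_of_fieldSeries₀ {a : ℝ → ℂ⟦X⟧} (ha : IsFieldSeries₀ a) :
    ∀ᵐ x ∂unitMeasure, PowerSeries.coeff 0 (a x) = 0 := by
  filter_upwards [ae_mem_unit] with x hx
  simpa using ha.2 x hx

/-- Since `f` has no constant term, only coefficients of `gradF₀` below `k` enter. Their different
cutoffs may all be raised to `k`, because a product of `m` factors `a` has no coefficient below `m`.
-/
theorem coeff_mul_gradF₀ (hg : IsCyclicKernel g) {f a : ℝ → ℂ⟦X⟧} (hf : IsFieldSeries₀ f)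
    (ha : IsFieldSeries₀ a) (k : ℕ) :
    ∀ᵐ x ∂unitMeasure, PowerSeries.coeff k (f x * gradF₀ g a x) =
      ∑ m ∈ Finset.range k, ∫ y, PowerSeries.coeff k (f x * ∏ i, a (y i)) *
        g (m + 1) (Fin.cons x y) ∂cubeMeasure m := by
  have hint : ∀ᵐ x ∂unitMeasure, ∀ m q, Integrable (fun y => PowerSeries.coeff q (∏ i, a (y i)) *
      g (m + 1) (Fin.cons x y)) (cubeMeasure m) := by
    rw [ae_all_iff]; intro m
    rw [ae_all_iff]; intro q
    have := ae_memLp_cons (hg.memLp_mul_cons (isFieldSeries_const 1) ha.1 m q)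
    simpa only [prod_cons_eq, one_mul] using this
  filter_upwards [hint, coeff_zero_of_fieldSeries₀ hf] with x hx hf0
  have hzero : ∀ m q, q < m → ∫ y, PowerSeries.coeff q (∏ i, a (y i)) *
      g (m + 1) (Fin.cons x y) ∂cubeMeasure m = 0 := by
    intro m q hq
    apply integral_eq_zero_of_ae
    filter_upwards [ae_cube_of_ae (coeff_zero_of_fieldSeries₀ ha)] with y hy
    rw [coeff_prod_eq_zero hy hq]
    simp
  have hterm : ∀ c ∈ Finset.HasAntidiagonal.antidiagonal k,
      PowerSeries.coeff c.1 (f x) * PowerSeries.coeff c.2 (gradF₀ g a x) =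
      ∑ m ∈ Finset.range k, ∫ y, PowerSeries.coeff c.1 (f x) *
        (PowerSeries.coeff c.2 (∏ i, a (y i)) * g (m + 1) (Fin.cons x y)) ∂cubeMeasure m := by
    rintro ⟨r, q⟩ hc
    rw [Finset.HasAntidiagonal.mem_antidiagonal] at hc
    simp only at hc ⊢
    rcases Nat.eq_zero_or_pos r with rfl | hr
    · simp [hf0]
    · simp only [integral_const_mul]
      rw [← Finset.mul_sum, gradF₀, PowerSeries.coeff_mk]
      congr 1
      refine Finset.sum_subset (Finset.range_subset_range.2 (by omega)) fun m _ hm => hzero m q ?_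
      simp only [Finset.mem_range, not_lt] at hm
      omega
  rw [PowerSeries.coeff_mul, Finset.sum_congr rfl hterm, Finset.sum_comm]
  refine Finset.sum_congr rfl fun m _ => ?_
  rw [← integral_finsetSum _ fun c _ => (hx m c.2).const_mul _]
  congr 1
  funext y
  rw [PowerSeries.coeff_mul, Finset.sum_mul]
  refine Finset.sum_congr rfl fun c _ => ?_
  ring

/-- A cyclic shift of the variables moves the position of `α` to the first coordinate without
changing the kernel. The `n` equal terms cancel the factor `1/n`, and Fubini integrates the other
coordinates first. -/
theorem varF₀_eq_integral_gradF₀ (hg : IsCyclicKernel g) {a α : ℝ → ℂ⟦X⟧} (ha : IsFieldSeries₀ a)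
    (hα : IsFieldSeries₀ α) (k : ℕ) :
    varF₀ g a α k = PowerSeries.coeff k (fieldIntegral fun x => gradF₀ g a x * α x) := by
  have hrot : ∀ (m : ℕ) (j : Fin (m + 1)),
      ∫ x, PowerSeries.coeff k (∏ i, Function.update (fun i => a (x i)) j (α (x j)) i) *
        g (m + 1) x ∂cubeMeasure (m + 1) =
      ∫ x, PowerSeries.coeff k (∏ i, (if i = 0 then α else a) (x i)) * g (m + 1) x
        ∂cubeMeasure (m + 1) := by
    intro m j
    have hmp := measurePreserving_piCongrLeft (fun _ : Fin (m + 1) => unitMeasure)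
      (Equiv.addRight j).symm
    have hform : ∀ x : Fin (m + 1) → ℝ,
        (MeasurableEquiv.piCongrLeft (fun _ => ℝ) (Equiv.addRight j).symm) x =
          fun k => x (k + j) := by
      intro x
      funext k
      have := Equiv.piCongrLeft_apply_apply (fun _ : Fin (m + 1) => ℝ) (Equiv.addRight j).symm x (k + j)
      simpa [MeasurableEquiv.coe_piCongrLeft] using this
    rw [← hmp.integral_comp' (fun x => PowerSeries.coeff k
      (∏ i, (if i = 0 then α else a) (x i)) * g (m + 1) x)]
    apply integral_congr_ae
    filter_upwards [hg.rotate m j] with x hx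
    rw [hform]
    simp only [hx]
    congr 2
    rw [← Equiv.prod_comp (Equiv.addRight j) fun i =>
      Function.update (fun i => a (x i)) j (α (x j)) i]
    refine Finset.prod_congr rfl fun i _ => ?_
    rw [Equiv.coe_addRight]
    by_cases hi : i = 0
    · subst hi; simp
    · rw [if_neg hi, Function.update_of_ne]
      simpa using hi
  rw [coeff_fieldIntegral, varF₀]
  have h1 : ∫ x, PowerSeries.coeff k (gradF₀ g a x * α x) ∂unitMeasure =
      ∫ x, ∑ m ∈ Finset.range k, ∫ y, PowerSeries.coeff k (α x * ∏ i, a (y i)) *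
        g (m + 1) (Fin.cons x y) ∂cubeMeasure m ∂unitMeasure := by
    apply integral_congr_ae
    filter_upwards [coeff_mul_gradF₀ hg hα ha k] with x hx
    rw [mul_comm, hx]
  have hmem := fun m => hg.memLp_mul_cons hα.1 ha.1 m k
  rw [h1, integral_finsetSum]
  · have hshift := Finset.sum_Ico_add' (fun n => (1 / ((n : ℕ) : ℂ)) * ∑ j : Fin n,
      ∫ x, PowerSeries.coeff k (∏ i, Function.update (fun i => a (x i)) j (α (x j)) i) * g n x
        ∂cubeMeasure n) 0 k 1
    have hIcc : Finset.Icc 1 k = Finset.Ico (0 + 1) (k + 1) := by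
      ext n; simp only [Finset.mem_Icc, Finset.mem_Ico]; omega
    rw [hIcc, ← hshift, Finset.range_eq_Ico]
    · refine Finset.sum_congr rfl fun m _ => ?_
      have hm : ((m + 1 : ℕ) : ℂ) ≠ 0 := by exact_mod_cast Nat.succ_ne_zero m
      rw [Finset.sum_congr rfl fun j _ => hrot m j, Finset.sum_const, Finset.card_univ,
        Fintype.card_fin, nsmul_eq_mul, integral_cons (hmem m), ← mul_assoc, one_div,
        inv_mul_cancel₀ hm, one_mul]
      simp only [prod_cons_eq]
  · intro m _
    have := integrable_of_memLp_top (memLp_integral_cons (hmem m))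
    simpa only [prod_cons_eq] using this

theorem isFunctionalDerivF₀_iff (hg : IsCyclicKernel g) {a b : ℝ → ℂ⟦X⟧} (ha : IsFieldSeries₀ a)
    (hb : IsFieldSeries b) :
    IsFunctionalDerivF₀ g a b ↔ ∀ᵐ x ∂unitMeasure, b x = gradF₀ g a x := by
  have hgrad := isFieldSeries_gradF₀ hg ha.1
  constructor
  · intro h
    have hk : ∀ᵐ x ∂unitMeasure, ∀ k, PowerSeries.coeff k (b x - gradF₀ g a x) = 0 := by
      rw [ae_all_iff]
      intro k
      refine ae_eq_zero_of_forall_integral_mul ((hb.sub hgrad) k) fun φ hφ => ?_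
      -- Admissible directions have no constant term; testing with `X φ` and reading off coefficient
      -- `k + 1` isolates coefficient `k` of `b`.
      have hα : IsFieldSeries₀ fun x => PowerSeries.X * PowerSeries.C (φ x) :=
        ⟨(isFieldSeries_const _).mul (isFieldSeries_C hφ), fun x _ => by simp⟩
      have h1 := (h _ hα (k + 1)).unique (hasDerivAt_F₀ hg ha.1 hα.1 (k + 1))
      rw [varF₀_eq_integral_gradF₀ hg ha hα, coeff_fieldIntegral, coeff_fieldIntegral] at h1
      have h2 : ∀ (p : ℂ⟦X⟧) (c : ℂ), PowerSeries.coeff (k + 1)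
          (p * (PowerSeries.X * PowerSeries.C c)) = PowerSeries.coeff k p * c := by
        intro p c
        rw [mul_left_comm, PowerSeries.coeff_succ_X_mul, PowerSeries.coeff_mul_C]
      simp only [h2] at h1
      simp only [map_sub, sub_mul]
      rw [integral_sub (integrable_of_memLp_top (memLp_top_mul (hb k) hφ))
        (integrable_of_memLp_top (memLp_top_mul (hgrad k) hφ)), h1, sub_self]
    filter_upwards [hk] with x hx
    rw [← sub_eq_zero]
    ext k
    simpa using hx k
  · intro h α hα k
    refine (hasDerivAt_F₀ hg ha.1 hα.1 k).congr_deriv ?_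
    rw [varF₀_eq_integral_gradF₀ hg ha hα, coeff_fieldIntegral, coeff_fieldIntegral]
    apply integral_congr_ae
    filter_upwards [h] with x hx
    rw [hx]

end FreeEnergy

/-! ### Solving the saddle point equations -/

section SaddlePoint

variable {g : (n : ℕ) → (Fin n → ℝ) → ℂ}

/-- Clearing the denominator puts the equation for `a` in fixed point form, with an explicit factor
`X`. -/
theorem eq_mul_invZSub_iff {c : ℂ} {a b : ℂ⟦X⟧} :
    a = PowerSeries.C c * invZSub (PowerSeries.C c * b) ↔
      a = PowerSeries.X * (PowerSeries.C c * (1 + a * b)) := by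
  have h := one_sub_X_mul_mul_inv (PowerSeries.C c * b)
  rw [invZSub]
  constructor
  · intro ha
    have h1 : a * (1 - PowerSeries.X * (PowerSeries.C c * b)) = PowerSeries.X * PowerSeries.C c := by
      rw [ha]
      linear_combination PowerSeries.X * PowerSeries.C c * h
    linear_combination h1
  · intro ha
    have h1 : a * (1 - PowerSeries.X * (PowerSeries.C c * b)) = PowerSeries.X * PowerSeries.C c := by
      linear_combination ha
    linear_combination (1 - PowerSeries.X * (PowerSeries.C c * b))⁻¹ * h1 - a * h

theorem one_add_mul_eq_inv {c : ℂ} {a b : ℂ⟦X⟧}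
    (h : a = PowerSeries.C c * invZSub (PowerSeries.C c * b)) :
    1 + a * b = (1 - PowerSeries.X * (PowerSeries.C c * b))⁻¹ := by
  have h1 := one_sub_X_mul_mul_inv (PowerSeries.C c * b)
  rw [invZSub] at h
  rw [h]
  linear_combination -h1

/-- The fixed point map of the saddle point equations. -/
noncomputable def saddleMap (g : (n : ℕ) → (Fin n → ℝ) → ℂ) (h : ℝ → ℝ) (a : ℝ → ℂ⟦X⟧) (x : ℝ) :
    ℂ⟦X⟧ :=
  PowerSeries.X * (PowerSeries.C (h x : ℂ) * (1 + a x * gradF₀ g a x))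

theorem coeff_mul_congr {f f' e e' : ℂ⟦X⟧} {n : ℕ}
    (hf : ∀ k < n, PowerSeries.coeff k f = PowerSeries.coeff k f')
    (he : ∀ k < n, PowerSeries.coeff k e = PowerSeries.coeff k e') {k : ℕ} (hk : k < n) :
    PowerSeries.coeff k (f * e) = PowerSeries.coeff k (f' * e') := by
  rw [PowerSeries.coeff_mul, PowerSeries.coeff_mul]
  refine Finset.sum_congr rfl fun c hc => ?_
  have := Finset.HasAntidiagonal.mem_antidiagonal.1 hc
  rw [hf _ (by omega), he _ (by omega)]

theorem coeff_prod_congr {ι : Type*} (s : Finset ι) {f f' : ι → ℂ⟦X⟧} {n : ℕ}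
    (hf : ∀ i, ∀ k < n, PowerSeries.coeff k (f i) = PowerSeries.coeff k (f' i)) {k : ℕ}
    (hk : k < n) : PowerSeries.coeff k (∏ i ∈ s, f i) = PowerSeries.coeff k (∏ i ∈ s, f' i) := by
  classical
  induction s using Finset.induction_on generalizing k with
  | empty => simp
  | insert i s hi ih =>
    rw [Finset.prod_insert hi, Finset.prod_insert hi]
    exact coeff_mul_congr (hf i) (fun k hk => ih hk) hk

theorem coeff_gradF₀_congr {a a' : ℝ → ℂ⟦X⟧} {n : ℕ}
    (ha : ∀ x, ∀ k < n, PowerSeries.coeff k (a x) = PowerSeries.coeff k (a' x)) (x : ℝ) {k : ℕ}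
    (hk : k < n) :
    PowerSeries.coeff k (gradF₀ g a x) = PowerSeries.coeff k (gradF₀ g a' x) := by
  simp only [gradF₀, PowerSeries.coeff_mk]
  refine Finset.sum_congr rfl fun m _ => ?_
  congr 1
  funext y
  rw [coeff_prod_congr _ (fun i => ha (y i)) hk]

/-- Coefficient `k` of `gradF₀` involves coefficients of `a` only up to `k`; the factor `X` then
improves agreement by one order. This is the contraction that makes the iteration converge. -/
theorem coeff_saddleMap_congr (h : ℝ → ℝ) {a a' : ℝ → ℂ⟦X⟧} {n : ℕ}
    (ha : ∀ x, ∀ k < n, PowerSeries.coeff k (a x) = PowerSeries.coeff k (a' x)) (x : ℝ) {k : ℕ}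
    (hk : k < n + 1) :
    PowerSeries.coeff k (saddleMap g h a x) = PowerSeries.coeff k (saddleMap g h a' x) := by
  cases k with
  | zero => simp [saddleMap]
  | succ k =>
    simp only [saddleMap, PowerSeries.coeff_succ_X_mul, PowerSeries.coeff_C_mul, map_add]
    rw [coeff_mul_congr (ha x) (fun k hk => coeff_gradF₀_congr ha x hk) (by omega : k < n)]

/-- Approximate solutions of the saddle point equations. -/
noncomputable def saddleIter (g : (n : ℕ) → (Fin n → ℝ) → ℂ) (h : ℝ → ℝ) : ℕ → ℝ → ℂ⟦X⟧
  | 0 => fun _ => 0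
  | n + 1 => saddleMap g h (saddleIter g h n)

theorem coeff_saddleIter_succ (h : ℝ → ℝ) (n : ℕ) :
    ∀ x, ∀ k < n, PowerSeries.coeff k (saddleIter g h (n + 1) x) =
      PowerSeries.coeff k (saddleIter g h n x) := by
  induction n with
  | zero => intro x k hk; omega
  | succ n ih => intro x k hk; exact coeff_saddleMap_congr h ih x hk

theorem coeff_saddleIter_eq (h : ℝ → ℝ) {n n' : ℕ} (hn : n ≤ n') (x : ℝ) {k : ℕ} (hk : k < n) :
    PowerSeries.coeff k (saddleIter g h n' x) = PowerSeries.coeff k (saddleIter g h n x) := by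
  induction n', hn using Nat.le_induction with
  | base => rfl
  | succ n' hn ih => rw [coeff_saddleIter_succ h n' x k (by omega), ih]

/-- The solution of the saddle point equations. -/
noncomputable def saddlePoint (g : (n : ℕ) → (Fin n → ℝ) → ℂ) (h : ℝ → ℝ) (x : ℝ) : ℂ⟦X⟧ :=
  PowerSeries.mk fun q => PowerSeries.coeff q (saddleIter g h (q + 1) x)

theorem saddleMap_saddlePoint (h : ℝ → ℝ) : saddleMap g h (saddlePoint g h) = saddlePoint g h := by
  have hag : ∀ n x, ∀ k < n, PowerSeries.coeff k (saddlePoint g h x) =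
      PowerSeries.coeff k (saddleIter g h n x) := by
    intro n x k hk
    rw [saddlePoint, PowerSeries.coeff_mk, ← coeff_saddleIter_eq h (Nat.succ_le_of_lt hk) x
      (Nat.lt_succ_self k)]
  funext x
  ext k
  rw [coeff_saddleMap_congr h (hag k) x (Nat.lt_succ_self k), hag (k + 1) x k (Nat.lt_succ_self k)]
  rfl

theorem isFieldSeries_saddleIter (hg : IsCyclicKernel g) {h : ℝ → ℝ}
    (hh : MemLp (fun x => (h x : ℂ)) ∞ unitMeasure) (n : ℕ) :
    IsFieldSeries (saddleIter g h n) := by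
  induction n with
  | zero => exact isFieldSeries_const 0
  | succ n ih =>
    exact (isFieldSeries_const _).mul ((isFieldSeries_C hh).mul
      ((isFieldSeries_const 1).add (ih.mul (isFieldSeries_gradF₀ hg ih))))

theorem isFieldSeries₀_saddlePoint (hg : IsCyclicKernel g) {h : ℝ → ℝ}
    (hh : MemLp (fun x => (h x : ℂ)) ∞ unitMeasure) : IsFieldSeries₀ (saddlePoint g h) := by
  refine ⟨fun k => ?_, fun x _ => ?_⟩
  · simp only [saddlePoint, PowerSeries.coeff_mk]
    exact isFieldSeries_saddleIter hg hh (k + 1) k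
  · rw [← saddleMap_saddlePoint]
    simp [saddleMap]

/-- The saddle point equations characterize the extrema of the action. -/
theorem isExtremum_iff (hg : IsCyclicKernel g) {h : ℝ → ℝ}
    (hh : MemLp (fun x => (h x : ℂ)) ∞ unitMeasure) {a b : ℝ → ℂ⟦X⟧} (ha : IsFieldSeries₀ a)
    (hb : IsFieldSeries b) :
    IsExtremum g h a b ↔
      (∀ᵐ x ∂unitMeasure,
        a x = PowerSeries.C (h x : ℂ) * invZSub (PowerSeries.C (h x : ℂ) * b x)) ∧
      IsFunctionalDerivF₀ g a b := by
  have hinv : IsFieldSeries fun x =>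
      PowerSeries.C (h x : ℂ) * invZSub (PowerSeries.C (h x : ℂ) * b x) :=
    (isFieldSeries_C hh).mul ((isFieldSeries_const _).mul ((isFieldSeries_C hh).mul hb).inv)
  have hres := ha.1.sub hinv
  have hlocal := fun (α β : ℝ → ℂ⟦X⟧) (hα : IsFieldSeries₀ α) (hβ : IsFieldSeries β) =>
    hasDerivAt_local_action hh ha.1 hb hα.1 hβ
  have hzero : IsFieldSeries₀ fun _ => 0 := ⟨isFieldSeries_const 0, fun _ _ => map_zero _⟩
  constructor
  · intro hext
    constructor
    · have hk : ∀ᵐ x ∂unitMeasure, ∀ k, PowerSeries.coeff k (a x -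
          PowerSeries.C (h x : ℂ) * invZSub (PowerSeries.C (h x : ℂ) * b x)) = 0 := by
        rw [ae_all_iff]
        intro k
        refine ae_eq_zero_of_forall_integral_mul (hres k) fun φ hφ => ?_
        -- Vary `b` alone, in the direction of a function `φ` independent of `z`; `F₀` does not
        -- change and the local part tests the residual of the first equation.
        have h1 := hext _ _ hzero (isFieldSeries_C hφ) k
        have h2 := (hlocal _ _ hzero (isFieldSeries_C hφ) k).sub
          (hasDerivAt_F₀ hg ha.1 hzero.1 k)
        have h3 := h2.unique (h1.congr_of_eventuallyEq
          (Eventually.of_forall fun t => by simp [action]))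
        rw [varF₀_eq_integral_gradF₀ hg ha hzero, coeff_fieldIntegral] at h3
        simpa [PowerSeries.coeff_mul_C] using h3
      filter_upwards [hk] with x hx
      rw [← sub_eq_zero]
      ext k
      simpa using hx k
    · intro α hα k
      -- Vary `a` alone. As `F₀` is the local part minus the action, and the action is stationary,
      -- its derivative is that of the local part, `∫ b α`.
      have h1 := hext _ _ hα (isFieldSeries_const 0) k
      have h2 := (hlocal _ _ hα (isFieldSeries_const 0) k).sub h1
      refine (h2.congr_of_eventuallyEq (Eventually.of_forall fun t => by
        simp [action])).congr_deriv ?_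
      rw [coeff_fieldIntegral]
      simp
  · rintro ⟨h1, h2⟩ α β hα hβ k
    have h3 := (hlocal _ _ hα hβ k).sub (h2 α hα k)
    refine (h3.congr_of_eventuallyEq (Eventually.of_forall fun t => by
        simp [action])).congr_deriv ?_
    rw [coeff_fieldIntegral, sub_eq_zero]
    apply integral_congr_ae
    filter_upwards [h1] with x hx
    rw [← hx]
    simp

theorem isExtremum_saddlePoint (hg : IsCyclicKernel g) {h : ℝ → ℝ}
    (hh : MemLp (fun x => (h x : ℂ)) ∞ unitMeasure) :
    IsExtremum g h (saddlePoint g h) (gradF₀ g (saddlePoint g h)) := by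
  have ha := isFieldSeries₀_saddlePoint hg hh
  have hb := isFieldSeries_gradF₀ hg ha.1
  rw [isExtremum_iff hg hh ha hb, isFunctionalDerivF₀_iff hg ha hb]
  refine ⟨Eventually.of_forall fun x => ?_, Eventually.of_forall fun x => rfl⟩
  rw [eq_mul_invZSub_iff]
  exact (congrFun (saddleMap_saddlePoint h) x).symm

/-- Euler's relation for the action at an extremum. -/
theorem mul_coeff_action (hg : IsCyclicKernel g) {h : ℝ → ℝ}
    (hh : MemLp (fun x => (h x : ℂ)) ∞ unitMeasure) {a b : ℝ → ℂ⟦X⟧} (ha : IsFieldSeries₀ a)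
    (hb : IsFieldSeries b)
    (hsaddle : ∀ᵐ x ∂unitMeasure,
      a x = PowerSeries.C (h x : ℂ) * invZSub (PowerSeries.C (h x : ℂ) * b x))
    (hderiv : IsFunctionalDerivF₀ g a b) (k : ℕ) :
    (k : ℂ) * PowerSeries.coeff k (action g h a b) =
      -∫ x, PowerSeries.coeff k (a x * b x) ∂unitMeasure := by
  have hθ : IsFieldSeries₀ fun x => eulerOp (a x) :=
    ⟨ha.1.eulerOp, fun x hx => by
      rw [← PowerSeries.coeff_zero_eq_constantCoeff_apply, coeff_eulerOp]; simp⟩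
  -- The direction `θ a` in the equation for `b` gives `k` times coefficient `k` of `F₀` as the
  -- coefficient of `∫ b θ a`.
  have h1 := (hasDerivAt_F₀ hg ha.1 hθ.1 k).unique (hderiv _ hθ k)
  rw [varF₀_eulerOp hg ha.1, coeff_fieldIntegral] at h1
  have hlog : IsFieldSeries fun x => logZSub (PowerSeries.C (h x : ℂ) * b x) + a x * b x :=
    (IsFieldSeries.logZSub ((isFieldSeries_C hh).mul hb)).add (ha.1.mul hb)
  rw [action, map_sub, mul_sub, h1, coeff_fieldIntegral, ← integral_const_mul,
    ← integral_sub ((hlog.integrable k).const_mul _) ((hb.mul hθ.1).integrable k),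
    ← integral_neg]
  apply integral_congr_ae
  filter_upwards [hsaddle] with x hx
  have h2 := mul_coeff_logZSub (PowerSeries.C (h x : ℂ) * b x) k
  -- By the saddle point equation, `θ` of the logarithm is `-(a b + a θ b)`. Adding `θ(a b) = a θ b
  -- + b θ a` and subtracting `b θ a` from `F₀` leaves only `-a b`.
  have h3 : PowerSeries.X * (PowerSeries.C (h x : ℂ) * b x + eulerOp (PowerSeries.C (h x : ℂ) * b x)) *
      (1 - PowerSeries.X * (PowerSeries.C (h x : ℂ) * b x))⁻¹ = a x * b x + a x * eulerOp (b x) := by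
    rw [invZSub] at hx
    rw [eulerOp_C_mul]
    linear_combination (-(b x) - eulerOp (b x)) * hx
  have h4 := coeff_eulerOp (a x * b x) k
  rw [Derivation.leibniz, smul_eq_mul, smul_eq_mul, map_add] at h4
  rw [h3, map_add] at h2
  rw [map_add, mul_add, h2, ← h4]
  ring

end SaddlePoint

/-! ### The generating functions at an extremum -/

section GeneratingFunctions

variable {Ω : ℕ → Type*} [∀ N, MeasurableSpace (Ω N)] {μ : ∀ N, Measure (Ω N)}
  {M : ∀ N, Ω N → Matrix (Fin N) (Fin N) ℂ} {g : (n : ℕ) → (Fin n → ℝ) → ℂ}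

theorem IsLocalFreeCumulants.isCyclicKernel (hM : IsLoopEnsemble μ M)
    (hg : IsLocalFreeCumulants μ M g) : IsCyclicKernel g where
  memLp := memLp_localFreeCumulants hM hg
  rotate m j := by
    filter_upwards [ae_injective_cube (m + 1), ae_cube_of_ae ae_mem_unit] with y h1 h2
    exact localFreeCumulants_rotate hM hg h2 h1 j

variable [∀ N, IsProbabilityMeasure (μ N)] {h : ℝ → ℝ}

/-- The coefficients of `1 + a b` satisfy the moment recursion: `a = X h (1 + a b)` gives the
relation between `a` and `d`, and `b = gradF₀` turns `a b` into the integral over first loops. -/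
theorem tendsto_traceMoment_saddle (hM : IsLoopEnsemble μ M) (hg : IsLocalFreeCumulants μ M g)
    {D : ℝ} (hpos : ∀ x ∈ Set.Icc (0 : ℝ) 1, 0 ≤ h x) (hD : ∀ x ∈ Set.Icc (0 : ℝ) 1, |h x| ≤ D)
    (h_cont : ∀ᵐ x ∂unitMeasure, ContinuousWithinAt h (Set.Icc (0 : ℝ) 1) x)
    {a b : ℝ → ℂ⟦X⟧} (ha : IsFieldSeries₀ a) (hb : IsFieldSeries b)
    (hsaddle : ∀ᵐ x ∂unitMeasure,
      a x = PowerSeries.C (h x : ℂ) * invZSub (PowerSeries.C (h x : ℂ) * b x))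
    (hderiv : IsFunctionalDerivF₀ g a b) (n : ℕ) :
    Tendsto (fun N => traceMoment (μ N) (M N) h n) atTop
      (𝓝 (∫ x, PowerSeries.coeff n (1 + a x * b x) ∂unitMeasure)) := by
  have hc := hg.isCyclicKernel hM
  have hgrad := (isFunctionalDerivF₀_iff hc ha hb).1 hderiv
  have ha0 := coeff_zero_of_fieldSeries₀ ha
  refine tendsto_traceMoment hM hpos hD (tendsto_diagMoment hM hg hpos hD h_cont
    (d := fun n x => PowerSeries.coeff n (1 + a x * b x)) ha0 ?_ ?_ ?_ n)
  · filter_upwards [hsaddle] with x hx n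
    conv_lhs => rw [eq_mul_invZSub_iff.1 hx]
    rw [PowerSeries.coeff_succ_X_mul, PowerSeries.coeff_C_mul]
  · filter_upwards [ha0] with x hx
    rw [PowerSeries.coeff_zero_eq_constantCoeff_apply] at hx
    simp [hx]
  · filter_upwards [hgrad, ae_all_iff.2 fun k => coeff_mul_gradF₀ hc ha ha k] with x h1 h2 n
    rw [map_add, PowerSeries.coeff_one, if_neg n.succ_ne_zero, zero_add, h1, h2]
    refine Finset.sum_congr rfl fun m _ => ?_
    congr 1
    funext y
    rw [Fin.prod_univ_succ, mul_comm]
    simp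

theorem tendsto_resolventSeries_saddle (hM : IsLoopEnsemble μ M) (hg : IsLocalFreeCumulants μ M g)
    {D : ℝ} (hpos : ∀ x ∈ Set.Icc (0 : ℝ) 1, 0 ≤ h x) (hD : ∀ x ∈ Set.Icc (0 : ℝ) 1, |h x| ≤ D)
    (h_cont : ∀ᵐ x ∂unitMeasure, ContinuousWithinAt h (Set.Icc (0 : ℝ) 1) x)
    {a b : ℝ → ℂ⟦X⟧} (ha : IsFieldSeries₀ a) (hb : IsFieldSeries b)
    (hsaddle : ∀ᵐ x ∂unitMeasure,
      a x = PowerSeries.C (h x : ℂ) * invZSub (PowerSeries.C (h x : ℂ) * b x))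
    (hderiv : IsFunctionalDerivF₀ g a b) (k : ℕ) :
    Tendsto (fun N => PowerSeries.coeff k (resolventSeries (μ N) (M N) h)) atTop
      (𝓝 (PowerSeries.coeff k
        (fieldIntegral fun x => invZSub (PowerSeries.C (h x : ℂ) * b x)))) := by
  rw [coeff_fieldIntegral]
  simp only [resolventSeries, invZSub]
  cases k with
  | zero => simp
  | succ k =>
    simp only [PowerSeries.coeff_succ_X_mul, PowerSeries.coeff_mk]
    convert tendsto_traceMoment_saddle hM hg hpos hD h_cont ha hb hsaddle hderiv k using 2
    apply integral_congr_ae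
    filter_upwards [hsaddle] with x hx
    rw [one_add_mul_eq_inv hx]

/-- For `k ≥ 1`, Euler's relation turns coefficient `k` of the action into `-1/k` times the limiting
moment; the constant term vanishes on both sides since `log z` has been removed. -/
theorem tendsto_traceLogSeries_saddle (hM : IsLoopEnsemble μ M) (hg : IsLocalFreeCumulants μ M g)
    {D : ℝ} (hpos : ∀ x ∈ Set.Icc (0 : ℝ) 1, 0 ≤ h x) (hD : ∀ x ∈ Set.Icc (0 : ℝ) 1, |h x| ≤ D)
    (h_cont : ∀ᵐ x ∂unitMeasure, ContinuousWithinAt h (Set.Icc (0 : ℝ) 1) x)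
    {a b : ℝ → ℂ⟦X⟧} (ha : IsFieldSeries₀ a) (hb : IsFieldSeries b)
    (hsaddle : ∀ᵐ x ∂unitMeasure,
      a x = PowerSeries.C (h x : ℂ) * invZSub (PowerSeries.C (h x : ℂ) * b x))
    (hderiv : IsFunctionalDerivF₀ g a b) (k : ℕ) :
    Tendsto (fun N => PowerSeries.coeff k (traceLogSeries (μ N) (M N) h)) atTop
      (𝓝 (PowerSeries.coeff k (action g h a b))) := by
  have hc := hg.isCyclicKernel hM
  have hmul := mul_coeff_action hc (memLp_profile hD h_cont) ha hb hsaddle hderiv k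
  simp only [traceLogSeries, PowerSeries.coeff_mk]
  cases k with
  | zero =>
    have h0 : PowerSeries.coeff 0 (action g h a b) = 0 := by
      rw [action, map_sub, coeff_fieldIntegral, coeff_F₀, Finset.Icc_eq_empty (by omega),
        Finset.sum_empty, sub_zero]
      apply integral_eq_zero_of_ae
      filter_upwards [coeff_zero_of_fieldSeries₀ ha] with x hx
      rw [PowerSeries.coeff_zero_eq_constantCoeff_apply] at hx
      rw [map_add, coeff_logZSub]
      simp [hx]
    rw [h0]
    simp
  | succ k =>
    have hk : ((k + 1 : ℕ) : ℂ) ≠ 0 := by exact_mod_cast k.succ_ne_zero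
    simp only [k.succ_ne_zero, if_false]
    have h1 : PowerSeries.coeff (k + 1) (action g h a b) =
        -((∫ x, PowerSeries.coeff (k + 1) (1 + a x * b x) ∂unitMeasure) / ((k + 1 : ℕ) : ℂ)) := by
      simp only [map_add, PowerSeries.coeff_one, k.succ_ne_zero, if_false, zero_add]
      rw [← neg_div, ← hmul, mul_div_cancel_left₀ _ hk]
    rw [h1]
    exact ((tendsto_traceMoment_saddle hM hg hpos hD h_cont ha hb hsaddle hderiv
      (k + 1)).div_const _).neg

end GeneratingFunctions

theorem theorem1 {Ω : ℕ → Type*} [∀ N, MeasurableSpace (Ω N)]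
    (μ : ∀ N, Measure (Ω N)) [∀ N, IsProbabilityMeasure (μ N)]
    (M : ∀ N, Ω N → Matrix (Fin N) (Fin N) ℂ) (hM : IsLoopEnsemble μ M)
    (g : (n : ℕ) → (Fin n → ℝ) → ℂ) (hg : IsLocalFreeCumulants μ M g)
    (h : ℝ → ℝ) (h_nonneg : ∀ x ∈ Set.Icc (0 : ℝ) 1, 0 ≤ h x)
    (h_bdd : ∃ C : ℝ, ∀ x ∈ Set.Icc (0 : ℝ) 1, h x ≤ C)
    (h_cont : ∀ᵐ x ∂(volume.restrict (Set.Icc (0 : ℝ) 1)),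
      ContinuousWithinAt h (Set.Icc (0 : ℝ) 1) x) :
    (∃ a b : ℝ → ℂ⟦X⟧, IsFieldSeries₀ a ∧ IsFieldSeries b ∧ IsExtremum g h a b) ∧
    ∀ a b : ℝ → ℂ⟦X⟧, IsFieldSeries₀ a → IsFieldSeries b →
      (IsExtremum g h a b ↔
        (∀ᵐ x ∂(volume.restrict (Set.Icc (0 : ℝ) 1)),
          a x = PowerSeries.C (h x : ℂ) * invZSub (PowerSeries.C (h x : ℂ) * b x)) ∧
        IsFunctionalDerivF₀ g a b) ∧
      (IsExtremum g h a b →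
        (∀ k : ℕ, Tendsto
          (fun N => PowerSeries.coeff k (traceLogSeries (μ N) (M N) h)) atTop
          (𝓝 (PowerSeries.coeff k (action g h a b)))) ∧
        (∀ k : ℕ, Tendsto
          (fun N => PowerSeries.coeff k (resolventSeries (μ N) (M N) h)) atTop
          (𝓝 (PowerSeries.coeff k
            (fieldIntegral fun x => invZSub (PowerSeries.C (h x : ℂ) * b x)))))) := by
  obtain ⟨D, hD⟩ := h_bdd
  have hD' : ∀ x ∈ Set.Icc (0 : ℝ) 1, |h x| ≤ D := fun x hx => by
    rw [abs_of_nonneg (h_nonneg x hx)]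
    exact hD x hx
  have hh := memLp_profile hD' h_cont
  have hc := hg.isCyclicKernel hM
  have ha := isFieldSeries₀_saddlePoint hc hh
  refine ⟨⟨_, _, ha, isFieldSeries_gradF₀ hc ha.1, isExtremum_saddlePoint hc hh⟩,
    fun a b ha hb => ⟨isExtremum_iff hc hh ha hb, fun hext => ?_⟩⟩
  obtain ⟨hsaddle, hderiv⟩ := (isExtremum_iff hc hh ha hb).1 hext
  exact ⟨tendsto_traceLogSeries_saddle hM hg h_nonneg hD' h_cont ha hb hsaddle hderiv,
    tendsto_resolventSeries_saddle hM hg h_nonneg hD' h_cont ha hb hsaddle hderiv⟩
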